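/- Let $G=(V,E,w)$ be a finite undirected weighted graph without loops, with $V=\{0,\dots,n-1\}$, $m=|E|$, $w:E\to\mathbb{R}_{\ge 0}$, and all weighted degrees $d_G(u)=\sum_{v\sim u}w(u,v)$ positive. Let $A_G$ be its adjacency matrix, $D_G$ its degree matrix, $\mathcal{L}_G=I-D_G^{-1/2}A_GD_G^{-1/2}$ and $\mathcal{J}_G=I+D_G^{-1/2}A_GD_G^{-1/2}$; $\lambda_1(M)\le\dots\le\lambda_n(M)$ are the eigenvalues of a symmetric matrix $M$, and $\lambda_j=\lambda_j(\mathcal{L}_G)$. For disjoint $A,B\subseteq V$ let $\overline{\phi}_G(A,B)=2w_G(A,B)/\mathrm{vol}_G(A\cup B)$, where $w_G(A,B)=\sum_{u\in A,\,v\in B,\,\{u,v\}\in E}w(u,v)$ and $\mathrm{vol}_G(S)=\sum_{u\in S}d_G(u)$, and let $$\bar\rho_G(k)=\max_{(A_1,B_1),\dots,(A_k,B_k)}\ \min_{1\le i\le k}\overline{\phi}_G(A_i,B_i),$$ the maximum being over all families in which the $2k$ sets $A_1,B_1,\dots,A_k,B_k$ are pairwise disjoint and every $A_i\cup B_i$ is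 nonempty. (For a graph with vertices of degree $0$, the corresponding entries of $D^{-1/2}$ are read as $0$, and a fraction $0/0$ as $0$.) For $C,\ell>0$ put $p_u(v)=\min\left\{w(u,v)\cdot\frac{C\log^3 n}{d_G(u)\,\ell},\,1\right\}$ and $p_e=p_u(v)+p_v(u)-p_u(v)\,p_v(u)$ for $e=\{u,v\}\in E$. The random graph $G^*=(V,F,\widetilde w)$ is obtained by putting every edge $e\in E$ into $F$ independently with probability $p_e$, and setting $\widetilde w(e)=w(e)/p_e$ for $e\in F$. **Theorem.** Let $k\ge 1$ and $c\ge 0$ be integers and let $a\ge 1$ be real. There are constants $C_0,\alpha,\beta,\gamma>0$, depending only on $k,c,a$, such that for every $C\ge C_0$ there are constants $K,T,d$ and a randomized algorithm (a program for a unit-cost real RAM with arithmetic, comparison, logarithm and biased coin flips) with the following property. Let $G$ be a graph as above with $k<n$, $\bar\rho_G(k)\ge\frac{1}{\log n}$ and $\lambda_{n-k}<2$, and let $\ell$ be a real number with $\frac1a(2-\lambda_{n-k})\le\ell\le a(2-\lambda_{n-k})$ (for instance $\ell=2-\lambda_{n-k}$). Given $n$, $m$, a list of the weighted edges of $G$,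 and $\ell$, the algorithm always stops after at most $T\,m\log^d n$ steps, it outputs a list of the weighted edges of the random graph $G^*$ defined above, and with probability at least $1-n^{-c}$ $$|F|\le K\,\frac{n\log^3 n}{2-\lambda_{n-k}},\qquad \bar\rho_{G^*}(k)\ge\alpha\,\bar\rho_G(k),\qquad \beta\,\lambda_{k+1}(\mathcal{J}_G)\le\lambda_{k+1}(\mathcal{J}_{G^*})\le\gamma\,\lambda_{k+1}(\mathcal{J}_G).$$ -/

import Mathlib

open scoped NNReal ENNReal

noncomputable section

/-! ## Weighted graphs -/

/-- A finite undirected weighted graph `(V, E, w)` on the vertex set `V = {0, …, n - 1}`: a set of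
unordered pairs without loops and a weight function `w : E → ℝ≥0`, extended by `0` off `E`. -/
structure WGraph (n : ℕ) where
  edges : Finset (Sym2 (Fin n))
  loopless : ∀ e ∈ edges, ¬ e.IsDiag
  weight : Sym2 (Fin n) → ℝ≥0
  weight_eq_zero : ∀ e, e ∉ edges → weight e = 0

namespace WGraph

variable {n : ℕ}

/-- The weight `w(u, v)` as a real number (`0` if `u` and `v` are not adjacent). -/
def wt (G : WGraph n) (u v : Fin n) : ℝ := (G.weight s(u, v) : ℝ)

theorem wt_comm (G : WGraph n) (u v : Fin n) : G.wt u v = G.wt v u := by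
  simp only [wt, Sym2.eq_swap]

/-- The weighted degree `d(u)`. -/
def deg (G : WGraph n) (u : Fin n) : ℝ := ∑ v, G.wt u v

/-- The volume of a vertex set: the sum of the degrees. -/
def vol (G : WGraph n) (S : Finset (Fin n)) : ℝ := ∑ u ∈ S, G.deg u

/-- The cut value `w(A, B)` between disjoint sets `A` and `B`. -/
def cut (G : WGraph n) (A B : Finset (Fin n)) : ℝ := ∑ u ∈ A, ∑ v ∈ B, G.wt u v

/-- `2 w(A, B) / vol(A ∪ B)`. -/
def phiBar (G : WGraph n) (A B : Finset (Fin n)) : ℝ := 2 * G.cut A B / G.vol (A ∪ B)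

/-- The families `(A₁, B₁), …, (A_k, B_k)` over which the `k`-way dual Cheeger constant is taken:
the `2k` sets are pairwise disjoint and each `Aᵢ ∪ Bᵢ` is nonempty. -/
def IsPairFamily {k : ℕ} (A B : Fin k → Finset (Fin n)) : Prop :=
  (∀ i, Disjoint (A i) (B i)) ∧ (∀ i, (A i ∪ B i).Nonempty) ∧
    ∀ i j, i ≠ j → Disjoint (A i) (A j) ∧ Disjoint (B i) (B j) ∧ Disjoint (A i) (B j)

/-- The `k`-way dual Cheeger constant (the supremum is over a finite set, hence a maximum
whenever `1 ≤ k ≤ n`). -/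
def rhoBar (G : WGraph n) (k : ℕ) : ℝ :=
  sSup {r | ∃ A B : Fin k → Finset (Fin n), IsPairFamily A B ∧ r = ⨅ i, G.phiBar (A i) (B i)}

/-- The adjacency matrix. -/
def adj (G : WGraph n) : Matrix (Fin n) (Fin n) ℝ := Matrix.of fun u v => G.wt u v

/-- `D^{-1/2}`. -/
def degInvSqrt (G : WGraph n) : Matrix (Fin n) (Fin n) ℝ :=
  Matrix.diagonal fun u => (Real.sqrt (G.deg u))⁻¹

/-- `D^{-1/2} A D^{-1/2}`. -/
def normAdj (G : WGraph n) : Matrix (Fin n) (Fin n) ℝ := G.degInvSqrt * G.adj * G.degInvSqrt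

/-- The normalised Laplacian `L = I - D^{-1/2} A D^{-1/2}`. -/
def lap (G : WGraph n) : Matrix (Fin n) (Fin n) ℝ := 1 - G.normAdj

/-- `J = I + D^{-1/2} A D^{-1/2}`. -/
def signless (G : WGraph n) : Matrix (Fin n) (Fin n) ℝ := 1 + G.normAdj

theorem isHermitian_normAdj (G : WGraph n) : G.normAdj.IsHermitian := by
  ext u v
  simp [normAdj, degInvSqrt, adj, Matrix.diagonal_mul, Matrix.mul_diagonal, G.wt_comm v u]
  ring

theorem isHermitian_lap (G : WGraph n) : G.lap.IsHermitian :=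
  Matrix.isHermitian_one.sub G.isHermitian_normAdj

theorem isHermitian_signless (G : WGraph n) : G.signless.IsHermitian :=
  Matrix.isHermitian_one.add G.isHermitian_normAdj

end WGraph

/-- The `j`-th smallest eigenvalue `λ_j(M)` of a real symmetric `n × n` matrix, `1 ≤ j ≤ n`, counted
with multiplicity (Mathlib's `eigenvalues₀` lists the eigenvalues in decreasing order). -/
def eigAsc {n : ℕ} (M : Matrix (Fin n) (Fin n) ℝ) (hM : M.IsHermitian) (j : ℕ) : ℝ :=
  if h : 1 ≤ j ∧ j ≤ n then
    hM.eigenvalues₀ ⟨n - j, by rw [Fintype.card_fin]; omega⟩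
  else 0

namespace WGraph

variable {n : ℕ}

/-- `λ_j(L_G)`. -/
def lapEig (G : WGraph n) (j : ℕ) : ℝ := eigAsc G.lap G.isHermitian_lap j

/-- `λ_j(J_G)`. -/
def signlessEig (G : WGraph n) (j : ℕ) : ℝ := eigAsc G.signless G.isHermitian_signless j

/-! ## The sampling scheme -/

/-- `p_u(v) = min {w(u, v) · C log³ n / (d(u) · ℓ), 1}`. -/
def halfProb (G : WGraph n) (C ℓ : ℝ) (u v : Fin n) : ℝ :=
  min (G.wt u v * (C * Real.log n ^ 3 / (G.deg u * ℓ))) 1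

/-- `p_e = p_u(v) + p_v(u) - p_u(v) p_v(u)` for `e = {u, v}`. -/
def edgeProb (G : WGraph n) (C ℓ : ℝ) : Sym2 (Fin n) → ℝ :=
  Sym2.lift ⟨fun u v =>
    G.halfProb C ℓ u v + G.halfProb C ℓ v u - G.halfProb C ℓ u v * G.halfProb C ℓ v u,
    fun u v => by ring⟩

/-- The graph `(V, F, w̃)` with `w̃(e) = w(e) / p_e` for `e ∈ F`. (For `C, ℓ ≥ 0` one has `p_e ≥ 0`,
and `toNNReal` only records that.) -/
def sparsifier (G : WGraph n) (C ℓ : ℝ) (F : Finset (Sym2 (Fin n))) (hF : F ⊆ G.edges) :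
    WGraph n where
  edges := F
  loopless e he := G.loopless e (hF he)
  weight e := if e ∈ F then G.weight e / (G.edgeProb C ℓ e).toNNReal else 0
  weight_eq_zero e he := by simp [he]

/-- The three arrays `src`, `dst`, `wts` list, in their first `m` cells, the edges of `G`, each edge
exactly once, in some order and with some orientation, together with their weights. -/
def StoredIn (G : WGraph n) (m : ℕ) (src dst : ℕ → ℕ) (wts : ℕ → ℝ) : Prop :=
  ∃ e : Fin m ≃ G.edges, ∀ i : Fin m, ∃ u v : Fin n,
    (e i : Sym2 (Fin n)) = s(u, v) ∧ src i = u ∧ dst i = v ∧ wts i = G.weight (e i)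

end WGraph

/-! ## The computational model: a randomized real RAM with unit costs

Programs work on natural-number registers and arrays (counters, addresses) and on real registers
and arrays. Natural numbers can only be copied, added, subtracted and compared. Real numbers can be
copied, added, subtracted, multiplied, divided and compared, and logarithms can be taken. Coins of
a given bias can be flipped. Every elementary operation costs one step. Registers and arrays are
named by constants in the program; only array cells are addressed dynamically. -/

/-- The memory. -/
structure Mem where
  nreg : ℕ → ℕ
  rreg : ℕ → ℝ
  narr : ℕ → ℕ → ℕ
  rarr : ℕ → ℕ → ℝ

/-- Elementary deterministic operations. -/
inductive Op where
  /-- `nreg i := c` -/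
  | nconst (i c : ℕ)
  /-- `nreg i := nreg j + nreg k` -/
  | nadd (i j k : ℕ)
  /-- `nreg i := nreg j - nreg k` (truncated) -/
  | nsub (i j k : ℕ)
  /-- `nreg i := (narr a)[nreg j]` -/
  | nload (i a j : ℕ)
  /-- `(narr a)[nreg j] := nreg i` -/
  | nstore (a j i : ℕ)
  /-- `rreg i := c` -/
  | rconst (i : ℕ) (c : ℝ)
  /-- `rreg i := nreg j` -/
  | rcast (i j : ℕ)
  /-- `rreg i := rreg j + rreg k` -/
  | radd (i j k : ℕ)
  /-- `rreg i := rreg j - rreg k` -/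
  | rsub (i j k : ℕ)
  /-- `rreg i := rreg j * rreg k` -/
  | rmul (i j k : ℕ)
  /-- `rreg i := rreg j / rreg k` -/
  | rdiv (i j k : ℕ)
  /-- `rreg i := log (rreg j)` -/
  | rlog (i j : ℕ)
  /-- `rreg i := (rarr a)[nreg j]` -/
  | rload (i a j : ℕ)
  /-- `(rarr a)[nreg j] := rreg i` -/
  | rstore (a j i : ℕ)

/-- The effect of an elementary operation. -/
def Op.run : Op → Mem → Mem
  | .nconst i c, s => { s with nreg := Function.update s.nreg i c }
  | .nadd i j k, s => { s with nreg := Function.update s.nreg i (s.nreg j + s.nreg k) }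
  | .nsub i j k, s => { s with nreg := Function.update s.nreg i (s.nreg j - s.nreg k) }
  | .nload i a j, s => { s with nreg := Function.update s.nreg i (s.narr a (s.nreg j)) }
  | .nstore a j i, s =>
      let cell := Function.update (s.narr a) (s.nreg j) (s.nreg i)
      { s with narr := Function.update s.narr a cell }
  | .rconst i c, s => { s with rreg := Function.update s.rreg i c }
  | .rcast i j, s => { s with rreg := Function.update s.rreg i (s.nreg j : ℝ) }
  | .radd i j k, s => { s with rreg := Function.update s.rreg i (s.rreg j + s.rreg k) }
  | .rsub i j k, s => { s with rreg := Function.update s.rreg i (s.rreg j - s.rreg k) }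
  | .rmul i j k, s => { s with rreg := Function.update s.rreg i (s.rreg j * s.rreg k) }
  | .rdiv i j k, s => { s with rreg := Function.update s.rreg i (s.rreg j / s.rreg k) }
  | .rlog i j, s => { s with rreg := Function.update s.rreg i (Real.log (s.rreg j)) }
  | .rload i a j, s => { s with rreg := Function.update s.rreg i (s.rarr a (s.nreg j)) }
  | .rstore a j i, s =>
      let cell := Function.update (s.rarr a) (s.nreg j) (s.rreg i)
      { s with rarr := Function.update s.rarr a cell }

/-- Programs. -/
inductive Prog where
  /-- do nothing -/
  | skip
  /-- an elementary operation -/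
  | op (o : Op)
  /-- `nreg i := 1` with probability `rreg j` (clamped to `[0, 1]`), and `nreg i := 0` otherwise,
  independently of everything before -/
  | flip (i j : ℕ)
  /-- sequential composition -/
  | seq (P Q : Prog)
  /-- if `nreg i ≤ nreg j` then `P` else `Q` -/
  | ifNat (i j : ℕ) (P Q : Prog)
  /-- if `rreg i ≤ rreg j` then `P` else `Q` -/
  | ifReal (i j : ℕ) (P Q : Prog)
  /-- repeat `P` as many times as the value of `nreg i` on entry says -/
  | loop (i : ℕ) (P : Prog)

/-- A coin that shows `true` with probability `x`, clamped to `[0, 1]`. -/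
def coin (x : ℝ) : PMF Bool :=
  PMF.ofFintype (fun b => if b then min 1 (ENNReal.ofReal x) else 1 - min 1 (ENNReal.ofReal x))
    (by simp [add_tsub_cancel_of_le])

/-- `r` rounds of a random computation with step count; every test of the loop counter costs one
more step. -/
def iterRounds (f : Mem → PMF (Mem × ℕ)) : ℕ → Mem → PMF (Mem × ℕ)
  | 0, s => PMF.pure (s, 1)
  | r + 1, s => (f s).bind fun x => (iterRounds f r x.1).map fun y => (y.1, x.2 + y.2 + 1)

open scoped Classical in
/-- The joint law of the final memory and of the number of steps of a program. -/
def Prog.exec : Prog → Mem → PMF (Mem × ℕ)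
  | .skip, s => PMF.pure (s, 1)
  | .op o, s => PMF.pure (o.run s, 1)
  | .flip i j, s =>
      (coin (s.rreg j)).map fun b =>
        ({ s with nreg := Function.update s.nreg i (if b then 1 else 0) }, 1)
  | .seq P Q, s =>
      (P.exec s).bind fun x => (Q.exec x.1).map fun y => (y.1, x.2 + y.2)
  | .ifNat i j P Q, s =>
      (if s.nreg i ≤ s.nreg j then P.exec s else Q.exec s).map fun x => (x.1, x.2 + 1)
  | .ifReal i j P Q, s =>
      (if s.rreg i ≤ s.rreg j then P.exec s else Q.exec s).map fun x => (x.1, x.2 + 1)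
  | .loop i P, s => iterRounds P.exec (s.nreg i) s

/-- The initial memory: `nreg 0` and `nreg 1` hold `n` and `m`, `rreg 0` holds a real parameter,
and `narr 0`, `narr 1`, `rarr 0` hold the edge list; everything else is `0`. -/
def inputMem (n m : ℕ) (ℓ : ℝ) (src dst : ℕ → ℕ) (wts : ℕ → ℝ) : Mem where
  nreg := fun i => if i = 0 then n else if i = 1 then m else 0
  rreg := fun i => if i = 0 then ℓ else 0
  narr := fun a => if a = 0 then src else if a = 1 then dst else fun _ => 0
  rarr := fun a => if a = 0 then wts else fun _ => 0

/-- The final memory holds the graph `H` as output: `nreg 2` is its number of edges, and `narr 2`,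
`narr 3`, `rarr 1` hold its edge list. -/
def Outputs {n : ℕ} (s : Mem) (H : WGraph n) : Prop :=
  H.StoredIn (s.nreg 2) (s.narr 2) (s.narr 3) (s.rarr 1)

end

/-! Write `r = ℓ / (C log³ n)`, `L = log n` and `μ = λ_{k+1}(J_G) = 2 - λ_{n-k}(L_G)`. Since `p_e ≥
p_u(v)` and `p_e ≥ p_v(u)`, every edge either has `p_e = 1`, so that it contributes no randomness,
or has sampled weight `w(e) / p_e` at most `r d(u)` and at most `r d(v)`. All concentration comes
from this dichotomy, and the tail bounds are stated so that summands of probability one may have any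
size.

Scalar Chernoff bounds control the number of edges (mean at most `n / r`), all degrees (up to the
factors 1/4 and 3), and the cuts of one optimal family `(A_i, B_i)`. The assumption on the dual
Cheeger constant gives each of these cuts mean at least `vol / (2 L)`, while its random summands are
at most `r vol`. Losing 4 in the cuts and 3 in the volumes gives `α = 1/12`.

For the spectrum, `J_G` is replaced by the form `energy y = ∑ w(u,v) (y u + y v)²` relative to `mass
y = ∑ d(u) (y u)²`, so that both graphs live on the same space of functions. Cauchy–Schwarz shows
that the functional `y ↦ y u + y v` has squared dual norm at most `1/d(u) + 1/d(v)`; multiplied by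
the sampled weight of a random edge this is at most `2 r`. In the upper bound the test space is
spanned by the lowest `k + 1` eigenfunctions. The sampled energy there is bounded by its trace, a
scalar sum with mean at most `(k + 1) μ`, so a scalar Chernoff bound is enough
(`signlessEig_sparsifier_le`, `subsetProb_bottom_tail`). In the lower bound the test space is the
span of the top `n - k` eigenfunctions. Normalised by the energy, the edges become random rank-one
matrices with expectation the identity and squared length at most `2 r / μ`, to which a matrix lower
tail applies (`subsetProb_rankOne_lower_tail`, `le_signlessEig_sparsifier`).

The matrix lower tail is proved with the potential `tr M^{-q}`. The coins are removed one at a time: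
replacing a random update `x xᵀ` by the deterministic `(p / 2) x xᵀ` does not decrease the expected
potential (`invPowTrace_coin_le`). The final deterministic matrix has small potential, a small
eigenvalue would force a large one, and Markov's inequality concludes.

The program accumulates degrees in one pass and flips the coins in a second pass. Its run is coupled
with the random subset of the edges; the coupling transfers the exact law, the probability bound and
the worst-case running time (`coupled_sampleProg`). -/

/-! ## Random subsets: each `e ∈ s` is kept independently with probability `p e` -/

section RandomSubset

variable {α : Type*} [DecidableEq α]

/-- The probability that the random subset of `s` equals `F`. -/
noncomputable def subsetWeight (s : Finset α) (p : α → ℝ) (F : Finset α) : ℝ :=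
  (∏ e ∈ F, p e) * ∏ e ∈ s \ F, (1 - p e)

/-- The expectation of `f` at the random subset of `s`. -/
noncomputable def subsetExp (s : Finset α) (p : α → ℝ) (f : Finset α → ℝ) : ℝ :=
  ∑ F ∈ s.powerset, subsetWeight s p F * f F

open scoped Classical in
/-- The probability that the random subset of `s` has the property `S`. -/
noncomputable def subsetProb (s : Finset α) (p : α → ℝ) (S : Finset α → Prop) : ℝ :=
  subsetExp s p fun F => if S F then 1 else 0

theorem subsetWeight_nonneg {s : Finset α} {p : α → ℝ} (h0 : ∀ e ∈ s, 0 ≤ p e)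
    (h1 : ∀ e ∈ s, p e ≤ 1) {F : Finset α} (hF : F ⊆ s) : 0 ≤ subsetWeight s p F :=
  mul_nonneg (Finset.prod_nonneg fun e he => h0 e (hF he))
    (Finset.prod_nonneg fun e he => sub_nonneg.2 (h1 e (Finset.mem_sdiff.1 he).1))

theorem subsetExp_mono {s : Finset α} {p : α → ℝ} (h0 : ∀ e ∈ s, 0 ≤ p e)
    (h1 : ∀ e ∈ s, p e ≤ 1) {f g : Finset α → ℝ} (h : ∀ F ⊆ s, f F ≤ g F) :
    subsetExp s p f ≤ subsetExp s p g :=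
  Finset.sum_le_sum fun F hF => mul_le_mul_of_nonneg_left (h F (Finset.mem_powerset.1 hF))
    (subsetWeight_nonneg h0 h1 (Finset.mem_powerset.1 hF))

theorem subsetExp_const_mul (s : Finset α) (p : α → ℝ) (r : ℝ) (f : Finset α → ℝ) :
    subsetExp s p (fun F => r * f F) = r * subsetExp s p f := by
  simp only [subsetExp, Finset.mul_sum]
  exact Finset.sum_congr rfl fun F _ => by ring

theorem subsetExp_add (s : Finset α) (p : α → ℝ) (f g : Finset α → ℝ) :
    subsetExp s p (fun F => f F + g F) = subsetExp s p f + subsetExp s p g := by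
  simp only [subsetExp, mul_add, Finset.sum_add_distrib]

/-- Independence in the form needed for exponential moments: multiplying out the product on the
right gives one term for each subset. -/
theorem subsetExp_prod (s : Finset α) (p g : α → ℝ) :
    subsetExp s p (fun F => ∏ e ∈ F, g e) = ∏ e ∈ s, (1 - p e + p e * g e) := by
  rw [Finset.prod_congr rfl fun e _ => add_comm (1 - p e) (p e * g e), Finset.prod_add]
  refine Finset.sum_congr rfl fun F _ => ?_
  rw [subsetWeight, Finset.prod_mul_distrib]
  ring

theorem subsetExp_one (s : Finset α) (p : α → ℝ) : subsetExp s p (fun _ => 1) = 1 := by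
  have := subsetExp_prod s p (fun _ => 1)
  simpa using this

/-- Conditioning on one coin. Both the potential argument and the law of the program are inductions
based on it. -/
theorem subsetExp_insert {a : α} {s : Finset α} (ha : a ∉ s) (p : α → ℝ) (f : Finset α → ℝ) :
    subsetExp (insert a s) p f =
      (1 - p a) * subsetExp s p f + p a * subsetExp s p fun F => f (insert a F) := by
  rw [subsetExp, Finset.sum_powerset_insert ha, subsetExp, subsetExp, Finset.mul_sum,
    Finset.mul_sum]
  congr 1
  · refine Finset.sum_congr rfl fun F hF => ?_
    have haF : a ∉ F := fun h => ha (Finset.mem_powerset.1 hF h)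
    rw [subsetWeight, subsetWeight, Finset.insert_sdiff_of_notMem _ haF,
      Finset.prod_insert (by simp [ha])]
    ring
  · refine Finset.sum_congr rfl fun F hF => ?_
    have haF : a ∉ F := fun h => ha (Finset.mem_powerset.1 hF h)
    have hs : insert a s \ insert a F = s \ F := by
      ext x
      simp only [Finset.mem_sdiff, Finset.mem_insert]
      constructor
      · rintro ⟨rfl | h, h'⟩
        · simp at h'
        · exact ⟨h, fun hx => h' (Or.inr hx)⟩
      · rintro ⟨h, h'⟩
        exact ⟨Or.inr h, by rintro (rfl | hx); exacts [ha h, h' hx]⟩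
    rw [subsetWeight, subsetWeight, Finset.prod_insert haF, hs]
    ring

theorem subsetProb_nonneg {s : Finset α} {p : α → ℝ} (h0 : ∀ e ∈ s, 0 ≤ p e)
    (h1 : ∀ e ∈ s, p e ≤ 1) (S : Finset α → Prop) : 0 ≤ subsetProb s p S :=
  Finset.sum_nonneg fun F hF => mul_nonneg
    (subsetWeight_nonneg h0 h1 (Finset.mem_powerset.1 hF)) (by dsimp only; split_ifs <;> norm_num)

theorem subsetProb_mono {s : Finset α} {p : α → ℝ} (h0 : ∀ e ∈ s, 0 ≤ p e)
    (h1 : ∀ e ∈ s, p e ≤ 1) {S T : Finset α → Prop} (h : ∀ F ⊆ s, S F → T F) :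
    subsetProb s p S ≤ subsetProb s p T := by
  classical
  refine subsetExp_mono h0 h1 fun F hF => ?_
  by_cases hS : S F
  · simp [hS, h F hF hS]
  · simp only [hS, if_false]
    split_ifs <;> norm_num

theorem subsetProb_not (s : Finset α) (p : α → ℝ) (S : Finset α → Prop) :
    subsetProb s p (fun F => ¬ S F) = 1 - subsetProb s p S := by
  classical
  rw [eq_sub_iff_add_eq, subsetProb, subsetProb, ← subsetExp_add]
  refine Eq.trans (congrArg _ (funext fun F => ?_)) (subsetExp_one s p)
  by_cases h : S F <;> simp [h]

theorem subsetProb_or_le {s : Finset α} {p : α → ℝ} (h0 : ∀ e ∈ s, 0 ≤ p e)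
    (h1 : ∀ e ∈ s, p e ≤ 1) (S T : Finset α → Prop) :
    subsetProb s p (fun F => S F ∨ T F) ≤ subsetProb s p S + subsetProb s p T := by
  classical
  rw [subsetProb, subsetProb, subsetProb, ← subsetExp_add]
  refine subsetExp_mono h0 h1 fun F _ => ?_
  by_cases hS : S F <;> by_cases hT : T F <;> simp [hS, hT]

theorem subsetProb_exists_le {s : Finset α} {p : α → ℝ} (h0 : ∀ e ∈ s, 0 ≤ p e)
    (h1 : ∀ e ∈ s, p e ≤ 1) {ι : Type*} [Fintype ι] (S : ι → Finset α → Prop) {b : ℝ}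
    (hb : ∀ i, subsetProb s p (S i) ≤ b) :
    subsetProb s p (fun F => ∃ i, S i F) ≤ Fintype.card ι * b := by
  classical
  have h : subsetProb s p (fun F => ∃ i, S i F) ≤ ∑ i, subsetProb s p (S i) := by
    simp only [subsetProb, subsetExp]
    rw [Finset.sum_comm]
    refine Finset.sum_le_sum fun F hF => ?_
    rw [← Finset.mul_sum]
    refine mul_le_mul_of_nonneg_left ?_ (subsetWeight_nonneg h0 h1 (Finset.mem_powerset.1 hF))
    have hnn : ∀ i ∈ Finset.univ, (0 : ℝ) ≤ if S i F then 1 else 0 := fun i _ => by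
      split_ifs <;> norm_num
    by_cases hF' : ∃ i, S i F
    · obtain ⟨i, hi⟩ := hF'
      have := Finset.single_le_sum hnn (Finset.mem_univ i)
      rw [if_pos ⟨i, hi⟩]
      simpa [hi] using this
    · rw [if_neg hF']
      exact Finset.sum_nonneg hnn
  refine h.trans ((Finset.sum_le_sum fun i _ => hb i).trans ?_)
  simp

theorem subsetProb_le_of_markov {s : Finset α} {p : α → ℝ} (h0 : ∀ e ∈ s, 0 ≤ p e)
    (h1 : ∀ e ∈ s, p e ≤ 1) {S : Finset α → Prop} {f : Finset α → ℝ} (hf : ∀ F ⊆ s, 0 ≤ f F)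
    {t : ℝ} (ht : 0 < t) (hS : ∀ F ⊆ s, S F → t ≤ f F) :
    subsetProb s p S ≤ t⁻¹ * subsetExp s p f := by
  classical
  rw [← subsetExp_const_mul]
  refine subsetExp_mono h0 h1 fun F hF => ?_
  split_ifs with h
  · rw [inv_mul_eq_div, le_div_iff₀ ht]
    simpa using hS F hF h
  · exact mul_nonneg (inv_nonneg.2 ht.le) (hf F hF)

/-- Upper Chernoff bound; summands of probability one may have any size. -/
theorem subsetProb_three_mul_le {s : Finset α} {p x : α → ℝ} (h0 : ∀ e ∈ s, 0 ≤ p e)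
    (h1 : ∀ e ∈ s, p e ≤ 1) (hx : ∀ e ∈ s, 0 ≤ x e) {R M : ℝ} (hR : 0 < R)
    (hxR : ∀ e ∈ s, p e = 1 ∨ x e ≤ R) (hM : ∑ e ∈ s, p e * x e ≤ M) :
    subsetProb s p (fun F => 3 * M ≤ ∑ e ∈ F, x e) ≤ Real.exp (-(M / R)) := by
  have key : subsetExp s p (fun F => ∏ e ∈ F, Real.exp (x e / R)) ≤ Real.exp (2 * (M / R)) := by
    rw [subsetExp_prod]
    -- For `p e = 1` this is `exp z ≤ exp (2 z)`, whatever the size of `z ≥ 0`. Otherwise `z ≤ 1`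
    -- and `exp z ≤ 1 + 2 z`. The final exponent is `2 M / R - 3 M / R`.
    have : ∀ e ∈ s, 1 - p e + p e * Real.exp (x e / R) ≤ Real.exp (2 * (p e * x e / R)) := by
      intro e he
      have hxe := div_nonneg (hx e he) hR.le
      rcases hxR e he with h | h
      · rw [h]
        simp only [sub_self, zero_add, one_mul]
        exact Real.exp_le_exp.2 (by linarith)
      · have hz : x e / R ≤ 1 := (div_le_one hR).2 h
        have hb := Real.exp_bound' hxe hz (n := 1) one_pos
        have hexp : Real.exp (x e / R) ≤ 1 + 2 * (x e / R) := by
          have := hb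
          norm_num at this
          linarith
        have := Real.add_one_le_exp (2 * (p e * x e / R))
        have h2 := mul_le_mul_of_nonneg_left hexp (h0 e he)
        have h3 : p e * x e / R = p e * (x e / R) := by ring
        rw [h3] at this ⊢
        linarith
    calc _ ≤ ∏ e ∈ s, Real.exp (2 * (p e * x e / R)) := by
          refine Finset.prod_le_prod (fun e he => ?_) this
          have := h1 e he
          have := mul_nonneg (h0 e he) (Real.exp_pos (x e / R)).le
          linarith
      _ = Real.exp (2 * ((∑ e ∈ s, p e * x e) / R)) := by
          rw [← Real.exp_sum, ← Finset.mul_sum, ← Finset.sum_div]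
      _ ≤ _ := Real.exp_le_exp.2 (by gcongr)
  have := subsetProb_le_of_markov h0 h1 (S := fun F => 3 * M ≤ ∑ e ∈ F, x e)
    (f := fun F => ∏ e ∈ F, Real.exp (x e / R))
    (fun F _ => Finset.prod_nonneg fun e _ => (Real.exp_pos _).le)
    (Real.exp_pos (3 * (M / R))) (fun F _ hF => by
      rw [← Real.exp_sum, ← Finset.sum_div, ← mul_div_assoc]
      exact Real.exp_le_exp.2 (by gcongr))
  refine this.trans ?_
  rw [← Real.exp_neg]
  refine (mul_le_mul_of_nonneg_left key (Real.exp_pos _).le).trans ?_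
  rw [← Real.exp_add]
  exact Real.exp_le_exp.2 (by linarith)

/-- Lower Chernoff bound; summands of probability one may have any size. -/
theorem subsetProb_le_div_four {s : Finset α} {p x : α → ℝ} (h0 : ∀ e ∈ s, 0 ≤ p e)
    (h1 : ∀ e ∈ s, p e ≤ 1) (hx : ∀ e ∈ s, 0 ≤ x e) {R : ℝ} (hR : 0 < R)
    (hxR : ∀ e ∈ s, p e = 1 ∨ x e ≤ R) :
    subsetProb s p (fun F => ∑ e ∈ F, x e ≤ (∑ e ∈ s, p e * x e) / 4) ≤
      Real.exp (-((∑ e ∈ s, p e * x e) / (4 * R))) := by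
  set m := ∑ e ∈ s, p e * x e with hm
  have key : subsetExp s p (fun F => ∏ e ∈ F, Real.exp (-(x e / R))) ≤
      Real.exp (-(m / R) / 2) := by
    rw [subsetExp_prod]
    have : ∀ e ∈ s, 1 - p e + p e * Real.exp (-(x e / R)) ≤
        Real.exp (-(p e * x e / R) / 2) := by
      intro e he
      have hxe := div_nonneg (hx e he) hR.le
      rcases hxR e he with h | h
      · rw [h]
        simp only [sub_self, zero_add, one_mul]
        exact Real.exp_le_exp.2 (by linarith)
      · have hz : x e / R ≤ 1 := (div_le_one hR).2 h
        -- For `0 ≤ z ≤ 1` one has `exp (-z) ≤ 1 / (1 + z) ≤ 1 - z / 2`. With threshold `m / 4` the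
        -- final exponent is `m / (4 R) - m / (2 R)`.
        have hexp : Real.exp (-(x e / R)) ≤ 1 - (x e / R) / 2 := by
          rw [Real.exp_neg]
          have h4 : 0 < 1 + x e / R := by linarith
          have h5 : 1 + x e / R ≤ Real.exp (x e / R) := by
            linarith [Real.add_one_le_exp (x e / R)]
          refine (inv_anti₀ h4 h5).trans ?_
          rw [inv_le_iff_one_le_mul₀ h4]
          nlinarith
        have := Real.add_one_le_exp (-(p e * x e / R) / 2)
        have h2 := mul_le_mul_of_nonneg_left hexp (h0 e he)
        have h3 : p e * x e / R = p e * (x e / R) := by ring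
        rw [h3] at this ⊢
        linarith
    calc _ ≤ ∏ e ∈ s, Real.exp (-(p e * x e / R) / 2) := by
          refine Finset.prod_le_prod (fun e he => ?_) this
          have := h1 e he
          have := mul_nonneg (h0 e he) (Real.exp_pos (-(x e / R))).le
          linarith
      _ = Real.exp (-(m / R) / 2) := by
          rw [← Real.exp_sum, ← Finset.sum_div, Finset.sum_neg_distrib, ← Finset.sum_div]
  have := subsetProb_le_of_markov h0 h1 (S := fun F => ∑ e ∈ F, x e ≤ m / 4)
    (f := fun F => ∏ e ∈ F, Real.exp (-(x e / R)))
    (fun F _ => Finset.prod_nonneg fun e _ => (Real.exp_pos _).le)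
    (Real.exp_pos (-(m / R) / 4)) (fun F _ hF => by
      rw [← Real.exp_sum, Finset.sum_neg_distrib, ← Finset.sum_div]
      refine Real.exp_le_exp.2 ?_
      have := div_le_div_of_nonneg_right hF hR.le
      have e1 : m / 4 / R = m / R / 4 := by ring
      linarith)
  refine this.trans ?_
  rw [← Real.exp_neg]
  refine (mul_le_mul_of_nonneg_left key (Real.exp_pos _).le).trans ?_
  rw [← Real.exp_add]
  refine Real.exp_le_exp.2 ?_
  have e1 : m / (4 * R) = m / R / 4 := by field_simp
  rw [e1]
  linarith

end RandomSubset

/-! ## Lower tail of a random sum of rank-one matrices -/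

section MatrixLowerTail

set_option linter.unusedSectionVars false

open Matrix

variable {ι : Type*} [Fintype ι] [DecidableEq ι]

attribute [local instance] Matrix.linftyOpNormedRing Matrix.linftyOpNormedAlgebra

/-! ### Derivatives of powers of a resolvent. -/

section NormedAlgebra

variable {𝔸 : Type*} [NormedRing 𝔸] [NormedAlgebra ℝ 𝔸]

/-- The hypothesis is the equation satisfied by `N t = (B + t X)⁻¹`. As `N` and `X` need not
commute, the product rule leaves a sum over the position of `X`. -/
theorem hasDerivAt_pow_of_riccati {N : ℝ → 𝔸} {X : 𝔸} {s : ℝ}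
    (h : HasDerivAt N (-(N s * X * N s)) s) (r : ℕ) :
    HasDerivAt (fun t => N t ^ r)
      (-∑ i ∈ Finset.range r, N s ^ (i + 1) * X * N s ^ (r - i)) s := by
  induction r with
  | zero => simpa using hasDerivAt_const s (1 : 𝔸)
  | succ r ih =>
    have := ih.mul h
    simp only [pow_succ (N _) r]
    convert this using 1
    · rfl
    rw [Finset.sum_range_succ, neg_mul, Finset.sum_mul, neg_add]
    congr 1
    · congr 1
      refine Finset.sum_congr rfl fun i hi => ?_
      rw [Finset.mem_range] at hi
      rw [mul_assoc _ _ (N s), ← pow_succ]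
      congr 2
      omega
    · have : r + 1 - r = 1 := by omega
      rw [this, pow_one, mul_neg, pow_succ]
      simp only [mul_assoc]

theorem hasDerivAt_clm_inverse_pow_mul [CompleteSpace 𝔸] (B X Y : 𝔸) {s : ℝ}
    (hs : IsUnit (B + s • X)) (τ : 𝔸 →L[ℝ] ℝ) (r : ℕ) :
    HasDerivAt (fun t : ℝ => τ (Ring.inverse (B + t • X) ^ r * Y))
      (-∑ i ∈ Finset.range r, τ (Ring.inverse (B + s • X) ^ (i + 1) * X *
        Ring.inverse (B + s • X) ^ (r - i) * Y)) s := by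
  obtain ⟨U, hU⟩ := hs
  have h1 : HasDerivAt (fun t : ℝ => B + t • X) X s := by
    simpa only [id_eq, one_smul] using ((hasDerivAt_id s).smul_const X).const_add B
  have h2 := hasFDerivAt_ringInverse (𝕜 := ℝ) U
  rw [hU] at h2
  have h3 : HasDerivAt (fun t : ℝ => Ring.inverse (B + t • X))
      (-(Ring.inverse (B + s • X) * X * Ring.inverse (B + s • X))) s := by
    have h4 := h2.comp_hasDerivAt s h1
    rw [← hU, Ring.inverse_unit]
    simpa [Function.comp_def] using h4
  have h5 := τ.hasFDerivAt.comp_hasDerivAt s ((hasDerivAt_pow_of_riccati h3 r).mul_const Y)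
  rw [neg_mul, Finset.sum_mul, map_neg, map_sum] at h5
  exact h5

end NormedAlgebra

/-! ### Eigenvector expansions of moments and traces. -/

theorem Matrix.IsHermitian.exists_eigenbasis {N : Matrix ι ι ℝ} (hN : N.IsHermitian) :
    ∃ u : ι → ι → ℝ, (∀ a b, u a ⬝ᵥ u b = if a = b then 1 else 0) ∧
      (∀ a, N *ᵥ u a = hN.eigenvalues a • u a) ∧ ∀ x, x = ∑ a, (x ⬝ᵥ u a) • u a := by
  refine ⟨fun a => (hN.eigenvectorBasis a).ofLp, fun a b => ?_, fun a =>
    hN.mulVec_eigenvectorBasis a, fun x => ?_⟩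
  · have := orthonormal_iff_ite.1 hN.eigenvectorBasis.orthonormal b a
    rw [EuclideanSpace.inner_eq_star_dotProduct] at this
    simpa [eq_comm] using this
  · have := hN.eigenvectorBasis.sum_repr (WithLp.toLp 2 x)
    have h2 := congrArg WithLp.ofLp this
    simp only [hN.eigenvectorBasis.repr_apply_apply, EuclideanSpace.inner_eq_star_dotProduct,
      WithLp.ofLp_sum, WithLp.ofLp_smul, star_trivial] at h2
    exact h2.symm

theorem dotProduct_eq_sum_of_eigenbasis {u : ι → ι → ℝ} (hu : ∀ x, x = ∑ a, (x ⬝ᵥ u a) • u a)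
    (x y : ι → ℝ) : x ⬝ᵥ y = ∑ a, (x ⬝ᵥ u a) * (y ⬝ᵥ u a) := by
  conv_lhs => rw [hu y]
  rw [dotProduct_sum]
  refine Finset.sum_congr rfl fun a _ => ?_
  rw [dotProduct_smul, smul_eq_mul, mul_comm]

theorem pow_mulVec_of_eigenvector {N : Matrix ι ι ℝ} {u : ι → ℝ} {ν : ℝ}
    (h : N *ᵥ u = ν • u) (r : ℕ) : (N ^ r) *ᵥ u = ν ^ r • u := by
  induction r with
  | zero => simp
  | succ r ih => rw [pow_succ, ← mulVec_mulVec, h, mulVec_smul, ih, smul_smul, pow_succ, mul_comm]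

theorem dotProduct_pow_mulVec {N : Matrix ι ι ℝ} {u : ι → ι → ℝ} {ν : ι → ℝ}
    (hN : ∀ a, N *ᵥ u a = ν a • u a) (hu : ∀ x, x = ∑ a, (x ⬝ᵥ u a) • u a) (r : ℕ) (x : ι → ℝ) :
    x ⬝ᵥ (N ^ r *ᵥ x) = ∑ a, ν a ^ r * (x ⬝ᵥ u a) ^ 2 := by
  conv_lhs => enter [2, 2]; rw [hu x]
  rw [mulVec_sum, dotProduct_sum]
  refine Finset.sum_congr rfl fun a _ => ?_
  rw [mulVec_smul, pow_mulVec_of_eigenvector (hN a), dotProduct_smul, dotProduct_smul,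
    smul_eq_mul, smul_eq_mul]
  ring

theorem trace_pow_eq_sum {N : Matrix ι ι ℝ} {u : ι → ι → ℝ} {ν : ι → ℝ}
    (huu : ∀ a b, u a ⬝ᵥ u b = if a = b then 1 else 0)
    (hN : ∀ a, N *ᵥ u a = ν a • u a) (hu : ∀ x, x = ∑ a, (x ⬝ᵥ u a) • u a) (r : ℕ) :
    (N ^ r).trace = ∑ a, ν a ^ r := by
  have h1 : ∀ i, (N ^ r) i i = ∑ a, ν a ^ r * u a i ^ 2 := fun i => by
    have := dotProduct_pow_mulVec hN hu r (Pi.single i 1)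
    simpa using this
  have h2 : ∀ a, ∑ i, u a i ^ 2 = 1 := fun a => by
    have := huu a a
    simpa [dotProduct, sq] using this
  simp only [trace, diag, h1]
  rw [Finset.sum_comm]
  simp only [← Finset.mul_sum, h2, mul_one]

/-- The moments of a positive semidefinite matrix at a vector, Chebyshev's inequality. -/
theorem Matrix.PosSemidef.moment_mul_le {N : Matrix ι ι ℝ} (hN : N.PosSemidef) (x : ι → ℝ)
    (r s : ℕ) :
    (x ⬝ᵥ (N ^ (r + 1) *ᵥ x)) * (x ⬝ᵥ (N ^ (s + 1) *ᵥ x)) ≤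
      (x ⬝ᵥ (N ^ 1 *ᵥ x)) * (x ⬝ᵥ (N ^ (r + s + 1) *ᵥ x)) := by
  obtain ⟨u, -, h1, h2⟩ := hN.1.exists_eigenbasis
  have hν := hN.eigenvalues_nonneg
  generalize hN.1.eigenvalues = ν at h1 hν
  simp only [dotProduct_pow_mulVec h1 h2]
  set c : ι → ℝ := fun a => x ⬝ᵥ u a
  change (∑ a, ν a ^ (r + 1) * c a ^ 2) * (∑ a, ν a ^ (s + 1) * c a ^ 2) ≤
    (∑ a, ν a ^ 1 * c a ^ 2) * ∑ a, ν a ^ (r + s + 1) * c a ^ 2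
  have key : ∀ a b, (ν a ^ (r + 1) * c a ^ 2) * (ν b ^ (s + 1) * c b ^ 2) +
      (ν b ^ (r + 1) * c b ^ 2) * (ν a ^ (s + 1) * c a ^ 2) ≤
      (ν a ^ 1 * c a ^ 2) * (ν b ^ (r + s + 1) * c b ^ 2) +
      (ν b ^ 1 * c b ^ 2) * (ν a ^ (r + s + 1) * c a ^ 2) := by
    intro a b
    -- Both powers are increasing on the nonnegative eigenvalues, so the two differences have the
    -- same sign. Summing `key` over all pairs `(a, b)` gives twice the claim.
    have h3 : 0 ≤ (ν a ^ r - ν b ^ r) * (ν a ^ s - ν b ^ s) := by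
      rcases le_total (ν a) (ν b) with h | h
      · exact mul_nonneg_of_nonpos_of_nonpos (sub_nonpos.2 (pow_le_pow_left₀ (hν a) h r))
          (sub_nonpos.2 (pow_le_pow_left₀ (hν a) h s))
      · exact mul_nonneg (sub_nonneg.2 (pow_le_pow_left₀ (hν b) h r))
          (sub_nonneg.2 (pow_le_pow_left₀ (hν b) h s))
    have h4 : 0 ≤ ν a * ν b * c a ^ 2 * c b ^ 2 := by
      have := hν a; have := hν b; positivity
    have h5 := mul_nonneg h4 h3
    have e : (ν a ^ 1 * c a ^ 2) * (ν b ^ (r + s + 1) * c b ^ 2) +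
      (ν b ^ 1 * c b ^ 2) * (ν a ^ (r + s + 1) * c a ^ 2) -
      ((ν a ^ (r + 1) * c a ^ 2) * (ν b ^ (s + 1) * c b ^ 2) +
      (ν b ^ (r + 1) * c b ^ 2) * (ν a ^ (s + 1) * c a ^ 2)) =
      ν a * ν b * c a ^ 2 * c b ^ 2 * ((ν a ^ r - ν b ^ r) * (ν a ^ s - ν b ^ s)) := by
      ring
    linarith
  have hsum := Finset.sum_le_sum fun a (_ : a ∈ Finset.univ) =>
    Finset.sum_le_sum fun b (_ : b ∈ Finset.univ) => key a b
  simp only [Finset.sum_add_distrib] at hsum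
  rw [Finset.sum_mul_sum, Finset.sum_mul_sum]
  rw [Finset.sum_comm (f := fun a b => (ν b ^ (r + 1) * c b ^ 2) * (ν a ^ (s + 1) * c a ^ 2)),
    Finset.sum_comm (f := fun a b => (ν b ^ 1 * c b ^ 2) * (ν a ^ (r + s + 1) * c a ^ 2))] at hsum
  linarith

/-- The potential `tr M^{-q}`. -/
noncomputable def invPowTrace (q : ℕ) (M : Matrix ι ι ℝ) : ℝ := ((M⁻¹) ^ q).trace

theorem trace_mul_vecMulVec (M : Matrix ι ι ℝ) (x : ι → ℝ) :
    (M * vecMulVec x x).trace = x ⬝ᵥ (M *ᵥ x) := by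
  rw [mul_vecMulVec, trace_vecMulVec, dotProduct_comm]

theorem vecMulVec_mul_mul_vecMulVec (M : Matrix ι ι ℝ) (x : ι → ℝ) :
    vecMulVec x x * M * vecMulVec x x = (x ⬝ᵥ (M *ᵥ x)) • vecMulVec x x := by
  rw [vecMulVec_mul, vecMulVec_mul_vecMulVec, ← dotProduct_mulVec]
  ext i j
  simp only [vecMulVec_apply, Matrix.smul_apply, smul_eq_mul, Pi.smul_apply]
  ring

theorem posSemidef_vecMulVec_self (x : ι → ℝ) : (vecMulVec x x).PosSemidef := by
  simpa using posSemidef_vecMulVec_self_star x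

theorem posDef_add_smul_vecMulVec {B : Matrix ι ι ℝ} (hB : B.PosDef) (x : ι → ℝ) {s : ℝ}
    (hs : 0 ≤ s) : (B + s • vecMulVec x x).PosDef :=
  hB.add_posSemidef ((posSemidef_vecMulVec_self x).smul hs)

theorem hasDerivAt_trace_inv_pow_mul {B : Matrix ι ι ℝ} (hB : B.PosDef) (x : ι → ℝ) {s : ℝ}
    (hs : 0 ≤ s) (r : ℕ) (Y : Matrix ι ι ℝ) :
    HasDerivAt (fun t : ℝ => ((B + t • vecMulVec x x)⁻¹ ^ r * Y).trace)
      (-∑ i ∈ Finset.range r, ((B + s • vecMulVec x x)⁻¹ ^ (i + 1) * vecMulVec x x *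
        (B + s • vecMulVec x x)⁻¹ ^ (r - i) * Y).trace) s := by
  simp only [nonsing_inv_eq_ringInverse]
  exact hasDerivAt_clm_inverse_pow_mul B (vecMulVec x x) Y
    (posDef_add_smul_vecMulVec hB x hs).isUnit
    (LinearMap.toContinuousLinearMap (traceLinearMap ι ℝ ℝ)) r

/-- Flipping one coin: the potential does not increase on average if the random rank-one update is
replaced by half of its expectation. -/
theorem invPowTrace_coin_le {B : Matrix ι ι ℝ} (hB : B.PosDef) {x : ι → ℝ} {p δ : ℝ} (hp0 : 0 ≤ p)
    (hp1 : p ≤ 1) (q : ℕ) (hx : p = 1 ∨ ∀ s : ℝ, 0 ≤ s →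
      x ⬝ᵥ ((B + s • vecMulVec x x)⁻¹ *ᵥ x) ≤ δ) (hδ : (q + 1) * δ ≤ Real.log 2) :
    (1 - p) * invPowTrace q B + p * invPowTrace q (B + vecMulVec x x) ≤
      invPowTrace q (B + (p / 2) • vecMulVec x x) := by
  set X := vecMulVec x x with hX
  set N : ℝ → Matrix ι ι ℝ := fun s => (B + s • X)⁻¹ with hN
  have hpd : ∀ s, 0 ≤ s → (N s).PosDef := fun s hs => (posDef_add_smul_vecMulVec hB x hs).inv
  set φ : ℝ → ℝ := fun s => (N s ^ q).trace with hφ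
  set g : ℝ → ℝ := fun s => x ⬝ᵥ (N s ^ (q + 1) *ᵥ x) with hg
  have hmn : ∀ s, 0 ≤ s → ∀ r, 0 ≤ x ⬝ᵥ (N s ^ r *ᵥ x) := fun s hs r => by
    simpa using ((hpd s hs).posSemidef.pow r).dotProduct_mulVec_nonneg x
  have hder : ∀ s, 0 ≤ s → HasDerivAt φ (-(q * g s)) s := by
    intro s hs
    have h := hasDerivAt_trace_inv_pow_mul hB x hs q 1
    simp only [mul_one] at h
    convert h using 1
    rw [neg_inj]
    have : ∀ i ∈ Finset.range q, (N s ^ (i + 1) * X * N s ^ (q - i)).trace = g s := by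
      intro i hi
      rw [Finset.mem_range] at hi
      rw [trace_mul_comm, ← mul_assoc, ← pow_add, trace_mul_vecMulVec]
      have : q - i + (i + 1) = q + 1 := by omega
      rw [this]
    rw [Finset.sum_congr rfl this]
    simp
  have hderg : ∀ s, 0 ≤ s → HasDerivAt g (-∑ i ∈ Finset.range (q + 1),
      (x ⬝ᵥ (N s ^ (i + 1) *ᵥ x)) * (x ⬝ᵥ (N s ^ (q - i + 1) *ᵥ x))) s := by
    intro s hs
    have h := hasDerivAt_trace_inv_pow_mul hB x hs (q + 1) X
    have e : g = fun t => (N t ^ (q + 1) * X).trace := by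
      funext t
      rw [trace_mul_vecMulVec]
    rw [e]
    convert h using 1
    rw [neg_inj]
    refine Finset.sum_congr rfl fun i hi => ?_
    rw [Finset.mem_range] at hi
    rw [mul_assoc, mul_assoc, ← mul_assoc X, vecMulVec_mul_mul_vecMulVec, mul_smul_comm, trace_smul,
      trace_mul_vecMulVec, smul_eq_mul, mul_comm]
    have : q + 1 - i = q - i + 1 := by omega
    rw [this]
  -- Here `φ' = -q g`, so a decreasing `g` means that the potential is convex along the update.
  have hganti : AntitoneOn g (Set.Ici 0) := by
    refine antitoneOn_of_deriv_nonpos (convex_Ici 0)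
      (fun s hs => (hderg s hs).continuousAt.continuousWithinAt)
      (fun s hs => (hderg s (interior_subset hs)).differentiableAt.differentiableWithinAt)
      fun s hs => ?_
    have hs' : 0 ≤ s := interior_subset hs
    rw [(hderg s hs').deriv]
    exact neg_nonpos.2 (Finset.sum_nonneg fun i _ => mul_nonneg (hmn s hs' _) (hmn s hs' _))
  have hg0 : ∀ s, 0 ≤ s → 0 ≤ g s := fun s hs => hmn s hs _
  have hmvt : ∀ s, 0 < s → ∃ t, 0 < t ∧ t < s ∧ φ 0 - φ s = s * (q * g t) := by
    intro s hs
    obtain ⟨t, ht, h⟩ := exists_hasDerivAt_eq_slope φ (fun t => -(q * g t)) hs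
      (fun t ht => (hder t ht.1).continuousAt.continuousWithinAt) (fun t ht => hder t ht.1.le)
    refine ⟨t, ht.1, ht.2, ?_⟩
    rw [eq_div_iff (by linarith)] at h
    linarith
  have hφdef : ∀ s, invPowTrace q (B + s • X) = φ s := fun s => rfl
  have e0 : invPowTrace q B = φ 0 := by rw [← hφdef, zero_smul, add_zero]
  have e1 : invPowTrace q (B + X) = φ 1 := by rw [← hφdef, one_smul]
  rw [e0, e1, hφdef]
  rcases hp0.eq_or_lt with rfl | hp
  · simp
  rcases hx with rfl | hx
  · have : φ 1 ≤ φ (1 / 2) := by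
      have : AntitoneOn φ (Set.Ici 0) := by
        refine antitoneOn_of_deriv_nonpos (convex_Ici 0)
          (fun s hs => (hder s hs).continuousAt.continuousWithinAt)
          (fun s hs => (hder s (interior_subset hs)).differentiableAt.differentiableWithinAt)
          fun s hs => ?_
        have hs' : 0 ≤ s := interior_subset hs
        rw [(hder s hs').deriv]
        exact neg_nonpos.2 (mul_nonneg (Nat.cast_nonneg q) (hg0 s hs'))
      exact this (by norm_num) (by norm_num) (by norm_num)
    linarith
  -- By the moment inequality each of the `q + 1` terms of `-g'` is at most the first moment times
  -- `g`, hence at most `δ g`. Thus `g' ≥ -(log 2) g`, and `g` loses at most a factor 2 on `[0, 1]`.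
  have hghalf : g 0 / 2 ≤ g 1 := by
    have hmono : MonotoneOn (fun s => Real.exp (Real.log 2 * s) * g s) (Set.Ici 0) := by
      have hd : ∀ s, 0 ≤ s → HasDerivAt (fun s => Real.exp (Real.log 2 * s) * g s) _ s :=
        fun s hs => (((hasDerivAt_id s).const_mul (Real.log 2)).exp).mul (hderg s hs)
      refine monotoneOn_of_deriv_nonneg (convex_Ici 0)
        (fun s hs => (hd s hs).continuousAt.continuousWithinAt)
        (fun s hs => (hd s (interior_subset hs)).differentiableAt.differentiableWithinAt)
        fun s hs => ?_
      have hs' : 0 ≤ s := interior_subset hs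
      rw [(hd s hs').deriv]
      have hb : ∑ i ∈ Finset.range (q + 1),
          (x ⬝ᵥ (N s ^ (i + 1) *ᵥ x)) * (x ⬝ᵥ (N s ^ (q - i + 1) *ᵥ x)) ≤ Real.log 2 * g s := by
        have : ∀ i ∈ Finset.range (q + 1),
            (x ⬝ᵥ (N s ^ (i + 1) *ᵥ x)) * (x ⬝ᵥ (N s ^ (q - i + 1) *ᵥ x)) ≤ δ * g s := by
          intro i hi
          rw [Finset.mem_range] at hi
          refine ((hpd s hs').posSemidef.moment_mul_le x i (q - i)).trans ?_
          have e : i + (q - i) + 1 = q + 1 := by omega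
          rw [e, pow_one]
          exact mul_le_mul_of_nonneg_right (hx s hs') (hg0 s hs')
        refine (Finset.sum_le_sum this).trans ?_
        rw [Finset.sum_const, Finset.card_range, nsmul_eq_mul, ← mul_assoc]
        push_cast
        exact mul_le_mul_of_nonneg_right hδ (hg0 s hs')
      have hE := Real.exp_pos (Real.log 2 * s)
      simp only [id_eq, mul_one]
      nlinarith
    have := hmono (by simp : (0 : ℝ) ∈ Set.Ici 0) (by simp : (1 : ℝ) ∈ Set.Ici 0) zero_le_one
    simp only [mul_zero, Real.exp_zero, one_mul, mul_one, Real.exp_log two_pos] at this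
    linarith
  -- The full update lowers the potential by at least `q g(0) / 2`, and the update by `p / 2` lowers
  -- it by at most `(p / 2) q g(0)`; so `p` times the first drop dominates the second.
  obtain ⟨t, ht0, ht1, h1⟩ := hmvt 1 one_pos
  obtain ⟨t', ht0', ht1', h2⟩ := hmvt (p / 2) (by linarith)
  have a1 : g 1 ≤ g t := hganti (by simpa using ht0.le) (by simp) ht1.le
  have a2 : g t' ≤ g 0 := hganti (by simp) (by simpa using ht0'.le) ht0'.le
  have hpq : 0 ≤ p * q := by positivity
  have a3 : (p * q) * g t' ≤ (p * q) * (2 * g t) :=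
    mul_le_mul_of_nonneg_left (by linarith) hpq
  nlinarith

/-- For `y = M⁻¹ x` the hypothesis reads `b |y|² ≤ x·y`; combine with `(x·y)² ≤ |x|² |y|²`. -/
theorem dotProduct_inv_mulVec_le {M : Matrix ι ι ℝ} (hM : M.PosDef) {b : ℝ} (hb : 0 < b)
    (h : ∀ z, b * (z ⬝ᵥ z) ≤ z ⬝ᵥ (M *ᵥ z)) (x : ι → ℝ) :
    x ⬝ᵥ (M⁻¹ *ᵥ x) ≤ (x ⬝ᵥ x) / b := by
  have hdet : IsUnit M.det := (isUnit_iff_isUnit_det M).1 hM.isUnit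
  set y := M⁻¹ *ᵥ x with hy
  have hMy : M *ᵥ y = x := by rw [hy, mulVec_mulVec, mul_nonsing_inv M hdet, one_mulVec]
  have h1 := h y
  rw [hMy, dotProduct_comm y x] at h1
  have h2 : (x ⬝ᵥ y) ^ 2 ≤ (x ⬝ᵥ x) * (y ⬝ᵥ y) := by
    simpa only [dotProduct, ← sq] using Finset.sum_mul_sq_le_sq_mul_sq Finset.univ x y
  have hxx : 0 ≤ x ⬝ᵥ x := Finset.sum_nonneg fun i _ => mul_self_nonneg (x i)
  have hyy : 0 ≤ y ⬝ᵥ y := Finset.sum_nonneg fun i _ => mul_self_nonneg (y i)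
  rw [le_div_iff₀ hb]
  have h3 : 0 ≤ x ⬝ᵥ y := (mul_nonneg hb.le hyy).trans h1
  rcases h3.eq_or_lt with h0 | h0
  · rw [← h0, zero_mul]; exact hxx
  · have : (x ⬝ᵥ y) * ((x ⬝ᵥ y) * b) ≤ (x ⬝ᵥ y) * (x ⬝ᵥ x) := by nlinarith
    exact le_of_mul_le_mul_left this h0

theorem invPowTrace_le {M : Matrix ι ι ℝ} (hM : M.PosDef) {t : ℝ} (ht : 0 < t)
    (h : ∀ z, t * (z ⬝ᵥ z) ≤ z ⬝ᵥ (M *ᵥ z)) (q : ℕ) :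
    invPowTrace q M ≤ Fintype.card ι * t⁻¹ ^ q := by
  obtain ⟨u, h0, h1, h2⟩ := hM.inv.1.exists_eigenbasis
  have hν := hM.inv.posSemidef.eigenvalues_nonneg
  have hν' : ∀ a, hM.inv.1.eigenvalues a ≤ t⁻¹ := fun a => by
    have := dotProduct_inv_mulVec_le hM ht h (u a)
    rw [h1, dotProduct_smul, h0, if_pos rfl] at this
    simpa using this
  rw [invPowTrace, trace_pow_eq_sum h0 h1 h2]
  refine (Finset.sum_le_sum fun a _ => pow_le_pow_left₀ (hν a) (hν' a) q).trans ?_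
  simp

/-- One eigenvalue of `M⁻¹` above `t⁻¹` already suffices. If there were none, then writing both
forms at `z` in terms of `y = M z` and using `ν² ≤ t⁻¹ ν` for each eigenvalue `ν` of `M⁻¹` would
contradict `hz`. -/
theorem le_invPowTrace {M : Matrix ι ι ℝ} (hM : M.PosDef) {t : ℝ} (ht : 0 < t) {z : ι → ℝ}
    (hz : z ⬝ᵥ (M *ᵥ z) < t * (z ⬝ᵥ z)) (q : ℕ) : t⁻¹ ^ q ≤ invPowTrace q M := by
  obtain ⟨u, h0, h1, h2⟩ := hM.inv.1.exists_eigenbasis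
  have hν := hM.inv.posSemidef.eigenvalues_nonneg
  rw [invPowTrace, trace_pow_eq_sum h0 h1 h2]
  obtain ⟨a, ha⟩ : ∃ a, t⁻¹ < hM.inv.1.eigenvalues a := by
    by_contra! hcon
    have hdet : IsUnit M.det := (isUnit_iff_isUnit_det M).1 hM.isUnit
    set y := M *ᵥ z with hy
    have hNy : M⁻¹ *ᵥ y = z := by rw [hy, mulVec_mulVec, nonsing_inv_mul M hdet, one_mulVec]
    have e1 : z ⬝ᵥ y = y ⬝ᵥ (M⁻¹ ^ 1 *ᵥ y) := by rw [pow_one, hNy, dotProduct_comm]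
    have e2 : z ⬝ᵥ z = y ⬝ᵥ (M⁻¹ ^ 2 *ᵥ y) := by
      rw [sq, ← mulVec_mulVec, hNy, dotProduct_mulVec, ← mulVec_transpose]
      have : M⁻¹ᵀ = M⁻¹ := by simpa using hM.inv.1.eq
      rw [this, hNy]
    rw [e1, e2, dotProduct_pow_mulVec h1 h2, dotProduct_pow_mulVec h1 h2, Finset.mul_sum] at hz
    refine absurd hz (not_lt.2 (Finset.sum_le_sum fun a _ => ?_))
    have := mul_le_mul_of_nonneg_left (hcon a) (mul_nonneg ht.le (hν a))
    have e3 : t * hM.inv.1.eigenvalues a * t⁻¹ = hM.inv.1.eigenvalues a := by field_simp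
    rw [e3] at this
    have := mul_le_mul_of_nonneg_right this (sq_nonneg (y ⬝ᵥ u a))
    calc _ = t * hM.inv.1.eigenvalues a * hM.inv.1.eigenvalues a * (y ⬝ᵥ u a) ^ 2 := by ring
      _ ≤ _ := by simpa using this
  refine (pow_le_pow_left₀ (inv_nonneg.2 ht.le) ha.le q).trans ?_
  exact Finset.single_le_sum (f := fun a => hM.inv.1.eigenvalues a ^ q)
    (fun b _ => pow_nonneg (hν b) q) (Finset.mem_univ a)

variable {α : Type*} [DecidableEq α]

theorem dotProduct_add_smul_vecMulVec_mulVec (B : Matrix ι ι ℝ) (x z : ι → ℝ) (s : ℝ) :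
    z ⬝ᵥ ((B + s • vecMulVec x x) *ᵥ z) = z ⬝ᵥ (B *ᵥ z) + s * (x ⬝ᵥ z) ^ 2 := by
  rw [add_mulVec, dotProduct_add, smul_mulVec, dotProduct_smul, vecMulVec_mulVec, smul_eq_mul]
  have : z ⬝ᵥ (MulOpposite.op (x ⬝ᵥ z) • x) = (x ⬝ᵥ z) * (x ⬝ᵥ z) := by
    rw [op_smul_eq_smul, dotProduct_smul, smul_eq_mul, dotProduct_comm z x]
  rw [this]
  ring

/-- Induction on the coins with varying base `B`. For either outcome of the coin `a`, the induction
hypothesis makes all other updates deterministic, and then `invPowTrace_coin_le` treats `a`. Bases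
only grow, so the lower bound `b` persists and gives the uniform `δ = R / b`. -/
theorem subsetExp_invPowTrace_le (s : Finset α) {p : α → ℝ} {x : α → ι → ℝ} {b R : ℝ} {q : ℕ}
    (h0 : ∀ e ∈ s, 0 ≤ p e) (h1 : ∀ e ∈ s, p e ≤ 1) (hb : 0 < b)
    (hR : ∀ e ∈ s, p e = 1 ∨ x e ⬝ᵥ x e ≤ R) (hq : (q + 1) * (R / b) ≤ Real.log 2)
    {B : Matrix ι ι ℝ} (hB : B.PosDef) (hBb : ∀ z, b * (z ⬝ᵥ z) ≤ z ⬝ᵥ (B *ᵥ z)) :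
    subsetExp s p (fun F => invPowTrace q (B + ∑ e ∈ F, vecMulVec (x e) (x e))) ≤
      invPowTrace q (B + ∑ e ∈ s, (p e / 2) • vecMulVec (x e) (x e)) := by
  induction s using Finset.induction_on generalizing B with
  | empty => simp [subsetExp, subsetWeight]
  | insert a s ha ih =>
    rw [subsetExp_insert ha]
    have h0' : ∀ e ∈ s, 0 ≤ p e := fun e he => h0 e (Finset.mem_insert_of_mem he)
    have h1' : ∀ e ∈ s, p e ≤ 1 := fun e he => h1 e (Finset.mem_insert_of_mem he)
    have hR' : ∀ e ∈ s, p e = 1 ∨ x e ⬝ᵥ x e ≤ R := fun e he => hR e (Finset.mem_insert_of_mem he)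
    have ha0 := h0 a (Finset.mem_insert_self a s)
    have ha1 := h1 a (Finset.mem_insert_self a s)
    have i1 := ih h0' h1' hR' hB hBb
    have hB' := posDef_add_smul_vecMulVec hB (x a) zero_le_one
    rw [one_smul] at hB'
    have i2 := ih h0' h1' hR' hB' fun z => by
      have := dotProduct_add_smul_vecMulVec_mulVec B (x a) z 1
      rw [one_smul] at this
      rw [this]
      nlinarith [hBb z, sq_nonneg (x a ⬝ᵥ z)]
    have e1 : subsetExp s p (fun F => invPowTrace q (B + ∑ e ∈ insert a F,
        vecMulVec (x e) (x e))) = subsetExp s p (fun F => invPowTrace q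
        (B + vecMulVec (x a) (x a) + ∑ e ∈ F, vecMulVec (x e) (x e))) := by
      refine Finset.sum_congr rfl fun F hF => ?_
      dsimp only
      rw [Finset.sum_insert fun h => ha (Finset.mem_powerset.1 hF h), add_assoc]
    rw [e1]
    set S := ∑ e ∈ s, (p e / 2) • vecMulVec (x e) (x e) with hS
    have hSp : S.PosSemidef := posSemidef_sum s fun e he =>
      (posSemidef_vecMulVec_self (x e)).smul (by have := h0' e he; positivity)
    have hBS : (B + S).PosDef := hB.add_posSemidef hSp
    have i3 := invPowTrace_coin_le hBS (x := x a) (p := p a) (δ := R / b) ha0 ha1 q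
      ((hR a (Finset.mem_insert_self a s)).imp id fun hxa t ht => by
        refine (dotProduct_inv_mulVec_le (posDef_add_smul_vecMulVec hBS (x a) ht) hb
          (fun z => ?_) (x a)).trans (by gcongr)
        rw [dotProduct_add_smul_vecMulVec_mulVec, add_mulVec, dotProduct_add]
        have i4 := hSp.dotProduct_mulVec_nonneg z
        rw [star_trivial] at i4
        have := mul_nonneg ht (sq_nonneg (x a ⬝ᵥ z))
        linarith [hBb z]) hq
    have e2 : B + vecMulVec (x a) (x a) + S = B + S + vecMulVec (x a) (x a) := by abel
    rw [e2] at i2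
    have e3 : B + ∑ e ∈ insert a s, (p e / 2) • vecMulVec (x e) (x e) =
        B + S + (p a / 2) • vecMulVec (x a) (x a) := by
      rw [Finset.sum_insert ha, hS]; abel
    rw [e3]
    refine le_trans (add_le_add ?_ ?_) i3
    · exact mul_le_mul_of_nonneg_left i1 (by linarith)
    · exact mul_le_mul_of_nonneg_left i2 ha0

/-- Lower tail for a random sum of independent rank-one matrices with expectation `1`. -/
theorem subsetProb_rankOne_lower_tail {s : Finset α} {p : α → ℝ} {x : α → ι → ℝ} {R : ℝ} {q : ℕ}
    (h0 : ∀ e ∈ s, 0 ≤ p e) (h1 : ∀ e ∈ s, p e ≤ 1)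
    (hR : ∀ e ∈ s, p e = 1 ∨ x e ⬝ᵥ x e ≤ R) (hq : (q + 1) * (8 * R) ≤ Real.log 2)
    (hsum : ∀ z, z ⬝ᵥ z ≤ ∑ e ∈ s, p e * (x e ⬝ᵥ z) ^ 2) :
    subsetProb s p (fun F => ∃ z, ∑ e ∈ F, (x e ⬝ᵥ z) ^ 2 < (z ⬝ᵥ z) / 8) ≤
      Fintype.card ι * (1 / 2) ^ q := by
  have hquad : ∀ (c : α → ℝ) (F : Finset α) (z : ι → ℝ),
      z ⬝ᵥ (((1 / 8 : ℝ) • (1 : Matrix ι ι ℝ) + ∑ e ∈ F, c e • vecMulVec (x e) (x e)) *ᵥ z) =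
        (1 / 8) * (z ⬝ᵥ z) + ∑ e ∈ F, c e * (x e ⬝ᵥ z) ^ 2 := by
    intro c F z
    induction F using Finset.induction_on with
    | empty => simp [smul_mulVec]
    | insert a F ha ih =>
      rw [Finset.sum_insert ha, Finset.sum_insert ha, add_comm (c a • _), ← add_assoc,
        dotProduct_add_smul_vecMulVec_mulVec, ih]
      ring
  have hB : ((1 / 8 : ℝ) • (1 : Matrix ι ι ℝ)).PosDef := PosDef.one.smul (by norm_num)
  have hpd : ∀ (c : α → ℝ) (F : Finset α), (∀ e ∈ F, 0 ≤ c e) →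
      ((1 / 8 : ℝ) • (1 : Matrix ι ι ℝ) + ∑ e ∈ F, c e • vecMulVec (x e) (x e)).PosDef :=
    fun c F hc => hB.add_posSemidef (posSemidef_sum F fun e he =>
      (posSemidef_vecMulVec_self (x e)).smul (hc e he))
  have hpd1 : ∀ F : Finset α,
      ((1 / 8 : ℝ) • (1 : Matrix ι ι ℝ) + ∑ e ∈ F, vecMulVec (x e) (x e)).PosDef := fun F => by
    simpa using hpd (fun _ => 1) F fun _ _ => zero_le_one
  -- The base `1/8` makes all matrices invertible. The averaged matrix is at least `1/8 + 1/2 ≥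
  -- 1/2`, with potential at most `2^q` times the dimension. A bad `z` gives a value below `1/8 +
  -- 1/8 = 1/4`, hence potential at least `4^q`.
  have main := subsetExp_invPowTrace_le s (b := 1 / 8) (R := R) (x := x) h0 h1 (by norm_num) hR
    (q := q) (by have : R / (1 / 8) = 8 * R := by ring
                 rw [this]; exact hq) hB (fun z => by simp [smul_mulVec])
  have hup : invPowTrace q ((1 / 8 : ℝ) • (1 : Matrix ι ι ℝ) +
      ∑ e ∈ s, (p e / 2) • vecMulVec (x e) (x e)) ≤ Fintype.card ι * (1 / 2 : ℝ)⁻¹ ^ q := by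
    refine invPowTrace_le (hpd _ s fun e he => by have := h0 e he; positivity) (by norm_num)
      (fun z => ?_) q
    rw [hquad]
    have e : ∑ e ∈ s, p e / 2 * (x e ⬝ᵥ z) ^ 2 = (∑ e ∈ s, p e * (x e ⬝ᵥ z) ^ 2) / 2 := by
      rw [Finset.sum_div]
      exact Finset.sum_congr rfl fun _ _ => by ring
    have hzz : 0 ≤ z ⬝ᵥ z := Finset.sum_nonneg fun i _ => mul_self_nonneg (z i)
    rw [e]
    linarith [hsum z]
  have hmk := subsetProb_le_of_markov h0 h1
    (S := fun F => ∃ z, ∑ e ∈ F, (x e ⬝ᵥ z) ^ 2 < (z ⬝ᵥ z) / 8)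
    (f := fun F => invPowTrace q ((1 / 8 : ℝ) • (1 : Matrix ι ι ℝ) +
      ∑ e ∈ F, vecMulVec (x e) (x e)))
    (fun F _ => ((hpd1 F).inv.posSemidef.pow q).trace_nonneg)
    (t := (1 / 4 : ℝ)⁻¹ ^ q) (by positivity)
    (fun F _ ⟨z, hz⟩ => le_invPowTrace (hpd1 F) (by norm_num) (z := z) (by
      have := hquad (fun _ => 1) F z
      simp only [one_smul, one_mul] at this
      rw [this]
      linarith) q)
  refine hmk.trans ?_
  have h4 : ((1 / 4 : ℝ)⁻¹ ^ q)⁻¹ = (1 / 4) ^ q := by rw [← inv_pow, inv_inv]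
  rw [h4]
  refine (mul_le_mul_of_nonneg_left (main.trans hup) (by positivity)).trans (le_of_eq ?_)
  have : (1 / 4 : ℝ) ^ q * (1 / 2 : ℝ)⁻¹ ^ q = (1 / 2) ^ q := by
    rw [← mul_pow]; norm_num
  rw [← this]
  ring

end MatrixLowerTail

/-! ## Simultaneous diagonalisation of quadratic forms and the min-max principle -/

section MinMax

variable {n : ℕ}

/-- In the coordinates given by `y` the form `N` is the sum of squares and `Q` is diagonal with
coefficients `ν`. -/
def SimDiag (Q N : (Fin n → ℝ) → ℝ) (y : Fin n → Fin n → ℝ) (ν : Fin n → ℝ) : Prop :=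
  ∀ c : Fin n → ℝ, N (∑ i, c i • y i) = ∑ i, c i ^ 2 ∧ Q (∑ i, c i • y i) = ∑ i, ν i * c i ^ 2

theorem SimDiag.linearIndependent {Q N : (Fin n → ℝ) → ℝ} {y : Fin n → Fin n → ℝ} {ν : Fin n → ℝ}
    (h : SimDiag Q N y ν) : LinearIndependent ℝ y := by
  rw [Fintype.linearIndependent_iff]
  intro c hc i
  have h0 := (h 0).1
  have h1 := (h c).1
  simp only [Pi.zero_apply, zero_smul, Finset.sum_const_zero] at h0
  rw [hc, h0] at h1
  have := (Finset.sum_eq_zero_iff_of_nonneg fun i _ => sq_nonneg (c i)).1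
    (show ∑ i, c i ^ 2 = 0 by rw [← h1]; simp) i (Finset.mem_univ i)
  exact pow_eq_zero_iff (two_ne_zero) |>.1 this

theorem SimDiag.exists_basis {Q N : (Fin n → ℝ) → ℝ} {y : Fin n → Fin n → ℝ} {ν : Fin n → ℝ}
    (h : SimDiag Q N y ν) : ∃ b : Module.Basis (Fin n) ℝ (Fin n → ℝ), ⇑b = y :=
  ⟨basisOfLinearIndependentOfCardEqFinrank' y h.linearIndependent (by simp), by simp⟩

/-- One half of Courant–Fischer: more than `j` independent vectors span a nonzero `x` whose first
`j` coordinates vanish (indices start at 0), and there `Q x ≥ ν j * N x`. -/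
theorem SimDiag.le_of_family {Q N : (Fin n → ℝ) → ℝ} {y : Fin n → Fin n → ℝ} {ν : Fin n → ℝ}
    (h : SimDiag Q N y ν) (hν : Monotone ν) (j : Fin n) {ι : Type*} [Fintype ι]
    (hι : j.1 < Fintype.card ι) {v : ι → Fin n → ℝ} (hv : LinearIndependent ℝ v) {t : ℝ}
    (ht : ∀ c : ι → ℝ, Q (∑ i, c i • v i) ≤ t * N (∑ i, c i • v i)) : ν j ≤ t := by
  obtain ⟨b, hb⟩ := h.exists_basis
  let f : (ι → ℝ) →ₗ[ℝ] (Fin j.1 → ℝ) :=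
    LinearMap.pi fun i => (b.coord ⟨i, i.2.trans j.2⟩) ∘ₗ Fintype.linearCombination ℝ v
  have hker : LinearMap.ker f ≠ ⊥ := LinearMap.ker_ne_bot_of_finrank_lt (by simpa using hι)
  obtain ⟨c, hc, hc0⟩ := (Submodule.ne_bot_iff _).1 hker
  set x := ∑ i, c i • v i with hx
  have hx0 : x ≠ 0 := fun h0 => hc0 (funext ((Fintype.linearIndependent_iff.1 hv) c h0))
  set d : Fin n → ℝ := fun i => b.repr x i with hd
  have hxd : x = ∑ i, d i • y i := by rw [← hb]; exact (b.sum_repr x).symm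
  have hdj : ∀ i, i < j → d i = 0 := fun i hi => by
    have := congrFun (LinearMap.mem_ker.1 hc) ⟨i, hi⟩
    simpa [f, Fintype.linearCombination_apply, hd, hx] using this
  have h1 := (h d).1
  have h2 := (h d).2
  rw [← hxd] at h1 h2
  have hpos : 0 < N x := by
    rw [h1]
    refine lt_of_le_of_ne (Finset.sum_nonneg fun i _ => sq_nonneg (d i)) fun h0 => hx0 ?_
    have := (Finset.sum_eq_zero_iff_of_nonneg fun i _ => sq_nonneg (d i)).1 h0.symm
    rw [hxd]
    refine Finset.sum_eq_zero fun i hi => ?_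
    rw [pow_eq_zero_iff (two_ne_zero) |>.1 (this i hi), zero_smul]
  have h3 : ν j * N x ≤ Q x := by
    rw [h1, h2, Finset.mul_sum]
    refine Finset.sum_le_sum fun i _ => ?_
    rcases lt_or_ge i j with hi | hi
    · simp [hdj i hi]
    · exact mul_le_mul_of_nonneg_right (hν hi) (sq_nonneg _)
  exact le_of_mul_le_mul_right (h3.trans (ht c)) hpos

theorem SimDiag.rev {Q N : (Fin n → ℝ) → ℝ} {y : Fin n → Fin n → ℝ} {ν : Fin n → ℝ}
    (h : SimDiag Q N y ν) (t : ℝ) :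
    SimDiag (fun x => t * N x - Q x) N (fun i => y i.rev) (fun i => t - ν i.rev) := by
  intro c
  have h1 := h fun i => c i.rev
  have e : ∑ i, c i • y i.rev = ∑ i, c i.rev • y i :=
    Fintype.sum_equiv Fin.revPerm _ _ fun i => by simp
  have e2 : ∑ i, c i ^ 2 = ∑ i : Fin n, c i.rev ^ 2 :=
    Fintype.sum_equiv Fin.revPerm _ _ fun i => by simp
  have e3 : ∑ i, ν i.rev * c i ^ 2 = ∑ i : Fin n, ν i * c i.rev ^ 2 :=
    Fintype.sum_equiv Fin.revPerm _ _ fun i => by simp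
  refine ⟨by rw [e, h1.1, e2], ?_⟩
  simp only [sub_mul, Finset.sum_sub_distrib, ← Finset.mul_sum]
  rw [e, h1.1, h1.2, e3, e2]

/-- The other half of Courant–Fischer follows by applying the first to `-Q` with the order of the
coordinates reversed. -/
theorem SimDiag.ge_of_family {Q N : (Fin n → ℝ) → ℝ} {y : Fin n → Fin n → ℝ} {ν : Fin n → ℝ}
    (h : SimDiag Q N y ν) (hν : Monotone ν) (j : Fin n) {ι : Type*} [Fintype ι]
    (hι : n ≤ j.1 + Fintype.card ι) {v : ι → Fin n → ℝ} (hv : LinearIndependent ℝ v) {t : ℝ}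
    (ht : ∀ c : ι → ℝ, t * N (∑ i, c i • v i) ≤ Q (∑ i, c i • v i)) : t ≤ ν j := by
  have := (h.rev 0).le_of_family (fun a b hab => sub_le_sub_left (hν (Fin.rev_anti hab)) 0) j.rev
    (by rw [Fin.val_rev]; omega) hv (t := -t) (fun c => by linarith [ht c])
  simp only [Fin.rev_rev] at this
  linarith

theorem SimDiag.comp {Q N : (Fin n → ℝ) → ℝ} {y : Fin n → Fin n → ℝ} {ν : Fin n → ℝ}
    (h : SimDiag Q N y ν) {ι : Type*} [Fintype ι] {φ : ι → Fin n} (hφ : Function.Injective φ)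
    (c : ι → ℝ) : N (∑ i, c i • y (φ i)) = ∑ i, c i ^ 2 ∧
      Q (∑ i, c i • y (φ i)) = ∑ i, ν (φ i) * c i ^ 2 := by
  set d : Fin n → ℝ := Function.extend φ c (fun _ => 0) with hd
  have h0 : ∀ j, j ∉ Set.range φ → d j = 0 := fun j hj =>
    Function.extend_apply' c _ j fun ⟨i, hi⟩ => hj ⟨i, hi⟩
  have h1 : ∀ i, c i = d (φ i) := fun i => (hφ.extend_apply c _ i).symm
  have e1 : ∑ i, c i • y (φ i) = ∑ j, d j • y j :=
    Fintype.sum_of_injective φ hφ _ _ (fun j hj => by rw [h0 j hj, zero_smul])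
      fun i => by rw [h1]
  have e2 : ∑ i, c i ^ 2 = ∑ j, d j ^ 2 :=
    Fintype.sum_of_injective φ hφ _ _ (fun j hj => by rw [h0 j hj]; simp) fun i => by rw [h1]
  have e3 : ∑ i, ν (φ i) * c i ^ 2 = ∑ j, ν j * d j ^ 2 :=
    Fintype.sum_of_injective φ hφ _ _ (fun j hj => by rw [h0 j hj]; simp) fun i => by rw [h1]
  rw [e1, e2, e3]
  exact h d

theorem SimDiag.unique {Q N : (Fin n → ℝ) → ℝ} {y y' : Fin n → Fin n → ℝ} {ν ν' : Fin n → ℝ}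
    (h : SimDiag Q N y ν) (hν : Monotone ν) (h' : SimDiag Q N y' ν') (hν' : Monotone ν') :
    ν = ν' := by
  have key : ∀ {y y' : Fin n → Fin n → ℝ} {ν ν' : Fin n → ℝ}, SimDiag Q N y ν → Monotone ν →
      SimDiag Q N y' ν' → Monotone ν' → ∀ j, ν j ≤ ν' j := by
    intro y y' ν ν' h hν h' hν' j
    have hj : j.1 + 1 ≤ n := j.2
    refine h.le_of_family hν j (ι := Fin (j.1 + 1)) (by simp)
      (h'.linearIndependent.comp (Fin.castLE hj) (Fin.castLE_injective hj)) fun c => ?_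
    have hc := h'.comp (Fin.castLE_injective hj) c
    simp only [Function.comp_apply]
    rw [hc.1, hc.2, Finset.mul_sum]
    refine Finset.sum_le_sum fun i _ => mul_le_mul_of_nonneg_right (hν' ?_) (sq_nonneg _)
    have := i.2
    rw [Fin.le_def, Fin.val_castLE]
    omega
  exact funext fun j => le_antisymm (key h hν h' hν' j) (key h' hν' h hν j)

open Matrix in
theorem exists_simDiag_eigAsc (M : Matrix (Fin n) (Fin n) ℝ) (hM : M.IsHermitian) :
    ∃ y, SimDiag (fun z => z ⬝ᵥ (M *ᵥ z)) (fun z => z ⬝ᵥ z) y (fun i => eigAsc M hM (i + 1)) ∧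
      Monotone fun i : Fin n => eigAsc M hM (i + 1) := by
  obtain ⟨u, h0, h1, h2⟩ := hM.exists_eigenbasis
  have hcard : Fintype.card (Fin n) = n := Fintype.card_fin n
  -- The bijection through which `eigenvalues` is defined from `eigenvalues₀`; `Fin.revPerm` in `τ`
  -- then turns decreasing into increasing order.
  let σ : Fin (Fintype.card (Fin n)) ≃ Fin n := Fintype.equivOfCardEq (Fintype.card_fin _)
  let τ : Fin n ≃ Fin n := Fin.revPerm.trans ((finCongr hcard.symm).trans σ)
  have hval : ∀ i : Fin n, eigAsc M hM (i + 1) = hM.eigenvalues (τ i) := fun i => by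
    have hi : 1 ≤ i.1 + 1 ∧ i.1 + 1 ≤ n := ⟨by omega, i.2⟩
    rw [eigAsc, dif_pos hi, IsHermitian.eigenvalues]
    congr 1
    simp only [τ, σ, Equiv.trans_apply, Equiv.symm_apply_apply]
    ext
    simp
  refine ⟨fun i => u (τ i), fun c => ?_, fun i j hij => ?_⟩
  · have hc : ∀ a, (∑ i, c i • u (τ i)) ⬝ᵥ u a = c (τ.symm a) := fun a => by
      simp only [sum_dotProduct, smul_dotProduct, h0, smul_eq_mul, mul_ite, mul_one, mul_zero]
      rw [Finset.sum_eq_single (τ.symm a)]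
      · simp
      · intro b _ hb
        rw [if_neg]
        rintro rfl
        simp at hb
      · simp
    constructor
    · dsimp only
      rw [dotProduct_eq_sum_of_eigenbasis h2]
      simp only [hc, ← sq]
      exact Fintype.sum_equiv τ.symm _ _ fun i => rfl
    · have := dotProduct_pow_mulVec h1 h2 1 (∑ i, c i • u (τ i))
      simp only [pow_one, hc] at this
      dsimp only
      rw [this]
      refine Fintype.sum_equiv τ.symm _ _ fun i => ?_
      rw [hval, Equiv.apply_symm_apply]
  · have hi : 1 ≤ i.1 + 1 ∧ i.1 + 1 ≤ n := ⟨by omega, i.2⟩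
    have hj : 1 ≤ j.1 + 1 ∧ j.1 + 1 ≤ n := ⟨by omega, j.2⟩
    dsimp only
    rw [eigAsc, eigAsc, dif_pos hi, dif_pos hj]
    refine hM.eigenvalues₀_antitone ?_
    rw [Fin.le_def] at hij ⊢
    dsimp only
    omega

end MinMax

/-! ## Energy and mass of a function on the vertices -/

/-- The function `{u, v} ↦ y u + y v` on unordered pairs. -/
def pairSum {n : ℕ} (y : Fin n → ℝ) : Sym2 (Fin n) → ℝ :=
  Sym2.lift ⟨fun u v => y u + y v, fun u v => add_comm (y u) (y v)⟩

@[simp] theorem pairSum_mk {n : ℕ} (y : Fin n → ℝ) (u v : Fin n) :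
    pairSum y s(u, v) = y u + y v := rfl

theorem pairSum_sum_smul {n : ℕ} {ι : Type*} (s : Finset ι) (c : ι → ℝ) (y : ι → Fin n → ℝ)
    (e : Sym2 (Fin n)) : pairSum (∑ i ∈ s, c i • y i) e = ∑ i ∈ s, c i * pairSum (y i) e := by
  induction e using Sym2.ind with
  | _ u v =>
    simp only [pairSum_mk, Finset.sum_apply, Pi.smul_apply, smul_eq_mul, mul_add,
      Finset.sum_add_distrib]

namespace WGraph

variable {n : ℕ} (G : WGraph n)

theorem wt_nonneg (u v : Fin n) : 0 ≤ G.wt u v := NNReal.coe_nonneg _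

theorem deg_nonneg (u : Fin n) : 0 ≤ G.deg u := Finset.sum_nonneg fun v _ => G.wt_nonneg u v

theorem sum_sum_eq_two_mul_sum_edges (g : Sym2 (Fin n) → ℝ) (hg : ∀ e, e ∉ G.edges → g e = 0) :
    ∑ u, ∑ v, g s(u, v) = 2 * ∑ e ∈ G.edges, g e := by
  have h1 : ∑ u, ∑ v, g s(u, v) =
      ∑ x ∈ Finset.univ.filter (fun x : Fin n × Fin n => s(x.1, x.2) ∈ G.edges),
        g s(x.1, x.2) := by
    rw [← Fintype.sum_prod_type', Finset.sum_filter]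
    refine Finset.sum_congr rfl fun x _ => ?_
    split_ifs with h
    · rfl
    · exact hg _ h
  rw [h1, ← Finset.sum_fiberwise_of_maps_to (g := fun x : Fin n × Fin n => s(x.1, x.2))
    (t := G.edges) (fun x hx => (Finset.mem_filter.1 hx).2), Finset.mul_sum]
  refine Finset.sum_congr rfl fun e he => ?_
  induction e using Sym2.ind with
  | _ a b =>
    have hab : a ≠ b := fun h => G.loopless _ he (by simp [h])
    have : (Finset.univ.filter fun x : Fin n × Fin n => s(x.1, x.2) ∈ G.edges).filter
        (fun x => s(x.1, x.2) = s(a, b)) = {(a, b), (b, a)} := by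
      ext ⟨u, v⟩
      simp only [Finset.mem_filter, Finset.mem_univ, true_and, Finset.mem_insert,
        Finset.mem_singleton, Prod.mk.injEq, Sym2.eq_iff]
      constructor
      · exact fun h => h.2
      · rintro (⟨rfl, rfl⟩ | ⟨rfl, rfl⟩)
        · exact ⟨he, Or.inl ⟨rfl, rfl⟩⟩
        · exact ⟨by rwa [Sym2.eq_swap], Or.inr ⟨rfl, rfl⟩⟩
    rw [this, Finset.sum_pair (by simp [hab]), Sym2.eq_swap]
    ring

/-- `∑_{u v ∈ E} w(u, v) (y u + y v)²`. -/
noncomputable def energy (y : Fin n → ℝ) : ℝ :=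
  ∑ e ∈ G.edges, (G.weight e : ℝ) * pairSum y e ^ 2

/-- `∑_u d(u) (y u)²`. -/
noncomputable def mass (y : Fin n → ℝ) : ℝ := ∑ u, G.deg u * y u ^ 2

theorem energy_eq (y : Fin n → ℝ) :
    G.energy y = G.mass y + ∑ u, ∑ v, y u * (G.wt u v * y v) := by
  have h := G.sum_sum_eq_two_mul_sum_edges (fun e => (G.weight e : ℝ) * pairSum y e ^ 2)
    (fun e he => by simp [G.weight_eq_zero e he])
  have h2 : ∑ u, ∑ v, (G.weight s(u, v) : ℝ) * pairSum y s(u, v) ^ 2 =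
      2 * (G.mass y + ∑ u, ∑ v, y u * (G.wt u v * y v)) := by
    have e1 : ∑ u, ∑ v, G.wt u v * y u ^ 2 = G.mass y := by
      simp only [mass, deg, Finset.sum_mul]
    have e2 : ∑ u, ∑ v, G.wt u v * y v ^ 2 = G.mass y := by
      rw [Finset.sum_comm, ← e1]
      exact Finset.sum_congr rfl fun u _ => Finset.sum_congr rfl fun v _ => by rw [G.wt_comm]
    rw [two_mul, add_add_add_comm]
    nth_rewrite 1 [← e1]
    rw [← e2]
    simp only [← Finset.sum_add_distrib]
    refine Finset.sum_congr rfl fun u _ => Finset.sum_congr rfl fun v _ => ?_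
    rw [pairSum_mk, wt]
    ring
  rw [energy]
  linarith

theorem energy_le (y : Fin n → ℝ) : G.energy y ≤ 2 * G.mass y := by
  have h1 : 0 ≤ ∑ u, ∑ v, G.wt u v * (y u - y v) ^ 2 :=
    Finset.sum_nonneg fun u _ => Finset.sum_nonneg fun v _ =>
      mul_nonneg (G.wt_nonneg u v) (sq_nonneg _)
  have e1 : ∑ u, ∑ v, G.wt u v * y u ^ 2 = G.mass y := by
    simp only [mass, deg, Finset.sum_mul]
  have e2 : ∑ u, ∑ v, G.wt u v * y v ^ 2 = G.mass y := by
    rw [Finset.sum_comm, ← e1]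
    exact Finset.sum_congr rfl fun u _ => Finset.sum_congr rfl fun v _ => by rw [G.wt_comm]
  have h2 : ∑ u, ∑ v, G.wt u v * (y u - y v) ^ 2 = G.mass y + G.mass y -
      2 * ∑ u, ∑ v, y u * (G.wt u v * y v) := by
    nth_rewrite 1 [← e1]
    rw [← e2]
    simp only [Finset.mul_sum, ← Finset.sum_add_distrib, ← Finset.sum_sub_distrib]
    exact Finset.sum_congr rfl fun u _ => Finset.sum_congr rfl fun v _ => by ring
  rw [G.energy_eq]
  linarith

open Matrix

theorem mass_degInvSqrt {G : WGraph n} (hG : ∀ u, 0 < G.deg u) (z : Fin n → ℝ) :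
    G.mass (fun u => (√(G.deg u))⁻¹ * z u) = z ⬝ᵥ z := by
  refine Finset.sum_congr rfl fun u _ => ?_
  have := Real.sq_sqrt (hG u).le
  have h0 := (Real.sqrt_pos.2 (hG u)).ne'
  rw [mul_pow, inv_pow, this]
  field_simp [(hG u).ne']

theorem energy_degInvSqrt {G : WGraph n} (hG : ∀ u, 0 < G.deg u) (z : Fin n → ℝ) :
    G.energy (fun u => (√(G.deg u))⁻¹ * z u) = z ⬝ᵥ (G.signless *ᵥ z) := by
  rw [G.energy_eq, mass_degInvSqrt hG, signless, add_mulVec, one_mulVec, dotProduct_add]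
  congr 1
  simp only [dotProduct, mulVec, Finset.mul_sum, normAdj, degInvSqrt, adj, mul_diagonal,
    diagonal_mul, of_apply]
  exact Finset.sum_congr rfl fun u _ => Finset.sum_congr rfl fun v _ => by ring

/-- The substitution `y = D^{-1/2} z` moves the eigenvalue problem of `J` to functions on the
vertices, where test functions of one graph can be used for another with different degrees. -/
theorem exists_simDiag {G : WGraph n} (hG : ∀ u, 0 < G.deg u) :
    ∃ y, SimDiag G.energy G.mass y (fun i => G.signlessEig (i + 1)) ∧
      Monotone fun i : Fin n => G.signlessEig (i + 1) := by
  obtain ⟨f, hf, hmono⟩ := exists_simDiag_eigAsc G.signless G.isHermitian_signless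
  refine ⟨fun i u => (√(G.deg u))⁻¹ * f i u, fun c => ?_, hmono⟩
  have e : ∑ i, c i • (fun u => (√(G.deg u))⁻¹ * f i u) =
      fun u => (√(G.deg u))⁻¹ * (∑ i, c i • f i) u := by
    funext u
    simp only [Finset.sum_apply, Pi.smul_apply, smul_eq_mul, Finset.mul_sum]
    exact Finset.sum_congr rfl fun i _ => by ring
  rw [e, mass_degInvSqrt hG, energy_degInvSqrt hG]
  exact hf c

/-- Since the normalised Laplacian is `2 - J`, reversing the diagonalisation of `J` diagonalises it,
and sorted diagonalisations have unique coefficients. The zero-based index `k` reverses to `n - 1 -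
k`, the `(n - k)`-th eigenvalue. -/
theorem lapEig_eq {k : ℕ} (hk : k < n) :
    G.lapEig (n - k) = 2 - G.signlessEig (k + 1) := by
  obtain ⟨f, hf, hmono⟩ := exists_simDiag_eigAsc G.signless G.isHermitian_signless
  obtain ⟨f', hf', hmono'⟩ := exists_simDiag_eigAsc G.lap G.isHermitian_lap
  have h2 := hf.rev 2
  have e : (fun z : Fin n → ℝ => 2 * (z ⬝ᵥ z) - z ⬝ᵥ (G.signless *ᵥ z)) =
      fun z => z ⬝ᵥ (G.lap *ᵥ z) := by
    funext z
    rw [signless, lap, add_mulVec, sub_mulVec, one_mulVec, dotProduct_add, dotProduct_sub]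
    ring
  rw [e] at h2
  have h3 := congrFun (hf'.unique hmono' h2 fun a b hab =>
    sub_le_sub_left (hmono (Fin.rev_anti hab)) 2) (⟨k, hk⟩ : Fin n).rev
  simp only [Fin.rev_rev, Fin.val_rev] at h3
  rw [lapEig, signlessEig]
  have e2 : n - (k + 1) + 1 = n - k := by omega
  rw [e2] at h3
  exact h3

/-- Weighted Cauchy–Schwarz. Distinctness of `u` and `v` makes their contributions two separate
terms of the mass. -/
theorem pairSum_sq_le {G : WGraph n} (hG : ∀ u, 0 < G.deg u) {u v : Fin n} (huv : u ≠ v)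
    (y : Fin n → ℝ) : (y u + y v) ^ 2 ≤ ((G.deg u)⁻¹ + (G.deg v)⁻¹) * G.mass y := by
  have h1 : G.deg u * y u ^ 2 + G.deg v * y v ^ 2 ≤ G.mass y := by
    rw [mass, ← Finset.sum_pair (f := fun u => G.deg u * y u ^ 2) huv]
    exact Finset.sum_le_sum_of_subset_of_nonneg (Finset.subset_univ _) fun w _ _ =>
      mul_nonneg (G.deg_nonneg w) (sq_nonneg _)
  have hu := hG u
  have hv := hG v
  refine le_trans ?_ (mul_le_mul_of_nonneg_left h1 (by positivity))
  have e : ((G.deg u)⁻¹ + (G.deg v)⁻¹) * (G.deg u * y u ^ 2 + G.deg v * y v ^ 2) -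
      (y u + y v) ^ 2 = (G.deg u * y u - G.deg v * y v) ^ 2 / (G.deg u * G.deg v) := by
    field_simp
    ring
  have : 0 ≤ (G.deg u * y u - G.deg v * y v) ^ 2 / (G.deg u * G.deg v) := by positivity
  linarith

/-- The coordinates of the functional `y ↦ y u + y v` in a mass-orthonormal basis. -/
theorem sum_pairSum_sq_le {G : WGraph n} (hG : ∀ u, 0 < G.deg u) {y : Fin n → Fin n → ℝ}
    {ν : Fin n → ℝ} (h : SimDiag G.energy G.mass y ν) {u v : Fin n} (huv : u ≠ v) :
    ∑ i, (y i u + y i v) ^ 2 ≤ (G.deg u)⁻¹ + (G.deg v)⁻¹ := by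
  set β : Fin n → ℝ := fun i => y i u + y i v with hβ
  -- A dual norm is computed by testing the functional on the vector with its own coordinates: the
  -- inequality becomes `(∑ β²)² ≤ (1/d(u) + 1/d(v)) ∑ β²`.
  have h1 := pairSum_sq_le hG huv (∑ i, β i • y i)
  rw [(h β).1] at h1
  have e : (∑ i, β i • y i) u + (∑ i, β i • y i) v = ∑ i, β i ^ 2 := by
    simp only [Finset.sum_apply, Pi.smul_apply, smul_eq_mul, ← Finset.sum_add_distrib, ← mul_add]
    exact Finset.sum_congr rfl fun i _ => by rw [hβ]; ring
  rw [e, sq] at h1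
  have hn : 0 ≤ ∑ i, β i ^ 2 := Finset.sum_nonneg fun i _ => sq_nonneg _
  rcases hn.eq_or_lt with h0 | h0
  · have hu := hG u
    have hv := hG v
    change ∑ i, β i ^ 2 ≤ _
    rw [← h0]
    positivity
  · exact le_of_mul_le_mul_right h1 h0

end WGraph

/-! ## Edge probabilities and sampled weights -/

namespace WGraph

variable {n : ℕ} {G : WGraph n} {C ℓ : ℝ}

/-- The weight that an edge gets if it is sampled. -/
noncomputable def sampledWeight (G : WGraph n) (C ℓ : ℝ) (e : Sym2 (Fin n)) : ℝ :=
  (G.weight e : ℝ) / G.edgeProb C ℓ e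

/-- The scale `ℓ / (C log³ n)` of sampled weights relative to degrees. -/
noncomputable def sampleScale (n : ℕ) (C ℓ : ℝ) : ℝ := ℓ / (C * Real.log n ^ 3)

theorem edgeProb_mk (u v : Fin n) : G.edgeProb C ℓ s(u, v) =
    G.halfProb C ℓ u v + G.halfProb C ℓ v u - G.halfProb C ℓ u v * G.halfProb C ℓ v u := rfl

theorem halfProb_le_one (u v : Fin n) : G.halfProb C ℓ u v ≤ 1 := min_le_right _ _

theorem sampleScale_pos (hn : 1 < n) (hC : 0 < C) (hℓ : 0 < ℓ) : 0 < sampleScale n C ℓ := by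
  have := Real.log_pos (Nat.one_lt_cast.2 hn)
  unfold sampleScale
  positivity

theorem halfProb_nonneg (hn : 1 < n) (hC : 0 < C) (hℓ : 0 < ℓ) (u v : Fin n) :
    0 ≤ G.halfProb C ℓ u v := by
  have := Real.log_pos (Nat.one_lt_cast.2 hn)
  have := G.deg_nonneg u
  have := G.wt_nonneg u v
  exact le_min (by positivity) zero_le_one

theorem halfProb_eq (u v : Fin n) :
    G.halfProb C ℓ u v = min (G.wt u v / (sampleScale n C ℓ * G.deg u)) 1 := by
  have : G.wt u v * (C * Real.log n ^ 3 / (G.deg u * ℓ)) =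
      G.wt u v / (sampleScale n C ℓ * G.deg u) := by
    rw [sampleScale, div_mul_eq_mul_div, div_div_eq_mul_div, mul_div_assoc (G.wt u v), mul_comm ℓ]
  rw [halfProb, this]

theorem edgeProb_nonneg (hn : 1 < n) (hC : 0 < C) (hℓ : 0 < ℓ) (e : Sym2 (Fin n)) :
    0 ≤ G.edgeProb C ℓ e := by
  induction e using Sym2.ind with
  | _ u v =>
    rw [edgeProb_mk]
    have h1 := halfProb_nonneg (G := G) hn hC hℓ u v
    have h2 := halfProb_nonneg (G := G) hn hC hℓ v u
    nlinarith [halfProb_le_one (G := G) (C := C) (ℓ := ℓ) u v]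

theorem edgeProb_le_one (e : Sym2 (Fin n)) : G.edgeProb C ℓ e ≤ 1 := by
  induction e using Sym2.ind with
  | _ u v =>
    rw [edgeProb_mk]
    nlinarith [halfProb_le_one (G := G) (C := C) (ℓ := ℓ) u v,
      halfProb_le_one (G := G) (C := C) (ℓ := ℓ) v u]

theorem halfProb_le_edgeProb (hn : 1 < n) (hC : 0 < C) (hℓ : 0 < ℓ) (u v : Fin n) :
    G.halfProb C ℓ u v ≤ G.edgeProb C ℓ s(u, v) := by
  rw [edgeProb_mk]
  have h2 := halfProb_nonneg (G := G) hn hC hℓ v u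
  nlinarith [halfProb_le_one (G := G) (C := C) (ℓ := ℓ) u v]

theorem edgeProb_eq_one_or_sampledWeight_le (hG : ∀ u, 0 < G.deg u) (hn : 1 < n) (hC : 0 < C)
    (hℓ : 0 < ℓ) (u v : Fin n) : G.edgeProb C ℓ s(u, v) = 1 ∨
      G.sampledWeight C ℓ s(u, v) ≤ sampleScale n C ℓ * G.deg u := by
  have hr := mul_pos (sampleScale_pos hn hC hℓ) (hG u)
  have hle := halfProb_le_edgeProb (G := G) hn hC hℓ u v
  rw [halfProb_eq] at hle
  rcases le_total (G.wt u v / (sampleScale n C ℓ * G.deg u)) 1 with h | h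
  · right
    rw [min_eq_left h, div_le_iff₀ hr] at hle
    rcases (edgeProb_nonneg (G := G) hn hC hℓ s(u, v)).eq_or_lt with h0 | h0
    · rw [sampledWeight, ← h0, div_zero]
      exact hr.le
    · rw [sampledWeight, div_le_iff₀ h0, mul_comm]
      exact hle
  · left
    rw [min_eq_right h] at hle
    exact le_antisymm (edgeProb_le_one _) hle

/-- Unbiasedness. An edge may have weight 0; then its probability is 0 too, and the convention `x /
0 = 0` is harmless. -/
theorem edgeProb_mul_sampledWeight (hG : ∀ u, 0 < G.deg u) (hn : 1 < n) (hC : 0 < C)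
    (hℓ : 0 < ℓ) (e : Sym2 (Fin n)) :
    G.edgeProb C ℓ e * G.sampledWeight C ℓ e = G.weight e := by
  rw [sampledWeight]
  rcases (edgeProb_nonneg (G := G) hn hC hℓ e).eq_or_lt with h0 | h0
  · have : (G.weight e : ℝ) = 0 := by
      induction e using Sym2.ind with
      | _ u v =>
        have hr := mul_pos (sampleScale_pos hn hC hℓ) (hG u)
        have hle := halfProb_le_edgeProb (G := G) hn hC hℓ u v
        rw [← h0, halfProb_eq, min_le_iff] at hle
        rcases hle with h | h
        · rw [div_le_iff₀ hr, zero_mul] at h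
          exact le_antisymm h (NNReal.coe_nonneg _)
        · exact absurd h (by norm_num)
    rw [this]
    simp
  · field_simp

theorem sampledWeight_nonneg (hn : 1 < n) (hC : 0 < C) (hℓ : 0 < ℓ) (e : Sym2 (Fin n)) :
    0 ≤ G.sampledWeight C ℓ e :=
  div_nonneg (NNReal.coe_nonneg _) (edgeProb_nonneg hn hC hℓ e)

/-- Bound `p_e` by the sum of its two halves; the halves belonging to a vertex `u` add up to at most
`∑ v, w(u,v) / (r d(u)) = 1 / r`. -/
theorem sum_edgeProb_le (hG : ∀ u, 0 < G.deg u) (hn : 1 < n) (hC : 0 < C) (hℓ : 0 < ℓ) :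
    ∑ e ∈ G.edges, G.edgeProb C ℓ e ≤ n / sampleScale n C ℓ := by
  have hr := sampleScale_pos hn hC hℓ
  have h := G.sum_sum_eq_two_mul_sum_edges (fun e => if e ∈ G.edges then G.edgeProb C ℓ e else 0)
    (fun e he => if_neg he)
  have e1 : ∑ e ∈ G.edges, (if e ∈ G.edges then G.edgeProb C ℓ e else 0) =
      ∑ e ∈ G.edges, G.edgeProb C ℓ e := Finset.sum_congr rfl fun e he => if_pos he
  rw [e1] at h
  have hhalf : ∀ u v, G.halfProb C ℓ u v ≤ G.wt u v / (sampleScale n C ℓ * G.deg u) := fun u v => by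
    rw [halfProb_eq]; exact min_le_left _ _
  have hsum : ∀ u, ∑ v, G.wt u v / (sampleScale n C ℓ * G.deg u) = 1 / sampleScale n C ℓ := by
    intro u
    rw [← Finset.sum_div]
    change G.deg u / _ = _
    have := (hG u).ne'
    field_simp
  have h2 : ∑ u, ∑ v, (if s(u, v) ∈ G.edges then G.edgeProb C ℓ s(u, v) else 0) ≤
      ∑ u, ∑ v, (G.wt u v / (sampleScale n C ℓ * G.deg u) +
        G.wt v u / (sampleScale n C ℓ * G.deg v)) := by
    refine Finset.sum_le_sum fun u _ => Finset.sum_le_sum fun v _ => ?_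
    have h3 := hhalf u v
    have h4 := hhalf v u
    have h5 := halfProb_nonneg (G := G) hn hC hℓ u v
    have h6 := halfProb_nonneg (G := G) hn hC hℓ v u
    split_ifs
    · rw [edgeProb_mk]
      nlinarith
    · linarith
  have h7 : ∑ u : Fin n, ∑ v : Fin n, (G.wt u v / (sampleScale n C ℓ * G.deg u) +
        G.wt v u / (sampleScale n C ℓ * G.deg v)) = 2 * (n / sampleScale n C ℓ) := by
    simp only [Finset.sum_add_distrib]
    rw [Finset.sum_comm (f := fun u v => G.wt v u / (sampleScale n C ℓ * G.deg v))]
    simp only [hsum, Finset.sum_const, Finset.card_univ, Fintype.card_fin, nsmul_eq_mul]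
    ring
  linarith

theorem sparsifier_weight (hn : 1 < n) (hC : 0 < C) (hℓ : 0 < ℓ) {F : Finset (Sym2 (Fin n))}
    (hF : F ⊆ G.edges) {e : Sym2 (Fin n)} (he : e ∈ F) :
    ((G.sparsifier C ℓ F hF).weight e : ℝ) = G.sampledWeight C ℓ e := by
  simp only [sparsifier, if_pos he, NNReal.coe_div,
    Real.coe_toNNReal _ (edgeProb_nonneg hn hC hℓ e), sampledWeight]

/-! ## Cuts as sums over edges -/

-- Injectivity says that no edge is counted twice. It holds for disjoint `A`, `B` and also for `A =
-- {u}`, `B = univ`, so cuts and degrees share one tail bound.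
open scoped Classical in
theorem cut_eq_sum_edges (G : WGraph n) {A B : Finset (Fin n)}
    (h : Set.InjOn (fun x : Fin n × Fin n => s(x.1, x.2)) ↑(A ×ˢ B)) :
    G.cut A B = ∑ e ∈ G.edges,
      if e ∈ (A ×ˢ B).image (fun x => s(x.1, x.2)) then (G.weight e : ℝ) else 0 := by
  rw [← Finset.sum_filter, Finset.filter_mem_eq_inter, cut, ← Finset.sum_product',
    Finset.sum_congr rfl fun x _ => show G.wt x.1 x.2 = (G.weight s(x.1, x.2) : ℝ) from rfl,
    ← Finset.sum_image (f := fun e => (G.weight e : ℝ)) h]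
  refine (Finset.sum_subset Finset.inter_subset_right fun e he h' => ?_).symm
  rw [G.weight_eq_zero e fun h'' => h' (Finset.mem_inter.2 ⟨h'', he⟩), NNReal.coe_zero]

theorem injOn_mk_of_disjoint {A B : Finset (Fin n)} (h : Disjoint A B) :
    Set.InjOn (fun x : Fin n × Fin n => s(x.1, x.2)) ↑(A ×ˢ B) := by
  rintro ⟨u, v⟩ h1 ⟨u', v'⟩ h2 he
  simp only [Finset.coe_product, Set.mem_prod, Finset.mem_coe] at h1 h2
  rcases Sym2.eq_iff.1 he with ⟨rfl, rfl⟩ | ⟨rfl, rfl⟩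
  · rfl
  · exact absurd h2.2 (Finset.disjoint_left.1 h h1.1)

theorem injOn_mk_singleton (u : Fin n) :
    Set.InjOn (fun x : Fin n × Fin n => s(x.1, x.2)) ↑(({u} : Finset (Fin n)) ×ˢ
      (Finset.univ : Finset (Fin n))) := by
  rintro ⟨a, v⟩ h1 ⟨b, v'⟩ h2 he
  simp only [Finset.coe_product, Set.mem_prod, Finset.mem_coe, Finset.mem_singleton] at h1 h2
  obtain ⟨rfl, -⟩ := h1
  obtain ⟨rfl, -⟩ := h2
  exact congrArg _ (Sym2.congr_right.1 he)

theorem cut_singleton_univ (G : WGraph n) (u : Fin n) : G.cut {u} Finset.univ = G.deg u := by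
  simp [cut, deg]

open scoped Classical in
/-- The value of the cut `(A, B)` after sampling the edges in `F`. -/
noncomputable def sampledCut (G : WGraph n) (C ℓ : ℝ) (A B : Finset (Fin n))
    (F : Finset (Sym2 (Fin n))) : ℝ :=
  ∑ e ∈ F, if e ∈ (A ×ˢ B).image (fun x => s(x.1, x.2)) then G.sampledWeight C ℓ e else 0

theorem sparsifier_cut (hn : 1 < n) (hC : 0 < C) (hℓ : 0 < ℓ) {F : Finset (Sym2 (Fin n))}
    (hF : F ⊆ G.edges) {A B : Finset (Fin n)}
    (h : Set.InjOn (fun x : Fin n × Fin n => s(x.1, x.2)) ↑(A ×ˢ B)) :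
    (G.sparsifier C ℓ F hF).cut A B = G.sampledCut C ℓ A B F := by
  classical
  rw [cut_eq_sum_edges _ h, sampledCut]
  exact Finset.sum_congr rfl fun e he => by rw [sparsifier_weight hn hC hℓ hF he]

theorem sparsifier_deg (hn : 1 < n) (hC : 0 < C) (hℓ : 0 < ℓ) {F : Finset (Sym2 (Fin n))}
    (hF : F ⊆ G.edges) (u : Fin n) :
    (G.sparsifier C ℓ F hF).deg u = G.sampledCut C ℓ {u} Finset.univ F := by
  rw [← cut_singleton_univ, sparsifier_cut hn hC hℓ hF (injOn_mk_singleton u)]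

theorem sampledCut_tail (hG : ∀ u, 0 < G.deg u) (hn : 1 < n) (hC : 0 < C) (hℓ : 0 < ℓ)
    {A B : Finset (Fin n)} (h : Set.InjOn (fun x : Fin n × Fin n => s(x.1, x.2)) ↑(A ×ˢ B))
    {D : ℝ} (hD : 0 < D) (hA : ∀ u ∈ A, G.deg u ≤ D) :
    subsetProb G.edges (G.edgeProb C ℓ) (fun F => 3 * G.cut A B ≤ G.sampledCut C ℓ A B F) ≤
      Real.exp (-(G.cut A B / (sampleScale n C ℓ * D))) ∧
    subsetProb G.edges (G.edgeProb C ℓ) (fun F => G.sampledCut C ℓ A B F ≤ G.cut A B / 4) ≤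
      Real.exp (-(G.cut A B / (4 * (sampleScale n C ℓ * D)))) := by
  classical
  have hr := sampleScale_pos hn hC hℓ
  have hRD := mul_pos hr hD
  set x : Sym2 (Fin n) → ℝ := fun e =>
    if e ∈ (A ×ˢ B).image (fun x => s(x.1, x.2)) then G.sampledWeight C ℓ e else 0 with hx
  have hx0 : ∀ e ∈ G.edges, 0 ≤ x e := fun e _ => by
    simp only [hx]
    split_ifs
    exacts [sampledWeight_nonneg hn hC hℓ e, le_rfl]
  have hxR : ∀ e ∈ G.edges, G.edgeProb C ℓ e = 1 ∨ x e ≤ sampleScale n C ℓ * D := fun e _ => by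
    simp only [hx]
    split_ifs with h
    · obtain ⟨⟨u, v⟩, huv, rfl⟩ := Finset.mem_image.1 h
      refine (edgeProb_eq_one_or_sampledWeight_le hG hn hC hℓ u v).imp id fun h1 => h1.trans ?_
      exact mul_le_mul_of_nonneg_left (hA u (Finset.mem_product.1 huv).1) hr.le
    · exact Or.inr hRD.le
  have hm : ∑ e ∈ G.edges, G.edgeProb C ℓ e * x e = G.cut A B := by
    rw [cut_eq_sum_edges _ h]
    refine Finset.sum_congr rfl fun e _ => ?_
    simp only [hx, mul_ite, mul_zero, edgeProb_mul_sampledWeight hG hn hC hℓ]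
  have h0 : ∀ e ∈ G.edges, 0 ≤ G.edgeProb C ℓ e := fun e _ => edgeProb_nonneg hn hC hℓ e
  have h1 : ∀ e ∈ G.edges, G.edgeProb C ℓ e ≤ 1 := fun e _ => edgeProb_le_one e
  have t1 := subsetProb_three_mul_le h0 h1 hx0 hRD hxR hm.le
  have t2 := subsetProb_le_div_four h0 h1 hx0 hRD hxR
  rw [hm] at t2
  exact ⟨t1, t2⟩

/-! ## The dual Cheeger constant after sampling -/

theorem finite_rhoBar_set (G : WGraph n) (k : ℕ) :
    {r | ∃ A B : Fin k → Finset (Fin n), IsPairFamily A B ∧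
      r = ⨅ i, G.phiBar (A i) (B i)}.Finite := by
  refine (Set.finite_range fun P : (Fin k → Finset (Fin n)) × (Fin k → Finset (Fin n)) =>
    ⨅ i, G.phiBar (P.1 i) (P.2 i)).subset ?_
  rintro r ⟨A, B, -, rfl⟩
  exact ⟨(A, B), rfl⟩

theorem exists_isPairFamily_of_rhoBar_pos {k : ℕ} (h : 0 < G.rhoBar k) :
    ∃ A B : Fin k → Finset (Fin n), IsPairFamily A B ∧
      ∀ i, G.rhoBar k ≤ G.phiBar (A i) (B i) := by
  have hne : {r | ∃ A B : Fin k → Finset (Fin n), IsPairFamily A B ∧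
      r = ⨅ i, G.phiBar (A i) (B i)}.Nonempty := by
    by_contra h0
    rw [Set.not_nonempty_iff_eq_empty] at h0
    rw [rhoBar, h0, Real.sSup_empty] at h
    exact lt_irrefl _ h
  obtain ⟨A, B, hAB, heq⟩ := hne.csSup_mem (finite_rhoBar_set G k)
  refine ⟨A, B, hAB, fun i => ?_⟩
  rw [rhoBar, heq]
  exact ciInf_le (Set.finite_range _).bddBelow i

theorem le_rhoBar {k : ℕ} (hk : 1 ≤ k) {A B : Fin k → Finset (Fin n)} (hAB : IsPairFamily A B)
    {r : ℝ} (h : ∀ i, r ≤ G.phiBar (A i) (B i)) : r ≤ G.rhoBar k := by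
  have : Nonempty (Fin k) := ⟨⟨0, hk⟩⟩
  exact (le_ciInf h).trans (le_csSup (finite_rhoBar_set G k).bddAbove ⟨A, B, hAB, rfl⟩)

theorem vol_pos (hG : ∀ u, 0 < G.deg u) {S : Finset (Fin n)} (hS : S.Nonempty) : 0 < G.vol S :=
  Finset.sum_pos (fun u _ => hG u) hS

/-- The cut loses a factor 4 and the volume gains at most 3. The lower degree bound keeps the new
volume positive, so the quotient is genuine. -/
theorem phiBar_ge_of_comparison {H : WGraph n} (hG : ∀ u, 0 < G.deg u) {A B : Finset (Fin n)}
    (hne : (A ∪ B).Nonempty) (hlow : ∀ u, G.deg u / 4 ≤ H.deg u) (hup : ∀ u, H.deg u ≤ 3 * G.deg u)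
    (hcut : G.cut A B / 4 ≤ H.cut A B) : G.phiBar A B / 12 ≤ H.phiBar A B := by
  have hH : ∀ u, 0 < H.deg u := fun u => by linarith [hG u, hlow u]
  have hv := vol_pos hG hne
  have hv' := vol_pos hH hne
  have hvv : H.vol (A ∪ B) ≤ 3 * G.vol (A ∪ B) := by
    rw [vol, vol, Finset.mul_sum]
    exact Finset.sum_le_sum fun u _ => hup u
  have hc : 0 ≤ G.cut A B := Finset.sum_nonneg fun u _ => Finset.sum_nonneg fun v _ =>
    G.wt_nonneg u v
  rw [phiBar, phiBar, div_div, div_le_div_iff₀ (by positivity) hv']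
  nlinarith

end WGraph

/-! ## The spectrum after sampling -/

namespace WGraph

variable {n : ℕ} {G : WGraph n} {C ℓ : ℝ}

theorem mass_le_mass {G H : WGraph n} {t : ℝ} (h : ∀ u, G.deg u ≤ t * H.deg u) (y : Fin n → ℝ) :
    G.mass y ≤ t * H.mass y := by
  rw [mass, mass, Finset.mul_sum]
  refine Finset.sum_le_sum fun u _ => ?_
  rw [← mul_assoc]
  exact mul_le_mul_of_nonneg_right (h u) (sq_nonneg _)

theorem sparsifier_energy (hn : 1 < n) (hC : 0 < C) (hℓ : 0 < ℓ) {F : Finset (Sym2 (Fin n))}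
    (hF : F ⊆ G.edges) (y : Fin n → ℝ) : (G.sparsifier C ℓ F hF).energy y =
      ∑ e ∈ F, G.sampledWeight C ℓ e * pairSum y e ^ 2 :=
  Finset.sum_congr rfl fun e he => by rw [sparsifier_weight hn hC hℓ hF he]

/-- The leverage of a random edge: the dual norm contributes `1/d(u) + 1/d(v)`, and the sampled
weight is at most `r d(u)` and at most `r d(v)`. -/
theorem edgeProb_eq_one_or_sampledWeight_mul_le (hG : ∀ u, 0 < G.deg u) (hn : 1 < n) (hC : 0 < C)
    (hℓ : 0 < ℓ) {y : Fin n → Fin n → ℝ} {ν : Fin n → ℝ} (h : SimDiag G.energy G.mass y ν)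
    {e : Sym2 (Fin n)} (he : e ∈ G.edges) : G.edgeProb C ℓ e = 1 ∨
      G.sampledWeight C ℓ e * ∑ i, pairSum (y i) e ^ 2 ≤ 2 * sampleScale n C ℓ := by
  induction e using Sym2.ind with
  | _ u v =>
    have huv : u ≠ v := fun h => G.loopless _ he (by simp [h])
    rcases edgeProb_eq_one_or_sampledWeight_le hG hn hC hℓ u v with h1 | h1
    · exact Or.inl h1
    rcases edgeProb_eq_one_or_sampledWeight_le hG hn hC hℓ v u with h2 | h2
    · exact Or.inl (by rwa [Sym2.eq_swap])
    rw [Sym2.eq_swap] at h2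
    right
    have h3 := sum_pairSum_sq_le hG h huv
    have hw := sampledWeight_nonneg (G := G) hn hC hℓ s(u, v)
    refine (mul_le_mul_of_nonneg_left h3 hw).trans ?_
    have e1 := (div_le_iff₀ (hG u)).2 h1
    have e2 := (div_le_iff₀ (hG v)).2 h2
    rw [div_eq_mul_inv] at e1 e2
    linarith

/-- Cauchy–Schwarz bounds the sampled energy of any combination of the bottom eigenfunctions by the
trace in `hsum`. This makes a matrix upper tail unnecessary; the trace costs a factor `k + 1`, and
the mass comparison costs 4. -/
theorem signlessEig_sparsifier_le (hG : ∀ u, 0 < G.deg u) (hn : 1 < n) (hC : 0 < C)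
    (hℓ : 0 < ℓ) {k : ℕ} (hk : k < n) {F : Finset (Sym2 (Fin n))} (hF : F ⊆ G.edges)
    {y : Fin n → Fin n → ℝ} (h : SimDiag G.energy G.mass y fun i => G.signlessEig (i + 1))
    (hlow : ∀ u, G.deg u / 4 ≤ (G.sparsifier C ℓ F hF).deg u) {t : ℝ} (ht : 0 ≤ t)
    (hsum : ∑ e ∈ F, G.sampledWeight C ℓ e *
      ∑ i : Fin (k + 1), pairSum (y (Fin.castLE hk i)) e ^ 2 ≤ t) :
    (G.sparsifier C ℓ F hF).signlessEig (k + 1) ≤ 4 * t := by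
  have hH : ∀ u, 0 < (G.sparsifier C ℓ F hF).deg u := fun u => by linarith [hG u, hlow u]
  obtain ⟨f, hf, hmono⟩ := exists_simDiag hH
  refine hf.le_of_family hmono ⟨k, hk⟩ (ι := Fin (k + 1)) (by simp)
    (h.linearIndependent.comp (Fin.castLE hk) (Fin.castLE_injective hk)) fun c => ?_
  have hc := (h.comp (Fin.castLE_injective hk) c).1
  have hm := mass_le_mass (G := G) (H := G.sparsifier C ℓ F hF) (t := 4)
    (fun u => by linarith [hlow u]) (∑ i, c i • y (Fin.castLE hk i))
  rw [hc] at hm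
  simp only [Function.comp_apply]
  rw [sparsifier_energy hn hC hℓ]
  have h1 : ∑ e ∈ F, G.sampledWeight C ℓ e * pairSum (∑ i, c i • y (Fin.castLE hk i)) e ^ 2 ≤
      (∑ i, c i ^ 2) * t := by
    refine le_trans ?_ (mul_le_mul_of_nonneg_left hsum (Finset.sum_nonneg fun i _ => sq_nonneg _))
    rw [Finset.mul_sum]
    refine Finset.sum_le_sum fun e _ => ?_
    rw [mul_left_comm, pairSum_sum_smul]
    exact mul_le_mul_of_nonneg_left (Finset.sum_mul_sq_le_sq_mul_sq _ _ _)
      (sampledWeight_nonneg hn hC hℓ e)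
  refine h1.trans ((mul_le_mul_of_nonneg_right hm ht).trans (le_of_eq (by ring)))

/-- The embedding of the top `n - k` indices. -/
def topIndex (n k : ℕ) (i : Fin (n - k)) : Fin n := ⟨k + i, by omega⟩

theorem topIndex_injective (n k : ℕ) : Function.Injective (topIndex n k) := fun i j h => by
  have := congrArg Fin.val h
  simp only [topIndex] at this
  exact Fin.ext (by omega)

/-- The vectors `√(w(e) / p(e)) J^{-1/2} b_e`, restricted to the top `n - k` eigenspaces. -/
noncomputable def edgeVector (G : WGraph n) (C ℓ : ℝ) (k : ℕ) (y : Fin n → Fin n → ℝ)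
    (ν : Fin n → ℝ) (e : Sym2 (Fin n)) (i : Fin (n - k)) : ℝ :=
  √(G.sampledWeight C ℓ e) * (pairSum (y (topIndex n k i)) e / √(ν (topIndex n k i)))

open Matrix in
theorem edgeVector_dotProduct_sq (hn : 1 < n) (hC : 0 < C) (hℓ : 0 < ℓ) (k : ℕ)
    (y : Fin n → Fin n → ℝ) (ν : Fin n → ℝ) (e : Sym2 (Fin n)) (z : Fin (n - k) → ℝ) :
    (G.edgeVector C ℓ k y ν e ⬝ᵥ z) ^ 2 = G.sampledWeight C ℓ e *
      pairSum (∑ i, (z i / √(ν (topIndex n k i))) • y (topIndex n k i)) e ^ 2 := by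
  have : G.edgeVector C ℓ k y ν e ⬝ᵥ z = √(G.sampledWeight C ℓ e) *
      pairSum (∑ i, (z i / √(ν (topIndex n k i))) • y (topIndex n k i)) e := by
    rw [pairSum_sum_smul, dotProduct, Finset.mul_sum]
    exact Finset.sum_congr rfl fun i _ => by rw [edgeVector]; ring
  rw [this, mul_pow, Real.sq_sqrt (sampledWeight_nonneg hn hC hℓ e)]

open Matrix in
theorem le_signlessEig_sparsifier (hG : ∀ u, 0 < G.deg u) (hn : 1 < n) (hC : 0 < C)
    (hℓ : 0 < ℓ) {k : ℕ} (hk : k < n) {F : Finset (Sym2 (Fin n))} (hF : F ⊆ G.edges)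
    {y : Fin n → Fin n → ℝ} {ν : Fin n → ℝ} (h : SimDiag G.energy G.mass y ν) (hν : Monotone ν)
    (hμ : 0 < ν ⟨k, hk⟩)
    (hlow : ∀ u, G.deg u / 4 ≤ (G.sparsifier C ℓ F hF).deg u)
    (hup : ∀ u, (G.sparsifier C ℓ F hF).deg u ≤ 3 * G.deg u)
    (hsum : ∀ z, (z ⬝ᵥ z) / 8 ≤ ∑ e ∈ F, (G.edgeVector C ℓ k y ν e ⬝ᵥ z) ^ 2) :
    ν ⟨k, hk⟩ / 24 ≤ (G.sparsifier C ℓ F hF).signlessEig (k + 1) := by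
  have hH : ∀ u, 0 < (G.sparsifier C ℓ F hF).deg u := fun u => by linarith [hG u, hlow u]
  have hνi : ∀ i, ν ⟨k, hk⟩ ≤ ν (topIndex n k i) := fun i => hν (by
    rw [Fin.le_def]; simp [topIndex])
  obtain ⟨f, hf, hmono⟩ := exists_simDiag hH
  refine hf.ge_of_family hmono ⟨k, hk⟩ (ι := Fin (n - k)) (by simp; omega)
    (h.linearIndependent.comp (topIndex n k) (topIndex_injective n k)) fun c => ?_
  have hc := (h.comp (topIndex_injective n k) c).1
  have hm := mass_le_mass (G := G.sparsifier C ℓ F hF) (H := G) (t := 3) hup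
    (∑ i, c i • y (topIndex n k i))
  rw [hc] at hm
  simp only [Function.comp_apply]
  rw [sparsifier_energy hn hC hℓ]
  -- This `z` undoes the division by `√ν` in `edgeVector`, and `z ⬝ᵥ z` becomes the energy of `∑ c i
  -- y i`. The constant 24 is 8 from `hsum` times 3 from the mass.
  have h1 := hsum fun i => √(ν (topIndex n k i)) * c i
  simp only [edgeVector_dotProduct_sq hn hC hℓ] at h1
  have e1 : ∀ i, √(ν (topIndex n k i)) * c i / √(ν (topIndex n k i)) = c i := fun i => by
    have := (Real.sqrt_pos.2 (hμ.trans_le (hνi i))).ne'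
    field_simp
  simp only [e1] at h1
  refine le_trans ?_ h1
  have h2 : ν ⟨k, hk⟩ * ∑ i, c i ^ 2 ≤ (fun i => √(ν (topIndex n k i)) * c i) ⬝ᵥ
      fun i => √(ν (topIndex n k i)) * c i := by
    rw [Finset.mul_sum]
    refine Finset.sum_le_sum fun i _ => ?_
    have := Real.mul_self_sqrt (hμ.le.trans (hνi i))
    rw [mul_mul_mul_comm, this, ← sq]
    exact mul_le_mul_of_nonneg_right (hνi i) (sq_nonneg _)
  nlinarith

/-! ## Tail bounds -/

-- In the top coordinates `J^{-1/2}` shrinks squares by at least `ν k`, so the leverage bound gives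
-- squared length at most `2 r / ν k`. By unbiasedness the expected form is the energy of the
-- normalised combination, which is `z ⬝ᵥ z`.
open Matrix in
theorem subsetProb_top_tail (hG : ∀ u, 0 < G.deg u) (hn : 1 < n) (hC : 0 < C)
    (hℓ : 0 < ℓ) {k : ℕ} (hk : k < n)
    {y : Fin n → Fin n → ℝ} {ν : Fin n → ℝ} (h : SimDiag G.energy G.mass y ν) (hν : Monotone ν)
    (hμ : 0 < ν ⟨k, hk⟩) {q : ℕ}
    (hq : (q + 1) * (8 * (2 * sampleScale n C ℓ / ν ⟨k, hk⟩)) ≤ Real.log 2) :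
    subsetProb G.edges (G.edgeProb C ℓ)
      (fun F => ∃ z, ∑ e ∈ F, (G.edgeVector C ℓ k y ν e ⬝ᵥ z) ^ 2 < (z ⬝ᵥ z) / 8) ≤
      n * (1 / 2) ^ q := by
  have hνi : ∀ i, ν ⟨k, hk⟩ ≤ ν (topIndex n k i) := fun i => hν (by
    rw [Fin.le_def]; simp [topIndex])
  have h0 : ∀ e ∈ G.edges, 0 ≤ G.edgeProb C ℓ e := fun e _ => edgeProb_nonneg hn hC hℓ e
  have h1 : ∀ e ∈ G.edges, G.edgeProb C ℓ e ≤ 1 := fun e _ => edgeProb_le_one e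
  refine (subsetProb_rankOne_lower_tail h0 h1 (R := 2 * sampleScale n C ℓ / ν ⟨k, hk⟩)
    (fun e he => ?_) hq fun z => ?_).trans ?_
  · refine (edgeProb_eq_one_or_sampledWeight_mul_le hG hn hC hℓ h he).imp id fun h2 => ?_
    have hw := sampledWeight_nonneg (G := G) hn hC hℓ e
    have e1 : G.edgeVector C ℓ k y ν e ⬝ᵥ G.edgeVector C ℓ k y ν e =
        ∑ i, G.sampledWeight C ℓ e * (pairSum (y (topIndex n k i)) e ^ 2 /
          ν (topIndex n k i)) := by
      refine Finset.sum_congr rfl fun i _ => ?_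
      rw [edgeVector, mul_mul_mul_comm, Real.mul_self_sqrt hw, div_mul_div_comm,
        Real.mul_self_sqrt (hμ.le.trans (hνi i)), sq]
    rw [e1, ← Finset.mul_sum, le_div_iff₀ hμ]
    refine le_trans ?_ h2
    rw [mul_assoc, Finset.sum_mul]
    refine mul_le_mul_of_nonneg_left ?_ hw
    calc _ ≤ ∑ i, pairSum (y (topIndex n k i)) e ^ 2 := by
          refine Finset.sum_le_sum fun i _ => ?_
          rw [div_mul_eq_mul_div, div_le_iff₀ (hμ.trans_le (hνi i))]
          exact mul_le_mul_of_nonneg_left (hνi i) (sq_nonneg _)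
      _ = ∑ j ∈ Finset.univ.map ⟨topIndex n k, topIndex_injective n k⟩, pairSum (y j) e ^ 2 := by
          rw [Finset.sum_map]; rfl
      _ ≤ _ := Finset.sum_le_sum_of_subset_of_nonneg (Finset.subset_univ _)
          fun _ _ _ => sq_nonneg _
  · have e1 : ∑ e ∈ G.edges, G.edgeProb C ℓ e * (G.edgeVector C ℓ k y ν e ⬝ᵥ z) ^ 2 =
        G.energy (∑ i, (z i / √(ν (topIndex n k i))) • y (topIndex n k i)) := by
      refine Finset.sum_congr rfl fun e _ => ?_
      rw [edgeVector_dotProduct_sq hn hC hℓ, ← mul_assoc, edgeProb_mul_sampledWeight hG hn hC hℓ]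
    rw [e1, (h.comp (topIndex_injective n k) _).2]
    refine Finset.sum_le_sum fun i _ => ?_
    have hp := hμ.trans_le (hνi i)
    rw [div_pow, Real.sq_sqrt hp.le, sq]
    field_simp
    exact le_rfl
  · refine mul_le_mul_of_nonneg_right ?_ (by positivity)
    simp

/-- The mean of the trace is the sum of the `k + 1` smallest eigenvalues, and each random summand is
at most `2 r` by the leverage bound. -/
theorem subsetProb_bottom_tail (hG : ∀ u, 0 < G.deg u) (hn : 1 < n) (hC : 0 < C)
    (hℓ : 0 < ℓ) {k : ℕ} (hk : k < n)
    {y : Fin n → Fin n → ℝ} {ν : Fin n → ℝ} (h : SimDiag G.energy G.mass y ν) (hν : Monotone ν) :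
    subsetProb G.edges (G.edgeProb C ℓ)
      (fun F => 3 * ((k + 1) * ν ⟨k, hk⟩) ≤ ∑ e ∈ F, G.sampledWeight C ℓ e *
        ∑ i : Fin (k + 1), pairSum (y (Fin.castLE hk i)) e ^ 2) ≤
      Real.exp (-((k + 1) * ν ⟨k, hk⟩ / (2 * sampleScale n C ℓ))) := by
  have h0 : ∀ e ∈ G.edges, 0 ≤ G.edgeProb C ℓ e := fun e _ => edgeProb_nonneg hn hC hℓ e
  have h1 : ∀ e ∈ G.edges, G.edgeProb C ℓ e ≤ 1 := fun e _ => edgeProb_le_one e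
  have hr := sampleScale_pos hn hC hℓ
  refine subsetProb_three_mul_le h0 h1 (fun e _ => mul_nonneg (sampledWeight_nonneg hn hC hℓ e)
    (Finset.sum_nonneg fun i _ => sq_nonneg _)) (by positivity) (fun e he => ?_) ?_
  · refine (edgeProb_eq_one_or_sampledWeight_mul_le hG hn hC hℓ h he).imp id fun h2 => ?_
    refine le_trans ?_ h2
    refine mul_le_mul_of_nonneg_left ?_ (sampledWeight_nonneg hn hC hℓ e)
    calc _ = ∑ j ∈ Finset.univ.map (Fin.castLEEmb hk), pairSum (y j) e ^ 2 := by
          rw [Finset.sum_map]; rfl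
      _ ≤ _ := Finset.sum_le_sum_of_subset_of_nonneg (Finset.subset_univ _)
          fun _ _ _ => sq_nonneg _
  · have e1 : ∑ e ∈ G.edges, G.edgeProb C ℓ e * (G.sampledWeight C ℓ e *
        ∑ i : Fin (k + 1), pairSum (y (Fin.castLE hk i)) e ^ 2) =
        ∑ i : Fin (k + 1), ν (Fin.castLE hk i) := by
      simp only [← mul_assoc, edgeProb_mul_sampledWeight hG hn hC hℓ, Finset.mul_sum]
      rw [Finset.sum_comm]
      refine Finset.sum_congr rfl fun i _ => ?_
      have := (h.comp (φ := fun _ : Unit => Fin.castLE hk i) (fun _ _ _ => rfl) fun _ => 1).2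
      simpa [energy] using this
    rw [e1]
    have : ∀ i : Fin (k + 1), ν (Fin.castLE hk i) ≤ ν ⟨k, hk⟩ := fun i => hν (by
      have := i.2
      rw [Fin.le_def, Fin.val_castLE]
      dsimp only
      omega)
    refine (Finset.sum_le_sum fun i _ => this i).trans (le_of_eq ?_)
    simp

theorem subsetProb_card_tail (hG : ∀ u, 0 < G.deg u) (hn : 1 < n) (hC : 0 < C)
    (hℓ : 0 < ℓ) :
    subsetProb G.edges (G.edgeProb C ℓ)
      (fun F => 3 * (n / sampleScale n C ℓ) ≤ (F.card : ℝ)) ≤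
      Real.exp (-(n / sampleScale n C ℓ)) := by
  have h0 : ∀ e ∈ G.edges, 0 ≤ G.edgeProb C ℓ e := fun e _ => edgeProb_nonneg hn hC hℓ e
  have h1 : ∀ e ∈ G.edges, G.edgeProb C ℓ e ≤ 1 := fun e _ => edgeProb_le_one e
  have := subsetProb_three_mul_le h0 h1 (x := fun _ => 1) (fun _ _ => zero_le_one) one_pos
    (fun _ _ => Or.inr le_rfl) (M := n / sampleScale n C ℓ)
    (by simpa using sum_edgeProb_le hG hn hC hℓ)
  simpa using this

end WGraph

/-! ### The union bound over all failure events. -/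

namespace WGraph

variable {n : ℕ} {G : WGraph n} {C ℓ : ℝ}

/-- The conclusion about the quality of the sparsifier given by the edge set `F`. -/
def IsGoodSample (G : WGraph n) (C ℓ : ℝ) (k : ℕ) (K α β γ : ℝ) (F : Finset (Sym2 (Fin n)))
    (hF : F ⊆ G.edges) : Prop :=
  (F.card : ℝ) ≤ K * (n * Real.log n ^ 3 / (2 - G.lapEig (n - k))) ∧
    α * G.rhoBar k ≤ (G.sparsifier C ℓ F hF).rhoBar k ∧
    β * G.signlessEig (k + 1) ≤ (G.sparsifier C ℓ F hF).signlessEig (k + 1) ∧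
    (G.sparsifier C ℓ F hF).signlessEig (k + 1) ≤ γ * G.signlessEig (k + 1)

theorem signlessEig_le_two (hG : ∀ u, 0 < G.deg u) {k : ℕ} (hk : k < n) :
    G.signlessEig (k + 1) ≤ 2 := by
  obtain ⟨y, h, -⟩ := exists_simDiag hG
  have h1 := h.comp (φ := fun _ : Unit => (⟨k, hk⟩ : Fin n)) (fun _ _ _ => rfl) fun _ => 1
  have h2 := G.energy_le (∑ _i : Unit, (1 : ℝ) • y ⟨k, hk⟩)
  rw [h1.1, h1.2] at h2
  simpa using h2

theorem phiBar_mul_vol (hG : ∀ u, 0 < G.deg u) {A B : Finset (Fin n)} (h : (A ∪ B).Nonempty) :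
    G.phiBar A B * G.vol (A ∪ B) = 2 * G.cut A B :=
  div_mul_cancel₀ _ (vol_pos hG h).ne'

-- Each single failure has probability at most `ε = n^{-(c+4)}`. With `1 / r = C L³ / ℓ` the
-- Chernoff exponents are `n / r` for the edge count, at least `1 / (4 r)` for degrees, at least `1
-- / (8 L r)` for cuts and `(k + 1) μ / (2 r)` for the bottom trace. The first three need only `ℓ ≤
-- 2 a`; the spectral events need `ℓ ≤ a μ`. The lower bound on `ℓ` enters in its positivity and in
-- the edge count.
set_option maxHeartbeats 1600000 in
open Matrix in
theorem one_sub_le_subsetProb_isGoodSample {k c : ℕ} {a : ℝ} (hk : 1 ≤ k) (ha : 1 ≤ a)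
    (hC : 512 * a * (c + 5) ≤ C) (hkn : k < n) (hG : ∀ u, 0 < G.deg u)
    (hρ : 1 / Real.log n ≤ G.rhoBar k) (hμ : 0 < G.signlessEig (k + 1))
    (hℓ1 : G.signlessEig (k + 1) / a ≤ ℓ) (hℓ2 : ℓ ≤ a * G.signlessEig (k + 1)) :
    1 - 1 / (n : ℝ) ^ c ≤ subsetProb G.edges (G.edgeProb C ℓ) fun F => ∃ hF : F ⊆ G.edges,
      G.IsGoodSample C ℓ k (3 * a * C) (1 / 12) (1 / 24) (12 * (k + 1)) F hF := by
  set μ := G.signlessEig (k + 1) with hμdef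
  set L := Real.log n with hL
  have ha0 : 0 < a := by linarith
  have hn : 1 < n := by omega
  have hn2 : (2 : ℝ) ≤ n := by exact_mod_cast hn
  have hlog2 : (1 / 2 : ℝ) ≤ Real.log 2 := by linarith [Real.log_two_gt_d9]
  have hL2 : 1 / 2 ≤ L := hlog2.trans (Real.log_le_log two_pos hn2)
  have hL0 : 0 < L := by linarith
  have hc0 : (0 : ℝ) ≤ c := Nat.cast_nonneg c
  have hac : 0 < a * (c + 5) := by positivity
  have hC0 : 0 < C := by nlinarith
  have hℓ : 0 < ℓ := (div_pos hμ ha0).trans_le hℓ1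
  have hμ2 : μ ≤ 2 := signlessEig_le_two hG hkn
  set r := sampleScale n C ℓ with hr
  have hr0 : 0 < r := sampleScale_pos hn hC0 hℓ
  have hrinv : ∀ t, t / r = t * (C * L ^ 3) / ℓ := fun t => by
    rw [hr, sampleScale, div_div_eq_mul_div]
  have h0 : ∀ e ∈ G.edges, 0 ≤ G.edgeProb C ℓ e := fun e _ => edgeProb_nonneg hn hC0 hℓ e
  have h1 : ∀ e ∈ G.edges, G.edgeProb C ℓ e ≤ 1 := fun e _ => edgeProb_le_one e
  have hCL : 256 * (a * (c + 5)) ≤ C * L := by nlinarith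
  have hCL2 : 128 * (a * (c + 5)) ≤ C * L ^ 2 := by nlinarith
  have hCL3 : 128 * (a * (c + 5)) * L ≤ C * L ^ 3 := by nlinarith
  have hℓ4 : ℓ ≤ 2 * a := by nlinarith
  set ε := Real.exp (-((c + 4) * L)) with hε
  have hε0 : 0 < ε := Real.exp_pos _
  have hexp : ∀ {X : ℝ}, (c + 4) * L ≤ X → Real.exp (-X) ≤ ε := fun h =>
    Real.exp_le_exp.2 (by linarith)
  obtain ⟨y, hy, hmono⟩ := exists_simDiag hG
  obtain ⟨A, B, hAB, hABρ⟩ := exists_isPairFamily_of_rhoBar_pos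
    (lt_of_lt_of_le (by positivity) hρ : 0 < G.rhoBar k)
  have inj : ∀ i, Set.InjOn (fun x : Fin n × Fin n => s(x.1, x.2)) ↑(A i ×ˢ B i) := fun i =>
    injOn_mk_of_disjoint (hAB.1 i)
  have hv : ∀ i, 0 < G.vol (A i ∪ B i) := fun i => vol_pos hG (hAB.2.1 i)
  -- tails
  have P1 : subsetProb G.edges (G.edgeProb C ℓ) (fun F => 3 * (n / r) ≤ (F.card : ℝ)) ≤ ε := by
    refine (subsetProb_card_tail hG hn hC0 hℓ).trans (hexp ?_)
    rw [hrinv, le_div_iff₀ hℓ]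
    have e1 : (c + 4) * L * ℓ ≤ (c + 4) * L * (2 * a) := by gcongr
    have e2 : 2 * (C * L ^ 3) ≤ n * (C * L ^ 3) := by gcongr
    nlinarith
  have hdegexp : ∀ u : Fin n, (c + 4) * L ≤ G.deg u / (4 * (r * G.deg u)) := fun u => by
    have e0 : G.deg u / (4 * (r * G.deg u)) = (1 / 4) / r := by
      have := (hG u).ne'
      field_simp
    rw [e0, hrinv, le_div_iff₀ hℓ]
    have e1 : (c + 4) * L * ℓ ≤ (c + 4) * L * (2 * a) := by gcongr
    nlinarith
  have P2 : subsetProb G.edges (G.edgeProb C ℓ)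
      (fun F => ∃ u, 3 * G.deg u ≤ G.sampledCut C ℓ {u} Finset.univ F) ≤ n * ε := by
    have := subsetProb_exists_le h0 h1 (b := ε)
      (fun u F => 3 * G.deg u ≤ G.sampledCut C ℓ {u} Finset.univ F) fun u => by
        have t := (sampledCut_tail hG hn hC0 hℓ (injOn_mk_singleton u) (hG u)
          (fun v hv => by rw [Finset.mem_singleton.1 hv])).1
        rw [cut_singleton_univ] at t
        refine t.trans (hexp ((hdegexp u).trans ?_))
        have := mul_pos hr0 (hG u)
        exact div_le_div_of_nonneg_left (hG u).le this (by linarith)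
    simpa using this
  have P3 : subsetProb G.edges (G.edgeProb C ℓ)
      (fun F => ∃ u, G.sampledCut C ℓ {u} Finset.univ F ≤ G.deg u / 4) ≤ n * ε := by
    have := subsetProb_exists_le h0 h1 (b := ε)
      (fun u F => G.sampledCut C ℓ {u} Finset.univ F ≤ G.deg u / 4) fun u => by
        have t := (sampledCut_tail hG hn hC0 hℓ (injOn_mk_singleton u) (hG u)
          (fun v hv => by rw [Finset.mem_singleton.1 hv])).2
        rw [cut_singleton_univ] at t
        exact t.trans (hexp (hdegexp u))
    simpa using this
  have P4 : subsetProb G.edges (G.edgeProb C ℓ)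
      (fun F => ∃ i, G.sampledCut C ℓ (A i) (B i) F ≤ G.cut (A i) (B i) / 4) ≤ k * ε := by
    have := subsetProb_exists_le h0 h1 (b := ε)
      (fun i F => G.sampledCut C ℓ (A i) (B i) F ≤ G.cut (A i) (B i) / 4) fun i => by
        have t := (sampledCut_tail hG hn hC0 hℓ (inj i) (hv i) (fun u hu =>
          Finset.single_le_sum (f := G.deg) (fun v _ => G.deg_nonneg v)
            (Finset.mem_union_left _ hu))).2
        refine t.trans (hexp ?_)
        have hvi := hv i
        -- The assumption on the dual Cheeger constant makes the mean of the cut comparable to the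
        -- volume up to `2 L`.
        have hcut : 1 / L * G.vol (A i ∪ B i) ≤ 2 * G.cut (A i) (B i) := by
          rw [← phiBar_mul_vol hG (hAB.2.1 i)]
          exact mul_le_mul_of_nonneg_right (hρ.trans (hABρ i)) hvi.le
        have e0 : 1 / (8 * L) / r ≤ G.cut (A i) (B i) / (4 * (r * G.vol (A i ∪ B i))) := by
          rw [div_div, div_le_div_iff₀ (by positivity) (by positivity)]
          rw [one_div_mul_eq_div, div_le_iff₀ hL0] at hcut
          nlinarith
        refine le_trans ?_ e0
        rw [hrinv, le_div_iff₀ hℓ]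
        have e1 : (c + 4) * L * ℓ ≤ (c + 4) * L * (2 * a) := by gcongr
        have e2 : 1 / (8 * L) * (C * L ^ 3) = C * L * L / 8 := by field_simp
        rw [e2]
        nlinarith
    simpa using this
  have P5 := subsetProb_bottom_tail hG hn hC0 hℓ hkn hy hmono
  dsimp only at P5
  rw [← hμdef, ← hr] at P5
  have P5' := P5.trans (hexp (by
    rw [mul_comm 2 r, ← div_div, hrinv, div_div, le_div_iff₀ (by positivity)]
    have e1 : (c + 4) * L * (ℓ * 2) ≤ (c + 4) * L * (a * μ * 2) := by gcongr
    have e2 : 128 * (a * (c + 5)) * L * μ ≤ C * L ^ 3 * μ :=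
      mul_le_mul_of_nonneg_right hCL3 hμ.le
    have e3 : 1 * (C * L ^ 3 * μ) ≤ (k + 1) * (C * L ^ 3 * μ) :=
      mul_le_mul_of_nonneg_right (by linarith [(Nat.cast_nonneg k : (0 : ℝ) ≤ k)])
        (by positivity)
    have e4 : 0 ≤ a * L * μ := by positivity
    nlinarith))
  have P6 : subsetProb G.edges (G.edgeProb C ℓ) (fun F => ∃ z,
      ∑ e ∈ F, (G.edgeVector C ℓ k y (fun i => G.signlessEig (i + 1)) e ⬝ᵥ z) ^ 2 <
        (z ⬝ᵥ z) / 8) ≤ n * ε := by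
    -- As `log 2 ≥ 1/2`, this makes `(1/2)^q ≤ ε`; and `q + 1 = O(L)` is small enough for the
    -- smallness condition on `r / μ`.
    set q := ⌈2 * (c + 4) * L⌉₊ with hq
    have hq1 : 2 * (c + 4) * L ≤ q := Nat.le_ceil _
    have hq2 : (q : ℝ) < 2 * (c + 4) * L + 1 := Nat.ceil_lt_add_one (by positivity)
    refine (subsetProb_top_tail hG hn hC0 hℓ hkn hy hmono hμ (q := q) ?_).trans ?_
    · dsimp only
      rw [← hμdef, ← hr]
      have e1 : r / μ ≤ a / (C * L ^ 3) := by
        rw [hr, sampleScale, div_div, div_le_div_iff₀ (by positivity) (by positivity)]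
        have : 0 ≤ C * L ^ 3 := by positivity
        nlinarith
      have e2 : ((q : ℝ) + 1) * (8 * (2 * r / μ)) = 16 * (q + 1) * (r / μ) := by ring
      rw [e2]
      refine (mul_le_mul_of_nonneg_left e1 (by positivity)).trans ?_
      rw [← mul_div_assoc, div_le_iff₀ (by positivity)]
      have e3 : (q : ℝ) + 1 ≤ 4 * (c + 5) * L := by nlinarith
      have e4 : 16 * ((q : ℝ) + 1) * a ≤ 16 * (4 * (c + 5) * L) * a := by gcongr
      have e5 : 1 / 2 * (C * L ^ 3) ≤ Real.log 2 * (C * L ^ 3) := by gcongr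
      nlinarith
    · refine mul_le_mul_of_nonneg_left ?_ (by positivity)
      have e1 : (1 / 2 : ℝ) ^ q = Real.exp (-(q * Real.log 2)) := by
        rw [← mul_neg, Real.exp_nat_mul, Real.exp_neg, Real.exp_log two_pos]
        norm_num
      rw [e1]
      refine hexp ?_
      have : 2 * (c + 4) * L * (1 / 2) ≤ q * Real.log 2 := by gcongr
      linarith
  -- union bound
  set bad : Finset (Sym2 (Fin n)) → Prop := fun F => (3 * (n / r) ≤ (F.card : ℝ)) ∨
    ((∃ u, 3 * G.deg u ≤ G.sampledCut C ℓ {u} Finset.univ F) ∨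
    ((∃ u, G.sampledCut C ℓ {u} Finset.univ F ≤ G.deg u / 4) ∨
    ((∃ i, G.sampledCut C ℓ (A i) (B i) F ≤ G.cut (A i) (B i) / 4) ∨
    ((3 * ((k + 1) * μ) ≤ ∑ e ∈ F, G.sampledWeight C ℓ e *
        ∑ i : Fin (k + 1), pairSum (y (Fin.castLE hkn i)) e ^ 2) ∨
    ∃ z, ∑ e ∈ F, (G.edgeVector C ℓ k y (fun i => G.signlessEig (i + 1)) e ⬝ᵥ z) ^ 2 <
        (z ⬝ᵥ z) / 8)))) with hbad
  have hbadP : subsetProb G.edges (G.edgeProb C ℓ) bad ≤ 1 / (n : ℝ) ^ c := by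
    have u1 := subsetProb_or_le h0 h1 _ _ |>.trans (add_le_add P5' P6)
    have u2 := subsetProb_or_le h0 h1 _ _ |>.trans (add_le_add P4 u1)
    have u3 := subsetProb_or_le h0 h1 _ _ |>.trans (add_le_add P3 u2)
    have u4 := subsetProb_or_le h0 h1 _ _ |>.trans (add_le_add P2 u3)
    have u5 := subsetProb_or_le h0 h1 _ _ |>.trans (add_le_add P1 u4)
    refine u5.trans ?_
    have hkn' : (k : ℝ) ≤ n := by exact_mod_cast hkn.le
    have hn0 : (0 : ℝ) < n := by linarith
    have e1 : ε = 1 / (n : ℝ) ^ (c + 4) := by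
      have : ((c : ℝ) + 4) = ((c + 4 : ℕ) : ℝ) := by push_cast; ring
      rw [hε, Real.exp_neg, this, Real.exp_nat_mul, Real.exp_log hn0, one_div]
    have e2 : ε * n ^ 4 = 1 / (n : ℝ) ^ c := by
      rw [e1, pow_add]
      field_simp
    rw [← e2]
    have e3 : ε + (n * ε + (n * ε + (k * ε + (ε + n * ε)))) = ε * (2 + 3 * n + k) := by ring
    rw [e3]
    refine mul_le_mul_of_nonneg_left ?_ hε0.le
    have e4 : (4 : ℝ) ≤ n ^ 2 := by nlinarith
    have e5 : (4 : ℝ) * n ^ 2 ≤ n ^ 2 * n ^ 2 := by gcongr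
    have e6 : (n : ℝ) ^ 4 = n ^ 2 * n ^ 2 := by ring
    nlinarith
  have hgood := subsetProb_not G.edges (G.edgeProb C ℓ) bad
  have : 1 - 1 / (n : ℝ) ^ c ≤ subsetProb G.edges (G.edgeProb C ℓ) fun F => ¬ bad F := by
    rw [hgood]; linarith
  refine this.trans (subsetProb_mono h0 h1 fun F hF hnb => ⟨hF, ?_⟩)
  simp only [hbad, not_or, not_exists, not_le, not_lt] at hnb
  obtain ⟨g1, g2, g3, g4, g5, g6⟩ := hnb
  have hlow : ∀ u, G.deg u / 4 ≤ (G.sparsifier C ℓ F hF).deg u := fun u => by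
    rw [sparsifier_deg hn hC0 hℓ]; exact (g3 u).le
  have hup : ∀ u, (G.sparsifier C ℓ F hF).deg u ≤ 3 * G.deg u := fun u => by
    rw [sparsifier_deg hn hC0 hℓ]; exact (g2 u).le
  refine ⟨?_, ?_, ?_, ?_⟩
  · have e0 : 2 - G.lapEig (n - k) = μ := by rw [G.lapEig_eq hkn]; ring
    rw [e0]
    refine g1.le.trans ?_
    rw [hrinv, ← mul_div_assoc, ← mul_div_assoc, div_le_div_iff₀ hℓ hμ]
    rw [div_le_iff₀ ha0] at hℓ1
    have : 0 ≤ 3 * (n * (C * L ^ 3)) := by positivity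
    nlinarith
  · refine le_rhoBar hk hAB fun i => ?_
    refine le_trans ?_ (phiBar_ge_of_comparison hG (hAB.2.1 i) hlow hup ?_)
    · linarith [hABρ i]
    · rw [sparsifier_cut hn hC0 hℓ hF (inj i)]
      exact (g4 i).le
  · have := le_signlessEig_sparsifier hG hn hC0 hℓ hkn hF hy hmono hμ hlow hup g6
    linarith
  · have := signlessEig_sparsifier_le hG hn hC0 hℓ hkn hF hy hlow (by positivity) g5.le
    linarith

end WGraph

/-! ## Couplings -/

section Coupling

/-- `ν` and `μ` have a coupling supported in the relation `R`. -/
def Coupled {α β : Type*} (ν : PMF α) (μ : PMF β) (R : α → β → Prop) : Prop :=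
  ∃ κ : PMF (α × β), κ.map Prod.fst = ν ∧ κ.map Prod.snd = μ ∧ ∀ z ∈ κ.support, R z.1 z.2

variable {α β γ δ : Type*}

theorem Coupled.pure {a : α} {b : β} {R : α → β → Prop} (h : R a b) :
    Coupled (PMF.pure a) (PMF.pure b) R :=
  ⟨PMF.pure (a, b), by simp [PMF.pure_map], by simp [PMF.pure_map], by simpa using h⟩

theorem Coupled.refl (ν : PMF α) : Coupled ν ν Eq := by
  refine ⟨ν.map fun a => (a, a), ?_, ?_, fun z hz => ?_⟩
  · rw [PMF.map_comp]; exact PMF.map_id ν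
  · rw [PMF.map_comp]; exact PMF.map_id ν
  · obtain ⟨a, -, rfl⟩ := (PMF.mem_support_map_iff _ _ _).1 hz
    rfl

theorem Coupled.bind {ν : PMF α} {μ : PMF β} {R : α → β → Prop} (h : Coupled ν μ R)
    {f : α → PMF γ} {g : β → PMF δ} {S : γ → δ → Prop}
    (hfg : ∀ a b, R a b → Coupled (f a) (g b) S) : Coupled (ν.bind f) (μ.bind g) S := by
  obtain ⟨κ, h1, h2, h3⟩ := h
  have key : ∀ z : α × β, ∃ K : PMF (γ × δ), K.map Prod.fst = f z.1 ∧ K.map Prod.snd = g z.2 ∧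
      (R z.1 z.2 → ∀ w ∈ K.support, S w.1 w.2) := by
    intro z
    by_cases hz : R z.1 z.2
    · obtain ⟨K, k1, k2, k3⟩ := hfg _ _ hz
      exact ⟨K, k1, k2, fun _ => k3⟩
    -- Pairs outside `R` are never drawn, but `κ.bind` needs a kernel defined everywhere; the
    -- independent coupling serves there.
    · refine ⟨(f z.1).bind fun c => (g z.2).map fun d => (c, d), ?_, ?_, fun h => absurd h hz⟩
      · rw [PMF.map_bind]
        simp only [PMF.map_comp]
        conv_rhs => rw [← PMF.bind_pure (f z.1)]
        congr 1
        funext c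
        exact PMF.map_const _ _
      · rw [PMF.map_bind]
        simp only [PMF.map_comp]
        conv_rhs => rw [← PMF.bind_const (f z.1) (g z.2)]
        congr 1
        funext c
        exact PMF.map_id _
  choose K k1 k2 k3 using key
  refine ⟨κ.bind K, ?_, ?_, fun w hw => ?_⟩
  · rw [PMF.map_bind, ← h1, PMF.bind_map]
    simp only [k1, Function.comp_def]
  · rw [PMF.map_bind, ← h2, PMF.bind_map]
    simp only [k2, Function.comp_def]
  · obtain ⟨z, hz, hw⟩ := (PMF.mem_support_bind_iff _ _ _).1 hw
    exact k3 z (h3 z hz) w hw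

theorem Coupled.map {ν : PMF α} {μ : PMF β} {R : α → β → Prop} (h : Coupled ν μ R)
    {f : α → γ} {g : β → δ} {S : γ → δ → Prop} (hfg : ∀ a b, R a b → S (f a) (g b)) :
    Coupled (ν.map f) (μ.map g) S := by
  rw [← PMF.bind_pure_comp, ← PMF.bind_pure_comp]
  exact h.bind fun a b hab => Coupled.pure (hfg a b hab)

theorem Coupled.toOuterMeasure_le {ν : PMF α} {μ : PMF β} {R : α → β → Prop} (h : Coupled ν μ R)
    {A : Set α} {B : Set β} (hAB : ∀ a b, R a b → a ∈ A → b ∈ B) :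
    ν.toOuterMeasure A ≤ μ.toOuterMeasure B := by
  obtain ⟨κ, rfl, rfl, h3⟩ := h
  rw [PMF.toOuterMeasure_map_apply, PMF.toOuterMeasure_map_apply]
  exact κ.toOuterMeasure_mono fun z hz => hAB _ _ (h3 z hz.2) hz.1

theorem Coupled.toOuterMeasure_eq {ν : PMF α} {μ : PMF β} {R : α → β → Prop} (h : Coupled ν μ R)
    {A : Set α} {B : Set β} (hAB : ∀ a b, R a b → (a ∈ A ↔ b ∈ B)) :
    ν.toOuterMeasure A = μ.toOuterMeasure B := by
  refine le_antisymm (h.toOuterMeasure_le fun a b hab => (hAB a b hab).1) ?_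
  obtain ⟨κ, rfl, rfl, h3⟩ := h
  rw [PMF.toOuterMeasure_map_apply, PMF.toOuterMeasure_map_apply]
  exact κ.toOuterMeasure_mono fun z hz => (hAB _ _ (h3 z hz.2)).2 hz.1

theorem Coupled.exists_of_mem_support {ν : PMF α} {μ : PMF β} {R : α → β → Prop}
    (h : Coupled ν μ R) {b : β} (hb : b ∈ μ.support) : ∃ a, R a b := by
  obtain ⟨κ, rfl, rfl, h3⟩ := h
  obtain ⟨z, hz, rfl⟩ := (PMF.mem_support_map_iff _ _ _).1 hb
  exact ⟨z.1, h3 z hz⟩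

end Coupling

/-! ## The law of the random subset -/

section RandomSubsetLaw

variable {α : Type*} [DecidableEq α]

theorem coin_true {x : ℝ} (h1 : x ≤ 1) : coin x true = ENNReal.ofReal x := by
  simpa [coin, PMF.ofFintype_apply] using h1

theorem coin_false {x : ℝ} (h0 : 0 ≤ x) (h1 : x ≤ 1) :
    coin x false = ENNReal.ofReal (1 - x) := by
  have h : ENNReal.ofReal x ≤ 1 := by simpa using h1
  simp [coin, PMF.ofFintype_apply, min_eq_right h, ENNReal.ofReal_sub _ h0]

/-- The random subset of `{ed i, …, ed (i + r - 1)}` that keeps each element `a` independently with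
probability `p a`. -/
noncomputable def randomSubset (p : α → ℝ) (ed : ℕ → α) : ℕ → ℕ → PMF (Finset α)
  | _, 0 => PMF.pure ∅
  | i, r + 1 => (coin (p (ed i))).bind fun b =>
      (randomSubset p ed (i + 1) r).map fun F => if b then insert (ed i) F else F

/-- Condition on the first coin. Injectivity of `ed` ensures that its element does not occur again
later in the list. -/
theorem randomSubset_toOuterMeasure {p : α → ℝ} (h0 : ∀ a, 0 ≤ p a) (h1 : ∀ a, p a ≤ 1)
    {ed : ℕ → α} (r i : ℕ) (hed : Set.InjOn ed (Finset.Ico i (i + r))) (A : Set (Finset α)) :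
    (randomSubset p ed i r).toOuterMeasure A =
      ENNReal.ofReal (subsetProb ((Finset.Ico i (i + r)).image ed) p (· ∈ A)) := by
  classical
  induction r generalizing i A with
  | zero =>
    rw [randomSubset, PMF.toOuterMeasure_pure_apply]
    by_cases h : (∅ : Finset α) ∈ A <;> simp [subsetProb, subsetExp, subsetWeight, h]
  | succ r ih =>
    have hIco : Finset.Ico i (i + (r + 1)) = insert i (Finset.Ico (i + 1) (i + 1 + r)) := by
      ext j; simp only [Finset.mem_Ico, Finset.mem_insert]; omega
    have hed' : Set.InjOn ed (Finset.Ico (i + 1) (i + 1 + r)) := hed.mono (by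
      rw [hIco]; simp)
    have hnot : ed i ∉ (Finset.Ico (i + 1) (i + 1 + r)).image ed := by
      intro h
      obtain ⟨j, hj, hij⟩ := Finset.mem_image.1 h
      have := hed (by rw [hIco]; simp [Finset.mem_Ico.1 hj]) (by rw [hIco]; simp) hij
      have := (Finset.mem_Ico.1 hj).1
      omega
    rw [randomSubset, PMF.toOuterMeasure_bind_apply, tsum_bool, coin_true (h1 _),
      coin_false (h0 _) (h1 _), PMF.toOuterMeasure_map_apply, PMF.toOuterMeasure_map_apply,
      ih _ hed', ih _ hed', hIco, Finset.image_insert]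
    have e := subsetExp_insert hnot p fun F => if F ∈ A then (1 : ℝ) else 0
    have n0 : ∀ S : Finset α → Prop, 0 ≤ subsetProb ((Finset.Ico (i + 1) (i + 1 + r)).image ed) p S :=
      fun S => subsetProb_nonneg (fun e _ => h0 e) (fun e _ => h1 e) S
    rw [← ENNReal.ofReal_mul (sub_nonneg.2 (h1 _)), ← ENNReal.ofReal_mul (h0 _),
      ← ENNReal.ofReal_add (mul_nonneg (sub_nonneg.2 (h1 _)) (n0 _)) (mul_nonneg (h0 _) (n0 _))]
    congr 1
    simp only [subsetProb, Set.mem_preimage, if_true, Bool.false_eq_true, if_false]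
    convert e.symm using 1

theorem subsetProb_mem_singleton {s : Finset α} (p : α → ℝ) {F : Finset α} (hF : F ⊆ s) :
    subsetProb s p (· ∈ ({F} : Set (Finset α))) = subsetWeight s p F := by
  rw [subsetProb, subsetExp, Finset.sum_eq_single F]
  · simp
  · intro F' _ h
    simp [h]
  · exact fun h => absurd (Finset.mem_powerset.2 hF) h

end RandomSubsetLaw

/-! ## Straight-line code -/

/-- A straight-line program. -/
def Prog.ops : List Op → Prog
  | [] => .skip
  | o :: l => .seq (.op o) (Prog.ops l)

theorem Prog.exec_seq_of_pure {P Q : Prog} {s s₁ s₂ : Mem} {t₁ t₂ : ℕ}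
    (hP : P.exec s = PMF.pure (s₁, t₁)) (hQ : Q.exec s₁ = PMF.pure (s₂, t₂)) :
    (Prog.seq P Q).exec s = PMF.pure (s₂, t₁ + t₂) := by
  rw [Prog.exec, hP, PMF.pure_bind, hQ, PMF.pure_map]

theorem Prog.exec_ops (l : List Op) (s : Mem) :
    (Prog.ops l).exec s = PMF.pure (l.foldl (fun s o => o.run s) s, l.length + 1) := by
  induction l generalizing s with
  | nil => rfl
  | cons o l ih =>
    rw [Prog.ops, Prog.exec_seq_of_pure (P := .op o) (s₁ := o.run s) (t₁ := 1) rfl (ih _)]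
    simp [add_comm, add_left_comm]

/-- `rreg i := min (rreg i) 1`, if `rreg 6` holds `1`. -/
def Prog.clamp (i : ℕ) : Prog := .ifReal i 6 .skip (.op (.rconst i 1))

theorem Prog.exec_clamp (i : ℕ) {s : Mem} (h : s.rreg 6 = 1) : (Prog.clamp i).exec s =
    PMF.pure ({ s with rreg := Function.update s.rreg i (min (s.rreg i) 1) }, 2) := by
  rw [Prog.clamp, Prog.exec, h]
  split_ifs with h1
  · rw [Prog.exec, PMF.pure_map, min_eq_left h1, Function.update_eq_self]
  · rw [Prog.exec, PMF.pure_map, min_eq_right (not_le.1 h1).le, Op.run]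

/-! ## The sampling program -/

/-- Add the weight of the current edge to the degrees of its ends and advance. -/
def degreeBody : List Op :=
  [.nload 5 0 3, .nload 6 1 3, .rload 1 0 3, .rload 2 2 5, .radd 2 2 1, .rstore 2 5 2,
    .rload 2 2 6, .radd 2 2 1, .rstore 2 6 2, .nadd 3 3 4]

/-- Compute `C log³ n`. -/
noncomputable def scaleCode (C : ℝ) : List Op :=
  [.rcast 3 0, .rlog 3 3, .rmul 4 3 3, .rmul 4 4 3, .rconst 5 C, .rmul 4 5 4, .rconst 6 1,
    .nconst 3 0]

/-- Compute the probability of the current edge and advance. -/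
def probCode : Prog :=
  .seq (.ops [.nload 5 0 3, .nload 6 1 3, .rload 1 0 3, .rload 2 2 5, .rmul 2 2 0, .rdiv 2 4 2,
      .rmul 2 1 2]) <|
  .seq (.clamp 2) <|
  .seq (.ops [.rload 7 2 6, .rmul 7 7 0, .rdiv 7 4 7, .rmul 7 1 7]) <|
  .seq (.clamp 7) <|
  .ops [.rmul 8 2 7, .radd 9 2 7, .rsub 9 9 8, .nadd 3 3 4]

/-- Append the current edge to the output. -/
def appendCode : List Op :=
  [.nstore 2 2 5, .nstore 3 2 6, .rdiv 10 1 9, .rstore 1 2 10, .nadd 2 2 4]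

/-- Treat the current edge. -/
def sampleBody : Prog :=
  .seq probCode (.seq (.flip 7 9) (.ifNat 4 7 (.ops appendCode) .skip))

/-- The sampling program. -/
noncomputable def sampleProg (C : ℝ) : Prog :=
  .seq (.op (.nconst 4 1)) <|
  .seq (.loop 1 (.ops degreeBody)) <|
  .seq (.ops (scaleCode C)) (.loop 1 sampleBody)

/-- Register layout: `nreg 3` is the position in the list, `nreg 4` holds 1, `rreg 0` holds `ℓ`,
`rreg 4` holds `C log³ n`, `rarr 2` holds the degrees, and `rreg 9` receives the edge probability.
-/
theorem exec_probCode {s : Mem} (h6 : s.rreg 6 = 1) :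
    ∃ s', probCode.exec s = PMF.pure (s', 22) ∧ s'.narr = s.narr ∧ s'.rarr = s.rarr ∧
      s'.nreg 2 = s.nreg 2 ∧ s'.nreg 3 = s.nreg 3 + s.nreg 4 ∧ s'.nreg 4 = s.nreg 4 ∧
      s'.nreg 5 = s.narr 0 (s.nreg 3) ∧ s'.nreg 6 = s.narr 1 (s.nreg 3) ∧
      s'.rreg 0 = s.rreg 0 ∧ s'.rreg 4 = s.rreg 4 ∧ s'.rreg 6 = 1 ∧
      s'.rreg 1 = s.rarr 0 (s.nreg 3) ∧
      s'.rreg 9 =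
        min (s.rarr 0 (s.nreg 3) * (s.rreg 4 / (s.rarr 2 (s.narr 0 (s.nreg 3)) * s.rreg 0))) 1 +
        min (s.rarr 0 (s.nreg 3) * (s.rreg 4 / (s.rarr 2 (s.narr 1 (s.nreg 3)) * s.rreg 0))) 1 -
        min (s.rarr 0 (s.nreg 3) * (s.rreg 4 / (s.rarr 2 (s.narr 0 (s.nreg 3)) * s.rreg 0))) 1 *
        min (s.rarr 0 (s.nreg 3) * (s.rreg 4 / (s.rarr 2 (s.narr 1 (s.nreg 3)) * s.rreg 0))) 1 := by
  refine ⟨_, Prog.exec_seq_of_pure (Prog.exec_ops _ _) (Prog.exec_seq_of_pure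
    (Prog.exec_clamp 2 (by simpa [Op.run, Function.update_apply] using h6))
    (Prog.exec_seq_of_pure (Prog.exec_ops _ _) (Prog.exec_seq_of_pure
    (Prog.exec_clamp 7 (by simpa [Op.run, Function.update_apply] using h6))
    (Prog.exec_ops _ _)))), ?_⟩
  simp [Op.run, h6]

theorem exec_sampleBody {s : Mem} (h6 : s.rreg 6 = 1) (h4 : s.nreg 4 = 1) :
    ∃ (s' : Bool → Mem) (t : Bool → ℕ) (q : ℝ),
      sampleBody.exec s = (coin q).map (fun b => (s' b, t b)) ∧
      q =
        min (s.rarr 0 (s.nreg 3) * (s.rreg 4 / (s.rarr 2 (s.narr 0 (s.nreg 3)) * s.rreg 0))) 1 +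
        min (s.rarr 0 (s.nreg 3) * (s.rreg 4 / (s.rarr 2 (s.narr 1 (s.nreg 3)) * s.rreg 0))) 1 -
        min (s.rarr 0 (s.nreg 3) * (s.rreg 4 / (s.rarr 2 (s.narr 0 (s.nreg 3)) * s.rreg 0))) 1 *
        min (s.rarr 0 (s.nreg 3) * (s.rreg 4 / (s.rarr 2 (s.narr 1 (s.nreg 3)) * s.rreg 0))) 1 ∧
      ∀ b, t b ≤ 30 ∧ (s' b).nreg 3 = s.nreg 3 + 1 ∧ (s' b).nreg 4 = 1 ∧
        (s' b).rreg 0 = s.rreg 0 ∧ (s' b).rreg 4 = s.rreg 4 ∧ (s' b).rreg 6 = 1 ∧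
        (s' b).narr 0 = s.narr 0 ∧ (s' b).narr 1 = s.narr 1 ∧ (s' b).rarr 0 = s.rarr 0 ∧
        (s' b).rarr 2 = s.rarr 2 ∧
        (s' b).nreg 2 = s.nreg 2 + (if b then 1 else 0) ∧
        (s' b).narr 2 = (if b then Function.update (s.narr 2) (s.nreg 2) (s.narr 0 (s.nreg 3))
          else s.narr 2) ∧
        (s' b).narr 3 = (if b then Function.update (s.narr 3) (s.nreg 2) (s.narr 1 (s.nreg 3))
          else s.narr 3) ∧
        (s' b).rarr 1 = (if b then Function.update (s.rarr 1) (s.nreg 2)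
          (s.rarr 0 (s.nreg 3) / q) else s.rarr 1) := by
  obtain ⟨s₁, hex, a1, a2, a3, a4, a5, a6, a7, a8, a9, a10, a11, a12⟩ := exec_probCode h6
  let s₂ : Bool → Mem := fun b =>
    { s₁ with nreg := Function.update s₁.nreg 7 (if b then 1 else 0) }
  refine ⟨fun b => if b then appendCode.foldl (fun s o => o.run s) (s₂ b) else s₂ b,
    fun b => if b then 30 else 25, s₁.rreg 9, ?_, a12, fun b => ?_⟩
  · rw [sampleBody, Prog.exec, hex, PMF.pure_bind, Prog.exec, Prog.exec, PMF.bind_map,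
      PMF.map_bind, ← PMF.bind_pure_comp]
    congr 1
    funext b
    have e : (Prog.ifNat 4 7 (.ops appendCode) .skip).exec (s₂ b) =
        PMF.pure (if b then appendCode.foldl (fun s o => o.run s) (s₂ b) else s₂ b,
          if b then 7 else 2) := by
      rw [Prog.exec]
      cases b
      · rw [if_neg (by simp [s₂, a5, h4]), Prog.exec, PMF.pure_map]; rfl
      · rw [if_pos (by simp [s₂, a5, h4]), Prog.exec_ops, PMF.pure_map]; rfl
    simp only [Function.comp_apply]
    change (((Prog.ifNat 4 7 (.ops appendCode) .skip).exec (s₂ b)).map _).map _ = _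
    rw [e, PMF.pure_map, PMF.pure_map]
    cases b <;> rfl
  · cases b
    · simp [s₂, *]
    · simp [s₂, appendCode, Op.run, *]

/-! ## The edge list of a graph -/

namespace WGraph

variable {n m : ℕ} {G : WGraph n} {src dst : ℕ → ℕ} {wts : ℕ → ℝ}

theorem StoredIn.mem_edges_iff (h : G.StoredIn m src dst wts) (e : Sym2 (Fin n)) :
    e ∈ G.edges ↔ ∃ i < m, ∃ u v : Fin n, e = s(u, v) ∧ src i = u ∧ dst i = v := by
  obtain ⟨f, hf⟩ := h
  constructor
  · intro he
    obtain ⟨u, v, h1, h2, h3, -⟩ := hf (f.symm ⟨e, he⟩)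
    rw [Equiv.apply_symm_apply] at h1
    exact ⟨_, (f.symm ⟨e, he⟩).2, u, v, h1, h2, h3⟩
  · rintro ⟨i, hi, u, v, rfl, h2, h3⟩
    obtain ⟨u', v', h1, h2', h3', -⟩ := hf ⟨i, hi⟩
    have hu : u' = u := Fin.ext (h2'.symm.trans h2)
    have hv : v' = v := Fin.ext (h3'.symm.trans h3)
    rw [← hu, ← hv, ← h1]
    exact (f ⟨i, hi⟩).2

theorem StoredIn.exists_enumeration (h : G.StoredIn m src dst wts) (hm : 0 < m) :
    ∃ ed : ℕ → Sym2 (Fin n), Set.InjOn ed (Finset.Ico 0 (0 + m)) ∧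
      (Finset.Ico 0 (0 + m)).image ed = G.edges ∧
      ∀ i < m, ∃ u v : Fin n, ed i = s(u, v) ∧ src i = u ∧ dst i = v ∧
        wts i = G.weight (ed i) := by
  obtain ⟨f, hf⟩ := h
  -- The value beyond the list is arbitrary but must be an element, which is where `0 < m` enters.
  let ed : ℕ → Sym2 (Fin n) := fun i => if hi : i < m then f ⟨i, hi⟩ else f ⟨0, hm⟩
  have hed : ∀ i (hi : i < m), ed i = f ⟨i, hi⟩ := fun i hi => dif_pos hi
  refine ⟨ed, fun i hi j hj hij => ?_, ?_, fun i hi => ?_⟩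
  · have hi' : i < m := by simpa using hi
    have hj' : j < m := by simpa using hj
    rw [hed i hi', hed j hj'] at hij
    exact congrArg Fin.val (f.injective (Subtype.ext hij))
  · ext e
    simp only [Finset.mem_image, Finset.mem_Ico, zero_le, zero_add, true_and]
    constructor
    · rintro ⟨i, hi, rfl⟩
      rw [hed i hi]
      exact (f _).2
    · intro he
      refine ⟨f.symm ⟨e, he⟩, (f.symm ⟨e, he⟩).2, ?_⟩
      rw [hed _ (f.symm ⟨e, he⟩).2]
      simp
  · rw [hed i hi]
    exact hf ⟨i, hi⟩

theorem deg_eq_sum_edges (G : WGraph n) (u : Fin n) :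
    G.deg u = ∑ e ∈ G.edges, if u ∈ e then (G.weight e : ℝ) else 0 := by
  classical
  rw [← cut_singleton_univ, cut_eq_sum_edges _ (injOn_mk_singleton u)]
  refine Finset.sum_congr rfl fun e _ => ?_
  congr 1
  simp only [Finset.mem_image, Finset.mem_product, Finset.mem_singleton, Finset.mem_univ, and_true,
    Prod.exists, eq_iff_iff, Sym2.mem_iff_exists]
  constructor
  · rintro ⟨a, b, rfl, rfl⟩
    exact ⟨b, rfl⟩
  · rintro ⟨b, rfl⟩
    exact ⟨u, b, rfl, rfl⟩

/-- The part of the degree of `x` that is due to the first `i` edges in the list. -/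
def partialDegree (src dst : ℕ → ℕ) (wts : ℕ → ℝ) (i x : ℕ) : ℝ :=
  ∑ j ∈ Finset.range i, ((if x = src j then wts j else 0) + if x = dst j then wts j else 0)

theorem partialDegree_eq {ed : ℕ → Sym2 (Fin n)} (h1 : Set.InjOn ed (Finset.Ico 0 (0 + m)))
    (h2 : (Finset.Ico 0 (0 + m)).image ed = G.edges)
    (h3 : ∀ i < m, ∃ u v : Fin n, ed i = s(u, v) ∧ src i = u ∧ dst i = v ∧
      wts i = G.weight (ed i)) (x : Fin n) : partialDegree src dst wts m x = G.deg x := by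
  have hmem : ∀ i < m, ed i ∈ G.edges := fun i hi => by
    rw [← h2]
    exact Finset.mem_image_of_mem _ (by simpa using hi)
  rw [deg_eq_sum_edges, ← h2, Finset.sum_image h1, partialDegree, zero_add,
    Finset.range_eq_Ico]
  refine Finset.sum_congr rfl fun i hi => ?_
  have hi' : i < m := by simpa using hi
  obtain ⟨u, v, e1, e2, e3, e4⟩ := h3 i hi'
  -- Without loops at most one of the two indicators in `partialDegree` is nonzero, and together
  -- they say that `x` lies on the edge.
  have huv : u ≠ v := fun h => G.loopless _ (hmem i hi') (by rw [e1, h]; simp)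
  rw [e2, e3, e4]
  simp only [e1, Sym2.mem_iff, Fin.val_inj]
  by_cases hu : x = u
  · have hv : x ≠ v := fun h => huv (hu.symm.trans h)
    simp [hu, huv]
  · simp [hu]

end WGraph

/-! ## Correctness of the sampling program -/

section Correctness

open WGraph

theorem exec_degreeLoop {n : ℕ} {src dst : ℕ → ℕ} {wts : ℕ → ℝ} {ℓ : ℝ} (r i : ℕ) {s : Mem}
    (h0 : s.nreg 0 = n) (h2 : s.nreg 2 = 0) (h3 : s.nreg 3 = i) (h4 : s.nreg 4 = 1)
    (hℓ : s.rreg 0 = ℓ) (hs : s.narr 0 = src) (hd : s.narr 1 = dst) (hw : s.rarr 0 = wts)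
    (hD : ∀ x, s.rarr 2 x = partialDegree src dst wts i x) {m : ℕ} (h1 : s.nreg 1 = m) :
    ∃ s' : Mem, iterRounds (Prog.ops degreeBody).exec r s = PMF.pure (s', 12 * r + 1) ∧
      s'.nreg 0 = n ∧ s'.nreg 1 = m ∧ s'.nreg 2 = 0 ∧ s'.nreg 4 = 1 ∧ s'.rreg 0 = ℓ ∧
      s'.narr 0 = src ∧ s'.narr 1 = dst ∧ s'.rarr 0 = wts ∧
      ∀ x, s'.rarr 2 x = partialDegree src dst wts (i + r) x := by
  induction r generalizing i s with
  | zero => exact ⟨s, rfl, h0, h1, h2, h4, hℓ, hs, hd, hw, hD⟩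
  | succ r ih =>
    set s₁ := degreeBody.foldl (fun s o => o.run s) s with hs₁
    obtain ⟨s', e1, e2⟩ := ih (i + 1) (s := s₁)
      (by simp [hs₁, degreeBody, Op.run, h0]) (by simp [hs₁, degreeBody, Op.run, h2])
      (by simp [hs₁, degreeBody, Op.run, h3, h4]) (by simp [hs₁, degreeBody, Op.run, h4])
      (by simp [hs₁, degreeBody, Op.run, hℓ]) (by simp [hs₁, degreeBody, Op.run, hs])
      (by simp [hs₁, degreeBody, Op.run, hd]) (by simp [hs₁, degreeBody, Op.run, hw])
      (fun x => by
        rw [partialDegree, Finset.sum_range_succ, ← partialDegree, ← hD x]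
        have e : s₁.rarr 2 = Function.update (Function.update (s.rarr 2) (src i)
            (s.rarr 2 (src i) + wts i)) (dst i) (Function.update (s.rarr 2) (src i)
            (s.rarr 2 (src i) + wts i) (dst i) + wts i) := by
          simp [hs₁, degreeBody, Op.run, hs, hd, hw, h3]
        rw [e]
        by_cases c2 : x = dst i
        · rw [c2, Function.update_self]
          -- The second store reads the cell after the first. If the two ends coincided, the weight
          -- would be added twice, in agreement with `partialDegree`.
          by_cases c1 : dst i = src i
          · rw [c1, Function.update_self, if_pos rfl, add_assoc]
          · rw [Function.update_of_ne c1, if_neg c1, if_pos rfl, zero_add]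
        · rw [Function.update_of_ne c2, if_neg c2, add_zero]
          by_cases c1 : x = src i
          · rw [c1, Function.update_self, if_pos rfl]
          · rw [Function.update_of_ne c1, if_neg c1, add_zero])
      (by simp [hs₁, degreeBody, Op.run, h1])
    refine ⟨s', ?_, ?_⟩
    · rw [iterRounds, Prog.exec_ops, PMF.pure_bind, ← hs₁, e1, PMF.pure_map]
      congr 2
      simp only [degreeBody, List.length_cons, List.length_nil]
      ring
    · rw [add_assoc, add_comm 1 r] at e2
      exact e2

/-- The memory holds the edges in `F` with their sampled weights as output. -/
def HoldsSample {n : ℕ} (G : WGraph n) (C ℓ : ℝ) (F : Finset (Sym2 (Fin n))) (s : Mem) : Prop :=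
  ∃ K : List (Sym2 (Fin n)), K.Nodup ∧ K.toFinset = F ∧ K.length = s.nreg 2 ∧
    ∀ j (hj : j < K.length), ∃ u v : Fin n, K[j] = s(u, v) ∧ s.narr 2 j = u ∧ s.narr 3 j = v ∧
      s.rarr 1 j = G.sampledWeight C ℓ K[j]

variable {n : ℕ} {G : WGraph n} {C ℓ : ℝ}

theorem HoldsSample.outputs (hn : 1 < n) (hC : 0 < C) (hℓ : 0 < ℓ) {F : Finset (Sym2 (Fin n))}
    (hF : F ⊆ G.edges) {s : Mem} (h : HoldsSample G C ℓ F s) :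
    Outputs s (G.sparsifier C ℓ F hF) := by
  obtain ⟨K, h1, rfl, h3, h4⟩ := h
  refine ⟨(finCongr h3.symm).trans ((List.Nodup.getEquiv K h1).trans
    (Equiv.subtypeEquivRight fun e => by simp [sparsifier])), fun i => ?_⟩
  obtain ⟨u, v, e1, e2, e3, e4⟩ := h4 i (by rw [h3]; exact i.2)
  refine ⟨u, v, ?_, e2, e3, ?_⟩
  · simpa using e1
  · rw [sparsifier_weight hn hC hℓ hF]
    · simpa using e4
    · simp

theorem HoldsSample.append {F : Finset (Sym2 (Fin n))} {s s' : Mem} (h : HoldsSample G C ℓ F s)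
    {u v : Fin n} (hF : s(u, v) ∉ F) (h2 : s'.nreg 2 = s.nreg 2 + 1)
    (hs : s'.narr 2 = Function.update (s.narr 2) (s.nreg 2) u)
    (hd : s'.narr 3 = Function.update (s.narr 3) (s.nreg 2) v)
    (hw : s'.rarr 1 = Function.update (s.rarr 1) (s.nreg 2) (G.sampledWeight C ℓ s(u, v))) :
    HoldsSample G C ℓ (insert s(u, v) F) s' := by
  obtain ⟨K, h1, rfl, h3, h4⟩ := h
  refine ⟨K ++ [s(u, v)], ?_, ?_, by simp [h2, h3], fun j hj => ?_⟩
  · rw [List.nodup_append_comm]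
    simpa using ⟨fun h => hF (by simpa using h), h1⟩
  · ext; simp [or_comm]
  · rcases Nat.lt_or_ge j K.length with hj' | hj'
    · obtain ⟨u', v', e1, e2, e3, e4⟩ := h4 j hj'
      have hne : j ≠ s.nreg 2 := by omega
      refine ⟨u', v', ?_, ?_, ?_, ?_⟩
      · rw [List.getElem_append_left hj', e1]
      · rw [hs, Function.update_of_ne hne, e2]
      · rw [hd, Function.update_of_ne hne, e3]
      · rw [hw, Function.update_of_ne hne, e4, List.getElem_append_left hj']
    · have hj'' : j = K.length := by simp at hj; omega
      subst hj''
      refine ⟨u, v, by simp, ?_, ?_, ?_⟩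
      · rw [hs, h3, Function.update_self]
      · rw [hd, h3, Function.update_self]
      · rw [hw, ← h3, Function.update_self]; simp

/-- Each flip of the program uses the same coin as the corresponding step of `randomSubset`. The
loop invariant is that the memory holds the part `F₀` already chosen, which lies among the edges
before position `i`; a round costs at most 30 steps and one loop test. -/
theorem coupled_sampleLoop {src dst : ℕ → ℕ} {wts : ℕ → ℝ} {m : ℕ}
    {ed : ℕ → Sym2 (Fin n)} (h1 : Set.InjOn ed (Finset.Ico 0 (0 + m)))
    (h3 : ∀ i < m, ∃ u v : Fin n, ed i = s(u, v) ∧ src i = u ∧ dst i = v ∧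
      wts i = G.weight (ed i)) (r i : ℕ) (hir : i + r = m) (F₀ : Finset (Sym2 (Fin n))) {s : Mem}
    (g3 : s.nreg 3 = i) (g4 : s.nreg 4 = 1) (r0 : s.rreg 0 = ℓ)
    (r4 : s.rreg 4 = C * Real.log n ^ 3) (r6 : s.rreg 6 = 1) (hs : s.narr 0 = src)
    (hd : s.narr 1 = dst) (hw : s.rarr 0 = wts) (hD : ∀ x : Fin n, s.rarr 2 x = G.deg x)
    (hF₀ : F₀ ⊆ (Finset.Ico 0 i).image ed) (hK : HoldsSample G C ℓ F₀ s) :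
    Coupled (randomSubset (G.edgeProb C ℓ) ed i r) (iterRounds sampleBody.exec r s)
      fun F x => F₀ ∪ F ⊆ (Finset.Ico 0 (0 + m)).image ed ∧ HoldsSample G C ℓ (F₀ ∪ F) x.1 ∧
        x.2 ≤ 31 * r + 1 := by
  induction r generalizing i F₀ s with
  | zero =>
    obtain rfl : i = m := by omega
    refine Coupled.pure ⟨?_, ?_, by simp⟩
    · simpa using hF₀
    · simpa using hK
  | succ r ih =>
    have him : i < m := by omega
    obtain ⟨u, v, e1, e2, e3, e4⟩ := h3 i him
    obtain ⟨s', t, q, hex, hq, hs'⟩ := exec_sampleBody r6 g4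
    have hq' : q = G.edgeProb C ℓ (ed i) := by
      rw [hq, e1, edgeProb_mk, halfProb, halfProb, g3, hs, hd, hw, r4, r0, e2, e3, hD, hD, e4,
        G.wt_comm v u, e1]
      rfl
    have hnot : ed i ∉ F₀ := fun h => by
      obtain ⟨j, hj, hij⟩ := Finset.mem_image.1 (hF₀ h)
      have hj' := (Finset.mem_Ico.1 hj).2
      have := h1 (by simp; omega) (by simpa using him) hij
      omega
    rw [randomSubset, iterRounds, hex, PMF.bind_map, hq']
    refine (Coupled.refl _).bind fun b b' hb => ?_
    subst hb
    obtain ⟨f1, f2, f3, f4, f5, f6, f7, f8, f9, f10, f11, f12, f13, f14⟩ := hs' b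
    have hnew : HoldsSample G C ℓ (if b then insert (ed i) F₀ else F₀) (s' b) := by
      cases b
      · simp only [Bool.false_eq_true, if_false] at f11 f12 f13 f14 ⊢
        obtain ⟨K, k1, k2, k3, k4⟩ := hK
        exact ⟨K, k1, k2, by rw [k3, f11, add_zero], by rw [f12, f13, f14]; exact k4⟩
      · simp only [if_true] at f11 f12 f13 f14 ⊢
        rw [e1] at hnot ⊢
        refine hK.append hnot f11 ?_ ?_ ?_
        · rw [f12, hs, g3, e2]
        · rw [f13, hd, g3, e3]
        · rw [f14, hw, g3, e4, hq', e1, sampledWeight]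
    have hsub : (if b then insert (ed i) F₀ else F₀) ⊆ (Finset.Ico 0 (i + 1)).image ed := by
      have h0 : F₀ ⊆ (Finset.Ico 0 (i + 1)).image ed := hF₀.trans (Finset.image_subset_image
        (Finset.Ico_subset_Ico_right (by omega)))
      split_ifs
      · exact Finset.insert_subset (Finset.mem_image_of_mem _ (by simp)) h0
      · exact h0
    have := ih (i + 1) (by omega) (if b then insert (ed i) F₀ else F₀) (s := s' b)
      (by rw [f2, g3]) f3 (f4.trans r0) (f5.trans r4) f6 (f7.trans hs) (f8.trans hd) (f9.trans hw)
      (by rw [f10]; exact hD) hsub hnew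
    refine this.map fun F x hx => ?_
    obtain ⟨x1, x2, x3⟩ := hx
    have hu : (if b then insert (ed i) F₀ else F₀) ∪ F =
        F₀ ∪ (if b then insert (ed i) F else F) := by
      cases b
      · rfl
      · ext; simp
    rw [hu] at x1 x2
    refine ⟨x1, x2, ?_⟩
    dsimp only
    omega

theorem coupled_sampleProg (hn : 1 < n) (hC : 0 < C) (hℓ : 0 < ℓ) {m : ℕ} (hm : 0 < m)
    {src dst : ℕ → ℕ} {wts : ℕ → ℝ} (hG : G.StoredIn m src dst wts) :
    ∃ ed : ℕ → Sym2 (Fin n), Set.InjOn ed (Finset.Ico 0 (0 + m)) ∧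
      (Finset.Ico 0 (0 + m)).image ed = G.edges ∧
      Coupled (randomSubset (G.edgeProb C ℓ) ed 0 m)
        ((sampleProg C).exec (inputMem n m ℓ src dst wts))
        fun F x => (∃ hF : F ⊆ G.edges, Outputs x.1 (G.sparsifier C ℓ F hF)) ∧ x.2 ≤ 60 * m := by
  obtain ⟨ed, h1, h2, h3⟩ := hG.exists_enumeration hm
  refine ⟨ed, h1, h2, ?_⟩
  set s₀ := inputMem n m ℓ src dst wts with hs₀
  set s₁ := (Op.nconst 4 1).run s₀ with hs₁
  obtain ⟨s₂, a1, a2, a3, a4, a5, a6, a7, a8, a9, a10⟩ := exec_degreeLoop (n := n) (ℓ := ℓ)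
    (src := src) (dst := dst) (wts := wts) (m := m) m 0 (s := s₁)
    (by simp [hs₁, hs₀, Op.run, inputMem]) (by simp [hs₁, hs₀, Op.run, inputMem])
    (by simp [hs₁, hs₀, Op.run, inputMem]) (by simp [hs₁, Op.run])
    (by simp [hs₁, hs₀, Op.run, inputMem]) (by simp [hs₁, hs₀, Op.run, inputMem])
    (by simp [hs₁, hs₀, Op.run, inputMem]) (by simp [hs₁, hs₀, Op.run, inputMem])
    (by simp [hs₁, hs₀, Op.run, inputMem, partialDegree])
    (by simp [hs₁, hs₀, Op.run, inputMem])
  set s₃ := (scaleCode C).foldl (fun s o => o.run s) s₂ with hs₃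
  have hs₃1 : s₃.nreg 1 = m := by simp [hs₃, scaleCode, Op.run, a3]
  have hloop : (Prog.loop 1 (.ops degreeBody)).exec s₁ = PMF.pure (s₂, 12 * m + 1) := by
    rw [Prog.exec, ← a1]
    simp [hs₁, hs₀, Op.run, inputMem]
  have hexec : (sampleProg C).exec s₀ = (iterRounds sampleBody.exec m s₃).map fun x =>
      (x.1, 1 + (12 * m + 1 + (9 + x.2))) := by
    rw [sampleProg, Prog.exec, Prog.exec, PMF.pure_bind, ← hs₁, Prog.exec, hloop, PMF.pure_bind,
      Prog.exec, Prog.exec_ops, PMF.pure_bind, ← hs₃, Prog.exec, hs₃1, PMF.map_comp, PMF.map_comp]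
    rfl
  rw [hexec, ← PMF.map_id (randomSubset _ ed 0 m)]
  refine (coupled_sampleLoop (G := G) (C := C) (ℓ := ℓ) h1 h3 m 0 (by omega) ∅ (s := s₃)
    ?_ ?_ ?_ ?_ ?_ ?_ ?_ ?_ ?_ (by simp) ?_).map fun F x hx => ?_
  · simp [hs₃, scaleCode, Op.run]
  · simp [hs₃, scaleCode, Op.run, a5]
  · simp [hs₃, scaleCode, Op.run, a6]
  · simp [hs₃, scaleCode, Op.run, a2, pow_succ]
  · simp [hs₃, scaleCode, Op.run]
  · simp [hs₃, scaleCode, Op.run, a7]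
  · simp [hs₃, scaleCode, Op.run, a8]
  · simp [hs₃, scaleCode, Op.run, a9]
  · intro x
    rw [← partialDegree_eq h1 h2 h3 x]
    simpa [hs₃, scaleCode, Op.run] using a10 x
  · exact ⟨[], by simp, by simp, by simp [hs₃, scaleCode, Op.run, a4], by simp⟩
  · obtain ⟨x1, x2, x3⟩ := hx
    rw [Finset.empty_union] at x1 x2
    rw [h2] at x1
    exact ⟨⟨x1, x2.outputs hn hC hℓ x1⟩, by dsimp only; omega⟩

/-- An output determines its edge set. Hence the event of outputting the graph of `F` corresponds
under the coupling exactly to drawing `F`, which gives an equality of probabilities. -/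
theorem Outputs.subset_unique {s : Mem} {F F' : Finset (Sym2 (Fin n))} {hF : F ⊆ G.edges}
    {hF' : F' ⊆ G.edges} (h : Outputs s (G.sparsifier C ℓ F hF))
    (h' : Outputs s (G.sparsifier C ℓ F' hF')) : F = F' :=
  Finset.ext fun e => (h.mem_edges_iff e).trans (h'.mem_edges_iff e).symm

end Correctness

/-! ### Assembly of the theorem. -/

theorem theorem3p1 (k : ℕ) (hk : 1 ≤ k) (c : ℕ) (a : ℝ) (ha : 1 ≤ a) :
    ∃ C₀ α β γ : ℝ, 0 < C₀ ∧ 0 < α ∧ 0 < β ∧ 0 < γ ∧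
      ∀ C : ℝ, C₀ ≤ C →
        ∃ (P : Prog) (K T : ℝ) (d : ℕ),
          ∀ (n : ℕ) (G : WGraph n),
            k < n →
            (∀ u, 0 < G.deg u) →
            1 / Real.log n ≤ G.rhoBar k →
            G.lapEig (n - k) < 2 →
            ∀ (ℓ : ℝ), (2 - G.lapEig (n - k)) / a ≤ ℓ → ℓ ≤ a * (2 - G.lapEig (n - k)) →
            ∀ (m : ℕ) (src dst : ℕ → ℕ) (wts : ℕ → ℝ), G.StoredIn m src dst wts →
              -- nearly-linear running time, whatever the coins show
              (∀ x ∈ (P.exec (inputMem n m ℓ src dst wts)).support,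
                (x.2 : ℝ) ≤ T * m * Real.log n ^ d) ∧
              -- every edge is kept independently with its probability, and reweighted
              (∀ (F : Finset (Sym2 (Fin n))) (hF : F ⊆ G.edges),
                (P.exec (inputMem n m ℓ src dst wts)).toOuterMeasure
                    {x | Outputs x.1 (G.sparsifier C ℓ F hF)} =
                  ENNReal.ofReal ((∏ e ∈ F, G.edgeProb C ℓ e) *
                    ∏ e ∈ G.edges \ F, (1 - G.edgeProb C ℓ e))) ∧
              -- with high probability the output is a sparsifier with the stated properties
              ENNReal.ofReal (1 - 1 / (n : ℝ) ^ c) ≤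
                (P.exec (inputMem n m ℓ src dst wts)).toOuterMeasure
                  {x | ∃ (F : Finset (Sym2 (Fin n))) (hF : F ⊆ G.edges),
                    Outputs x.1 (G.sparsifier C ℓ F hF) ∧
                    (F.card : ℝ) ≤ K * (n * Real.log n ^ 3 / (2 - G.lapEig (n - k))) ∧
                    α * G.rhoBar k ≤ (G.sparsifier C ℓ F hF).rhoBar k ∧
                    β * G.signlessEig (k + 1) ≤ (G.sparsifier C ℓ F hF).signlessEig (k + 1) ∧
                    (G.sparsifier C ℓ F hF).signlessEig (k + 1) ≤ γ * G.signlessEig (k + 1)} := by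
  have ha0 : 0 < a := by linarith
  -- The upper spectral constant is 3 (Chernoff) times 4 (mass) times `k + 1` (trace). The running
  -- time is linear in `m`, so the exponent `d` is 0.
  refine ⟨512 * a * (c + 5), 1 / 12, 1 / 24, 12 * (k + 1), by positivity, by norm_num, by norm_num,
    by positivity, fun C hC => ⟨sampleProg C, 3 * a * C, 60, 0, ?_⟩⟩
  intro n G hkn hG hρ hlap ℓ hℓ1 hℓ2 m src dst wts hst
  have hn : 1 < n := by omega
  have hC0 : 0 < C := lt_of_lt_of_le (by positivity) hC
  have hμ : 2 - G.lapEig (n - k) = G.signlessEig (k + 1) := by rw [G.lapEig_eq hkn]; ring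
  have hμ0 : 0 < G.signlessEig (k + 1) := by linarith
  have hℓ : 0 < ℓ := (div_pos (by linarith) ha0).trans_le hℓ1
  -- A graph with positive degrees has an edge. This lets the constant overhead of the program be
  -- absorbed: at most `43 m + 12` steps, hence at most `60 m`.
  have hm : 0 < m := by
    rcases Nat.eq_zero_or_pos m with rfl | h
    · exfalso
      have hE : G.edges = ∅ := Finset.eq_empty_of_forall_notMem fun e he => by
        obtain ⟨i, hi, -⟩ := (hst.mem_edges_iff e).1 he
        omega
      have := hG ⟨0, by omega⟩
      rw [WGraph.deg_eq_sum_edges, hE] at this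
      simp at this
    · exact h
  obtain ⟨ed, e1, e2, hcpl⟩ := coupled_sampleProg hn hC0 hℓ hm hst
  have hlaw := fun A => randomSubset_toOuterMeasure (p := G.edgeProb C ℓ)
    (fun e => WGraph.edgeProb_nonneg hn hC0 hℓ e) (fun e => WGraph.edgeProb_le_one e) m 0 e1 A
  rw [e2] at hlaw
  refine ⟨fun x hx => ?_, fun F hF => ?_, ?_⟩
  · obtain ⟨F, -, hF⟩ := hcpl.exists_of_mem_support hx
    rw [pow_zero, mul_one]
    exact_mod_cast hF
  · rw [← hcpl.toOuterMeasure_eq (A := {F}) fun F' x hx => ?_, hlaw, subsetProb_mem_singleton _ hF,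
      subsetWeight]
    obtain ⟨⟨hF', hout⟩, -⟩ := hx
    constructor
    · rintro rfl
      exact hout
    · exact fun h => Outputs.subset_unique hout h
  · have hgood := WGraph.one_sub_le_subsetProb_isGoodSample (ℓ := ℓ) hk ha hC hkn hG hρ hμ0
      (by rwa [← hμ]) (by rwa [← hμ])
    refine (ENNReal.ofReal_le_ofReal hgood).trans ?_
    refine le_trans (le_of_eq (hlaw _).symm) (hcpl.toOuterMeasure_le
      (A := {F | ∃ hF : F ⊆ G.edges, G.IsGoodSample C ℓ k (3 * a * C) (1 / 12) (1 / 24)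
        (12 * (k + 1)) F hF}) fun F x hx hF => ?_)
    obtain ⟨⟨hF', hout⟩, -⟩ := hx
    obtain ⟨_, hg⟩ := hF
    exact ⟨F, hF', hout, hg⟩
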